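/- Let $\kappa$ be a field and let $m,d\ge 1$ be integers. For $n\ge 1$ let $q_0:\kappa[t]/(t^n)\to\kappa$, $t\mapsto 0$, be the standard section and let $G_n=\underline{\mathrm{Aut}}(\kappa[t]/(t^n),q_0)$ be the group functor of automorphisms of the standard pointed curvilinear algebra. Let $E_{m,d}$ be the functor of framed extensions: for a $\kappa$-algebra $R$, $E_{m,d}(R)$ is the set of homomorphisms of $R$-algebras $\varphi:R[t]/(t^m)\to R[t]/(t^{md})$ that are compatible with the sections $q_0$ and finite locally free of degree $d$. The group $G_m$ acts on $E_{m,d}$ from the left by $g\cdot\varphi=\varphi\circ g^{-1}$. Let $V\subseteq E_{m,d}$ be the subfunctor of those $\varphi$ with $\varphi(t)=t^d p(t)$, where the coefficients $a_l$ of $t^l$ in $p$ satisfy $a_0=1$ and $a_{kd}=0$ for $k=1,\dots,m-2$. For $n\ge 1$ let $\mathcal F_n^c$ be the stack of pointed curvilinear algebras of length $n$: its objects over $\operatorname{Spec}R$ are the pairs $(B,q)$ of a finite locally free $R$-algebra $B$ of degree $n$ and a section $q:B\to R$ of $R\to B$ such that $q^*:\operatorname{Spec}R\to\operatorname{Spec}B$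 factors through the open complement of the closed subscheme defined by the first Fitting ideal of $\Omega_{B/R}$ and through the closed subscheme $\mathcal S_n$, where $\mathcal S_1=\operatorname{Spec}B$ and $\mathcal S_{h+1}\subseteq\mathcal S_h$ is defined by the $0$-th Fitting ideal of $\Omega_{\mathcal S_h/R}$. Let $\mathcal E_{m,d}^c$ be the stack whose objects over $\operatorname{Spec} R$ are the extensions $(A\hookrightarrow B,q)$, where $A$ is a finite locally free $R$-algebra of degree $m$, $B$ is finite locally free of degree $d$ over $A$, and $(B,q)\in\mathcal F_{md}^c(R)$. Then: 1. $V$ is isomorphic to the affine space $\mathbb A_\kappa^{(m-1)(d-1)}$. 2. If $d=1$ or the characteristic of $\kappa$ does not divide $m$, then the canonical morphism $V\hookrightarrow E_{m,d}\to[E_{m,d}/G_m]$ to the quotient stack (for the étale topology) is an isomorphism; in particular $[E_{m,d}/G_m]\simeq\mathbb A_\kappa^{(m-1)(d-1)}$. 3. If the characteristic of $\kappa$ is $0$ or at least $md$, then the morphism $\mathcal E_{m,d}^c\to\mathcal F_{md}^c$, $(A\hookrightarrow B,q)\mapsto(B,q)$, is an affine bundle of dimension $(m-1)(d-1)$: its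 base change to any affine scheme $S\to\mathcal F_{md}^c$ is, Zariski-locally on $S$, isomorphic to $\mathbb A_S^{(m-1)(d-1)}$ over $S$. Moreover, $\mathcal F_{md}^c$ contains the standard object $(R[t]/(t^{md}),q_0)$ over every $\kappa$-algebra $R$, and each of its objects is Zariski-locally on the base isomorphic to it (so that $\mathcal F_{md}^c$ is the classifying stack $\mathcal BG_{md}$). -/

import Mathlib

open CategoryTheory Polynomial Opposite

universe u

namespace Curvilinear

/-- A ring homomorphism is finite locally free of degree `n`. -/
def IsFinLocFree {A B : Type*} [CommRing A] [CommRing B] (f : A →+* B) (n : ℕ) : Prop :=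
  f.Finite ∧ f.Flat ∧ f.FinitePresentation ∧ ∀ x : PrimeSpectrum A, f.finrank x = n

/-- Being finite locally free of degree `n` is stable under base change. -/
theorem IsFinLocFree.baseChange {A B A' B' : Type u} [CommRing A] [CommRing B] [CommRing A']
    [CommRing B'] [Algebra A B] [Algebra A A'] [Algebra A' B'] [Algebra B B'] [Algebra A B']
    [IsScalarTower A A' B'] [IsScalarTower A B B'] [Algebra.IsPushout A B A' B'] {n : ℕ}
    (h : IsFinLocFree (algebraMap A B) n) : IsFinLocFree (algebraMap A' B') n := by
  obtain ⟨h1, h2, h3, h4⟩ := h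
  have : Algebra.IsPushout A A' B B' := Algebra.IsPushout.symm inferInstance
  refine ⟨RingHom.finite_isStableUnderBaseChange _ _ _ _ h1,
    RingHom.Flat.isStableUnderBaseChange _ _ _ _ h2,
    RingHom.finitePresentation_isStableUnderBaseChange _ _ _ _ h3, fun x => ?_⟩
  have : Module.Finite A B := RingHom.finite_algebraMap.mp h1
  have : Module.Flat A B := RingHom.flat_algebraMap_iff.mp h2
  rw [RingHom.finrank_algebraMap, Algebra.rankAtStalk_eq_of_isPushout A B A' B' x,
    ← RingHom.finrank_algebraMap]
  exact h4 _

/-! ### The standard pointed curvilinear algebra -/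

/-- The ring `R[t]/(t^n)`; the class of `t` is `AdjoinRoot.root _`. -/
abbrev Trunc (n : ℕ) (R : Type*) [CommRing R] : Type _ := AdjoinRoot (X ^ n : R[X])

namespace Trunc

/-- The class of `t` in `R[t]/(t^n)`. -/
noncomputable abbrev t (n : ℕ) (R : Type*) [CommRing R] : Trunc n R := AdjoinRoot.root (X ^ n : R[X])

theorem t_pow (n : ℕ) (R : Type*) [CommRing R] : t n R ^ n = 0 := by
  have := AdjoinRoot.mk_self (f := (X ^ n : R[X]))
  rwa [map_pow, AdjoinRoot.mk_X] at this

/-- The `R`-algebra homomorphism `R[t]/(t^n) → S` with `t ↦ a`, where `a ^ n = 0`. -/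
noncomputable def liftHom {n : ℕ} {R S : Type*} [CommRing R] [CommRing S] [Algebra R S] (a : S)
    (ha : a ^ n = 0) : Trunc n R →ₐ[R] S :=
  AdjoinRoot.liftAlgHom _ (Algebra.ofId R S) a (by simpa using ha)

@[simp]
theorem liftHom_t {n : ℕ} {R S : Type*} [CommRing R] [CommRing S] [Algebra R S] (a : S)
    (ha : a ^ n = 0) : liftHom (R := R) a ha (t n R) = a := by
  simp [liftHom]

/-- The standard section `q₀ : R[t]/(t^n) → R`, `t ↦ 0`. -/
noncomputable def pt (n : ℕ) [NeZero n] (R : Type*) [CommRing R] : Trunc n R →ₐ[R] R :=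
  liftHom 0 (zero_pow (NeZero.ne n))

@[simp]
theorem pt_t (n : ℕ) [NeZero n] (R : Type*) [CommRing R] : pt n R (t n R) = 0 := by
  simp [pt]

/-- The map `R[t]/(t^n) → S[t]/(t^n)` induced by `R → S`, with `t ↦ t`. -/
noncomputable def map (n : ℕ) {R S : Type*} [CommRing R] [CommRing S] (u : R →+* S) :
    Trunc n R →+* Trunc n S :=
  AdjoinRoot.map u _ _ (by simp)

@[simp]
theorem map_t (n : ℕ) {R S : Type*} [CommRing R] [CommRing S] (u : R →+* S) :
    map n u (t n R) = t n S := by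
  simp [map]

@[simp]
theorem map_algebraMap (n : ℕ) {R S : Type*} [CommRing R] [CommRing S] (u : R →+* S) (r : R) :
    map n u (algebraMap R _ r) = algebraMap S _ (u r) := by
  simp [map, AdjoinRoot.algebraMap_eq]

@[simp]
theorem map_mk (n : ℕ) {R S : Type*} [CommRing R] [CommRing S] (u : R →+* S) (p : R[X]) :
    map n u (AdjoinRoot.mk _ p) = AdjoinRoot.mk _ (p.map u) := by
  rw [map, AdjoinRoot.map, AdjoinRoot.lift_mk, ← Polynomial.eval₂_map, ← AdjoinRoot.aeval_eq,
    Polynomial.aeval_def, AdjoinRoot.algebraMap_eq]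

@[simp]
theorem map_id (n : ℕ) {R : Type*} [CommRing R] (x : Trunc n R) : map n (RingHom.id R) x = x := by
  obtain ⟨p, rfl⟩ := AdjoinRoot.mk_surjective x
  simp

@[simp]
theorem map_map (n : ℕ) {R S T : Type*} [CommRing R] [CommRing S] [CommRing T] (u : R →+* S)
    (v : S →+* T) (x : Trunc n R) : map n v (map n u x) = map n (v.comp u) x := by
  obtain ⟨p, rfl⟩ := AdjoinRoot.mk_surjective x
  simp [Polynomial.map_map]

theorem pt_map (n : ℕ) [NeZero n] {R S : Type*} [CommRing R] [CommRing S] (u : R →+* S)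
    (x : Trunc n R) : pt n S (map n u x) = u (pt n R x) := by
  have : (pt n S : Trunc n S →+* S).comp (map n u) = u.comp (pt n R : Trunc n R →+* R) := by
    apply AdjoinRoot.ringHom_ext
    · ext r
      have h1 := map_algebraMap n u r
      have h2 := (pt n R).commutes r
      have h3 := (pt n S).commutes (u r)
      simp only [AdjoinRoot.algebraMap_eq] at h1 h2 h3
      simp [h1, h2, h3]
    · simp
  exact congr($this x)

/-- Base change of an `R`-algebra homomorphism `R[t]/(t^m) → R[t]/(t^n)` along `R → S`. -/
noncomputable def baseChange {m n : ℕ} {R S : Type*} [CommRing R] [CommRing S] (u : R →+* S)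
    (φ : Trunc m R →ₐ[R] Trunc n R) : Trunc m S →ₐ[S] Trunc n S :=
  liftHom (map n u (φ (t m R))) (by rw [← map_pow, ← map_pow, t_pow, map_zero, map_zero])

@[simp]
theorem baseChange_t {m n : ℕ} {R S : Type*} [CommRing R] [CommRing S] (u : R →+* S)
    (φ : Trunc m R →ₐ[R] Trunc n R) : baseChange u φ (t m S) = map n u (φ (t m R)) := by
  simp [baseChange]

@[simp]
theorem baseChange_map {m n : ℕ} {R S : Type*} [CommRing R] [CommRing S] (u : R →+* S)
    (φ : Trunc m R →ₐ[R] Trunc n R) (x : Trunc m R) :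
    baseChange u φ (map m u x) = map n u (φ x) := by
  have : (baseChange u φ : Trunc m S →+* Trunc n S).comp (map m u) =
      (map n u).comp (φ : Trunc m R →+* Trunc n R) := by
    apply AdjoinRoot.ringHom_ext
    · ext r
      have h1 := map_algebraMap m u r
      have h2 := φ.commutes r
      have h3 := (baseChange u φ).commutes (u r)
      have h4 := map_algebraMap n u r
      simp only [AdjoinRoot.algebraMap_eq] at h1 h2 h3 h4
      simp [h1, h2, h3, h4]
    · simp
  exact congr($this x)

theorem hom_ext {n : ℕ} {R S : Type*} [CommRing R] [CommRing S] [Algebra R S]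
    {f g : Trunc n R →ₐ[R] S} (h : f (t n R) = g (t n R)) : f = g :=
  AdjoinRoot.algHom_ext h

theorem baseChange_id {m n : ℕ} {R : Type*} [CommRing R] (φ : Trunc m R →ₐ[R] Trunc n R) :
    baseChange (RingHom.id R) φ = φ := hom_ext (by simp)

theorem baseChange_baseChange {m n : ℕ} {R S T : Type*} [CommRing R] [CommRing S] [CommRing T]
    (u : R →+* S) (v : S →+* T) (φ : Trunc m R →ₐ[R] Trunc n R) :
    baseChange v (baseChange u φ) = baseChange (v.comp u) φ := hom_ext (by simp)

theorem baseChange_comp {l m n : ℕ} {R S : Type*} [CommRing R] [CommRing S] (u : R →+* S)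
    (φ : Trunc m R →ₐ[R] Trunc n R) (ψ : Trunc l R →ₐ[R] Trunc m R) :
    baseChange u (φ.comp ψ) = (baseChange u φ).comp (baseChange u ψ) := hom_ext (by simp)

theorem baseChange_refl {n : ℕ} {R S : Type*} [CommRing R] [CommRing S] (u : R →+* S) :
    baseChange u (AlgHom.id R (Trunc n R)) = AlgHom.id S (Trunc n S) := hom_ext (by simp)

theorem baseChange_pointed {m n : ℕ} [NeZero m] [NeZero n] {R S : Type*} [CommRing R] [CommRing S]
    (u : R →+* S) {φ : Trunc m R →ₐ[R] Trunc n R} (h : (pt n R).comp φ = pt m R) :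
    (pt n S).comp (baseChange u φ) = pt m S := by
  apply hom_ext
  have := congr($h (t m R))
  simp only [AlgHom.comp_apply, pt_t] at this
  simp [pt_map, this]

/-- `S[t]/(t^n)` is the base change of `R[t]/(t^n)`. -/
theorem isPushout (n : ℕ) (R S : Type*) [CommRing R] [CommRing S] [Algebra R S]
    [Algebra (Trunc n R) (Trunc n S)]
    [IsScalarTower R (Trunc n R) (Trunc n S)]
    (h : algebraMap (Trunc n R) (Trunc n S) = map n (algebraMap R S)) :
    Algebra.IsPushout R S (Trunc n R) (Trunc n S) := by
  constructor
  rcases subsingleton_or_nontrivial S with hS | hS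
  · have : Subsingleton (Trunc n S) := Module.subsingleton S _
    have : Subsingleton (TensorProduct R S (Trunc n R)) := Module.subsingleton S _
    exact IsBaseChange.of_equiv
      { toFun := fun _ => 0, invFun := fun _ => 0, map_add' := by simp, map_smul' := by simp,
        left_inv := fun _ => Subsingleton.elim _ _, right_inv := fun _ => Subsingleton.elim _ _ }
      (fun _ => Subsingleton.elim _ _)
  have : Nontrivial R := (algebraMap R S).domain_nontrivial
  let b := AdjoinRoot.powerBasisAux' (monic_X_pow (R := R) n)
  let b' := AdjoinRoot.powerBasisAux' (monic_X_pow (R := S) n)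
  have hd : (X ^ n : R[X]).natDegree = (X ^ n : S[X]).natDegree := by simp
  let e := (b.baseChange S).equiv b' (finCongr hd)
  refine IsBaseChange.of_equiv e (fun x => ?_)
  have key : (e.toLinearMap.restrictScalars R) ∘ₗ (TensorProduct.mk R S (Trunc n R) 1) =
      (IsScalarTower.toAlgHom R (Trunc n R) (Trunc n S)).toLinearMap := by
    refine b.ext fun i => ?_
    have hb : b i = t n R ^ (i : ℕ) := (AdjoinRoot.powerBasis' (monic_X_pow (R := R) n)).basis_eq_pow i
    have hb' : b' (finCongr hd i) = t n S ^ (i : ℕ) :=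
      (AdjoinRoot.powerBasis' (monic_X_pow (R := S) n)).basis_eq_pow _
    have h1 : e (b.baseChange S i) = b' (finCongr hd i) := Module.Basis.equiv_apply _ _ _ _
    rw [Module.Basis.baseChange_apply] at h1
    simp only [LinearMap.comp_apply, LinearMap.restrictScalars_apply, TensorProduct.mk_apply,
      AlgHom.toLinearMap_apply, LinearEquiv.coe_coe, h1, hb']
    rw [hb, map_pow]
    congr 1
    simp [h]
  exact congr($key x)

theorem baseChange_isFinLocFree {m n d : ℕ} {R S : Type u} [CommRing R] [CommRing S]
    (u : R →+* S) {φ : Trunc m R →ₐ[R] Trunc n R} (h : IsFinLocFree φ.toRingHom d) :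
    IsFinLocFree (baseChange u φ).toRingHom d := by
  let := u.toAlgebra
  let := (map m u).toAlgebra
  let := (map n u).toAlgebra
  let := φ.toRingHom.toAlgebra
  let := (baseChange u φ).toRingHom.toAlgebra
  let : Algebra (Trunc m R) (Trunc n S) := ((map n u).comp φ.toRingHom).toAlgebra
  have : IsScalarTower R (Trunc m R) (Trunc m S) :=
    .of_algebraMap_eq fun x => (map_algebraMap m u x).symm
  have : IsScalarTower R (Trunc n R) (Trunc n S) :=
    .of_algebraMap_eq fun x => (map_algebraMap n u x).symm
  have : IsScalarTower R (Trunc m R) (Trunc n R) :=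
    .of_algebraMap_eq fun x => (φ.commutes x).symm
  have : IsScalarTower S (Trunc m S) (Trunc n S) :=
    .of_algebraMap_eq fun x => ((baseChange u φ).commutes x).symm
  have : IsScalarTower (Trunc m R) (Trunc n R) (Trunc n S) := .of_algebraMap_eq fun x => rfl
  have : IsScalarTower (Trunc m R) (Trunc m S) (Trunc n S) :=
    .of_algebraMap_eq fun x => (baseChange_map u φ x).symm
  have : IsScalarTower R (Trunc m S) (Trunc n S) := .of_algebraMap_eq fun x =>
    ((baseChange u φ).commutes (u x)).symm
  have hm : Algebra.IsPushout R S (Trunc m R) (Trunc m S) := isPushout m R S rfl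
  have hn : Algebra.IsPushout R S (Trunc n R) (Trunc n S) := isPushout n R S rfl
  have := hm.symm
  have := hn.symm
  have : Algebra.IsPushout (Trunc m R) (Trunc n R) (Trunc m S) (Trunc n S) :=
    (Algebra.IsPushout.comp_iff (R := R) (S := Trunc m R) (R' := S) (S' := Trunc m S)
      (T := Trunc n R) (T' := Trunc n S)).mp ‹_›
  exact IsFinLocFree.baseChange (A := Trunc m R) (B := Trunc n R) (A' := Trunc m S)
    (B' := Trunc n S) h

/-- The coefficient of `t ^ k` (it is `0` for `n ≤ k`). -/
noncomputable def coeff {n : ℕ} {R : Type*} [CommRing R] (x : Trunc n R) (k : ℕ) : R :=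
  (AdjoinRoot.modByMonicHom (monic_X_pow n) x).coeff k

theorem coeff_map {n : ℕ} {R S : Type*} [CommRing R] [CommRing S] (u : R →+* S) (x : Trunc n R)
    (k : ℕ) : coeff (map n u x) k = u (coeff x k) := by
  obtain ⟨p, rfl⟩ := AdjoinRoot.mk_surjective x
  have := Polynomial.map_modByMonic u (p := p) (monic_X_pow (R := R) n)
  simp only [Polynomial.map_pow, Polynomial.map_X] at this
  rw [coeff, map_mk, AdjoinRoot.modByMonicHom_mk, ← this, Polynomial.coeff_map, coeff,
    AdjoinRoot.modByMonicHom_mk]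

theorem coeff_ext {n : ℕ} {R : Type*} [CommRing R] {x y : Trunc n R}
    (h : ∀ k, coeff x k = coeff y k) : x = y := by
  have : AdjoinRoot.modByMonicHom (monic_X_pow n) x = AdjoinRoot.modByMonicHom (monic_X_pow n) y :=
    Polynomial.ext h
  rw [← AdjoinRoot.mk_leftInverse (monic_X_pow n) x, this,
    AdjoinRoot.mk_leftInverse (monic_X_pow n) y]

theorem coeff_sum {n : ℕ} {R : Type*} [CommRing R] (a : ℕ → R) {k : ℕ} (hk : k < n) :
    coeff (AdjoinRoot.mk (X ^ n : R[X]) (∑ i ∈ Finset.range n, C (a i) * X ^ i)) k = a k := by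
  rcases subsingleton_or_nontrivial R with h | h
  · exact Subsingleton.elim _ _
  rw [coeff, AdjoinRoot.modByMonicHom_mk, (Polynomial.modByMonic_eq_self_iff (monic_X_pow n)).mpr]
  · simp [Polynomial.finsetSum_coeff, Polynomial.coeff_C_mul, Polynomial.coeff_X_pow, hk]
  · rw [Polynomial.degree_X_pow]
    refine (Polynomial.degree_sum_le _ _).trans_lt ?_
    refine (Finset.sup_lt_iff (WithBot.bot_lt_coe n)).mpr ?_
    intro i hi
    exact (Polynomial.degree_C_mul_X_pow_le i (a i)).trans_lt (WithBot.coe_lt_coe.mpr (Finset.mem_range.mp hi))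

theorem coeff_of_le {n : ℕ} {R : Type*} [CommRing R] (x : Trunc n R) {k : ℕ} (hk : n ≤ k) :
    coeff x k = 0 := by
  rcases subsingleton_or_nontrivial R with h | h
  · exact Subsingleton.elim _ _
  obtain ⟨p, rfl⟩ := AdjoinRoot.mk_surjective x
  rw [coeff, AdjoinRoot.modByMonicHom_mk]
  refine Polynomial.coeff_eq_zero_of_degree_lt
    ((Polynomial.degree_modByMonic_lt p (monic_X_pow n)).trans_le ?_)
  rw [Polynomial.degree_X_pow]
  exact_mod_cast hk

end Trunc

/-! ### Étale sheaves on affine schemes over a field -/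

section Stacks

variable {κ : Type u} [Field κ]

/-- A family of maps of affine schemes is a (standard) étale covering: étale and jointly surjective.
It is used below for finite families. -/
structure IsEtaleCover {R : CommAlgCat.{u} κ} {ι : Type} (T : ι → CommAlgCat.{u} κ)
    (u : ∀ i, R ⟶ T i) : Prop where
  etale : ∀ i, (u i).hom.toRingHom.Etale
  cover : ∀ x : PrimeSpectrum R, ∃ i, x ∈ Set.range (PrimeSpectrum.comap (u i).hom.toRingHom)

/-- The sheaf condition for a presheaf of sets on affine `κ`-schemes (a functor on `κ`-algebras)
with respect to the étale topology. -/
def IsEtaleSheaf (P : CommAlgCat.{u} κ ⥤ Type u) : Prop :=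
  ∀ (R : CommAlgCat.{u} κ) (ι : Type) (_ : Finite ι) (T : ι → CommAlgCat.{u} κ)
    (u : ∀ i, R ⟶ T i), IsEtaleCover T u → ∀ x : ∀ i, P.obj (T i),
    (∀ (i j : ι) (S : CommAlgCat.{u} κ) (a : T i ⟶ S) (b : T j ⟶ S),
      u i ≫ a = u j ≫ b → P.map a (x i) = P.map b (x j)) →
    ∃! y : P.obj R, ∀ i, P.map (u i) y = x i

/-- Faithfully flat descent for elements of rings. -/
theorem IsEtaleCover.descent {R : CommAlgCat.{u} κ} {ι : Type} [Finite ι]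
    {T : ι → CommAlgCat.{u} κ} {u : ∀ i, R ⟶ T i} (hu : IsEtaleCover T u) (x : ∀ i, T i)
    (hx : ∀ (i j : ι) (S : CommAlgCat.{u} κ) (a : T i ⟶ S) (b : T j ⟶ S),
      u i ≫ a = u j ≫ b → a (x i) = b (x j)) :
    ∃! y : R, ∀ i, u i y = x i := by
  classical
  have := Fintype.ofFinite ι
  let (i : ι) : Algebra R (T i) := (u i).hom.toRingHom.toAlgebra
  have (i : ι) : IsScalarTower κ R (T i) := .of_algebraMap_eq fun r => ((u i).hom.commutes r).symm
  have (i : ι) : Algebra.Etale R (T i) := hu.etale i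
  have : Algebra.Etale R (∀ i, T i) := inferInstance
  have : Module.Flat R (∀ i, T i) := inferInstance
  have : Module.FaithfullyFlat R (∀ i, T i) := by
    refine Module.FaithfullyFlat.of_comap_surjective fun p => ?_
    obtain ⟨i, q, hq⟩ := hu.cover p
    refine ⟨PrimeSpectrum.comap (Pi.evalRingHom (fun i => (T i : Type u)) i) q, ?_⟩
    rw [← hq]
    rfl
  have hinj : Function.Injective (algebraMap R (∀ i, T i)) := FaithfulSMul.algebraMap_injective _ _
  have heff := Algebra.IsEffective.of_faithfullyFlat R (∀ i, T i)
  have hz : Algebra.TensorProduct.includeLeftSubRight R (∀ i, T i) x = 0 := by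
    rw [Algebra.TensorProduct.includeLeftSubRight_apply, sub_eq_zero]
    apply (Algebra.TensorProduct.piRight R R (∀ i, T i) (fun i => (T i : Type u))).injective
    rw [Algebra.TensorProduct.piRight_tmul, Algebra.TensorProduct.piRight_tmul]
    funext j
    apply (Algebra.TensorProduct.comm R (∀ i, T i) (T j)).injective
    apply (Algebra.TensorProduct.piRight R R (T j) (fun i => (T i : Type u))).injective
    rw [Algebra.TensorProduct.comm_tmul, Algebra.TensorProduct.comm_tmul,
      Algebra.TensorProduct.piRight_tmul, Algebra.TensorProduct.piRight_tmul]
    funext i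
    let a : T i ⟶ CommAlgCat.of κ (TensorProduct R (T j) (T i)) :=
      CommAlgCat.ofHom
        ((Algebra.TensorProduct.includeRight : T i →ₐ[R] TensorProduct R (T j) (T i)).restrictScalars κ)
    let b : T j ⟶ CommAlgCat.of κ (TensorProduct R (T j) (T i)) :=
      CommAlgCat.ofHom
        ((Algebra.TensorProduct.includeLeft : T j →ₐ[R] TensorProduct R (T j) (T i)).restrictScalars κ)
    refine hx i j _ a b ?_
    ext r
    exact ((Algebra.TensorProduct.includeRight : T i →ₐ[R] TensorProduct R (T j) (T i)).commutes r).trans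
      ((Algebra.TensorProduct.includeLeft : T j →ₐ[R] TensorProduct R (T j) (T i)).commutes r).symm
  obtain ⟨y, hy⟩ := (heff x).mp hz
  refine ⟨y, fun i => congr_fun hy i, fun y' hy' => hinj ?_⟩
  rw [show algebraMap R (∀ i, T i) y = x from hy]
  funext i
  exact hy' i

/-- Representable functors are étale sheaves. -/
theorem isEtaleSheaf_coyoneda (A : CommAlgCat.{u} κ) :
    IsEtaleSheaf (coyoneda.obj (op A)) := by
  intro R ι _ T u hu x hx
  have key := fun a : A => hu.descent (fun i => (show A ⟶ T i from x i) a)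
    (fun i j S f g h => by
      have h1 : (show A ⟶ T i from x i) ≫ f = (show A ⟶ T j from x j) ≫ g := hx i j S f g h
      simpa using congr($h1 a))
  choose y hy hy' using key
  have e1 : y 1 = 1 := (hy' 1 1 fun i => by simp).symm
  have em (a b : A) : y (a * b) = y a * y b :=
    (hy' (a * b) (y a * y b) fun i => by simp only [map_mul, hy]).symm
  have e0 : y 0 = 0 := (hy' 0 0 fun i => by simp).symm
  have ea (a b : A) : y (a + b) = y a + y b :=
    (hy' (a + b) (y a + y b) fun i => by simp only [map_add, hy]).symm
  have ec (r : κ) : y (algebraMap κ A r) = algebraMap κ R r :=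
    (hy' _ (algebraMap κ R r) fun i => by
      rw [(u i).hom.commutes r]
      exact ((show A ⟶ T i from x i).hom.commutes r).symm).symm
  let f : A →ₐ[κ] R :=
    { toFun := y, map_one' := e1, map_mul' := em, map_zero' := e0, map_add' := ea, commutes' := ec }
  refine ⟨CommAlgCat.ofHom f, fun i => ?_, fun g hg => ?_⟩
  · refine CommAlgCat.hom_ext (AlgHom.ext fun a => ?_)
    exact hy a i
  · refine CommAlgCat.hom_ext (AlgHom.ext fun a => ?_)
    refine hy' a _ fun i => ?_
    have := hg i
    exact congr((show A ⟶ T i from $this) a)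

/-! ### Group actions, torsors and quotient stacks -/

/-- A left action of a group functor on a set-valued functor. -/
structure GrpAction (G : CommAlgCat.{u} κ ⥤ GrpCat.{u}) (P : CommAlgCat.{u} κ ⥤ Type u) where
  smul : ∀ {R : CommAlgCat.{u} κ}, G.obj R → P.obj R → P.obj R
  one_smul : ∀ {R : CommAlgCat.{u} κ} (x : P.obj R), smul (1 : G.obj R) x = x
  mul_smul : ∀ {R : CommAlgCat.{u} κ} (g h : G.obj R) (x : P.obj R),
    smul (g * h) x = smul g (smul h x)
  map_smul : ∀ {R S : CommAlgCat.{u} κ} (u : R ⟶ S) (g : G.obj R) (x : P.obj R),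
    P.map u (smul g x) = smul (G.map u g) (P.map u x)

/-- An object of the quotient stack `[E / G]` over `Spec base`: a `G`-torsor `tot → Spec base`
for the étale topology with a `G`-equivariant map `tot → E`. -/
structure QuotientStack {G : CommAlgCat.{u} κ ⥤ GrpCat.{u}} {E : CommAlgCat.{u} κ ⥤ Type u}
    (a : GrpAction G E) where
  base : CommAlgCat.{u} κ
  tot : CommAlgCat.{u} κ ⥤ Type u
  proj : tot ⟶ coyoneda.obj (op base)
  act : GrpAction G tot
  isSheaf : IsEtaleSheaf tot
  proj_smul : ∀ {S : CommAlgCat.{u} κ} (g : G.obj S) (x : tot.obj S),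
    proj.app S (act.smul g x) = proj.app S x
  simply_transitive : ∀ {S : CommAlgCat.{u} κ} (x y : tot.obj S),
    proj.app S x = proj.app S y → ∃! g : G.obj S, act.smul g x = y
  locally_nonempty : ∃ (ι : Type) (_ : Finite ι) (T : ι → CommAlgCat.{u} κ) (u : ∀ i, base ⟶ T i),
    IsEtaleCover T u ∧ ∀ i, ∃ x : tot.obj (T i), proj.app (T i) x = u i
  toE : tot ⟶ E
  toE_smul : ∀ {S : CommAlgCat.{u} κ} (g : G.obj S) (x : tot.obj S),
    toE.app S (act.smul g x) = a.smul g (toE.app S x)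

namespace QuotientStack

variable {G : CommAlgCat.{u} κ ⥤ GrpCat.{u}} {E : CommAlgCat.{u} κ ⥤ Type u} {a : GrpAction G E}

/-- A morphism of `[E / G]`, over `Spec Y.base → Spec X.base`: an equivariant map of the torsors
over it (so that `Y.tot` is the pullback of `X.tot`) that commutes with the maps to `E`. -/
@[ext]
structure Hom (X Y : QuotientStack a) where
  base : X.base ⟶ Y.base
  tot : Y.tot ⟶ X.tot
  proj_comp : tot ≫ X.proj = Y.proj ≫ coyoneda.map base.op
  equivariant : ∀ {S : CommAlgCat.{u} κ} (g : G.obj S) (y : Y.tot.obj S),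
    tot.app S (Y.act.smul g y) = X.act.smul g (tot.app S y)
  toE_comp : tot ≫ X.toE = Y.toE

instance : Category (QuotientStack a) where
  Hom := Hom
  id X :=
    { base := 𝟙 _, tot := 𝟙 _, proj_comp := by simp, equivariant := by simp, toE_comp := by simp }
  comp {X Y Z} f g :=
    { base := f.base ≫ g.base
      tot := g.tot ≫ f.tot
      proj_comp := by
        rw [Category.assoc, f.proj_comp, ← Category.assoc, g.proj_comp, Category.assoc,
          ← Functor.map_comp, ← op_comp]
      equivariant := fun h y => by simp [f.equivariant, g.equivariant]
      toE_comp := by rw [Category.assoc, f.toE_comp, g.toE_comp] }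
  id_comp f := by apply Hom.ext <;> simp
  comp_id f := by apply Hom.ext <;> simp
  assoc f g h := by apply Hom.ext <;> simp

/-- The trivial torsor over `Spec R` with the orbit map `g ↦ g • x` of a point `x ∈ E(R)`. -/
def ofPoint (a : GrpAction G E) (hG : IsEtaleSheaf (G ⋙ forget GrpCat)) (R : CommAlgCat.{u} κ)
    (x : E.obj R) : QuotientStack a where
  base := R
  tot :=
    { obj := fun S => G.obj S × (R ⟶ S)
      map := fun f => ↾fun p => (G.map f p.1, p.2 ≫ f)
      map_id := fun S => by ext p <;> simp
      map_comp := fun f g => by ext p <;> simp }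
  proj :=
    { app := fun S => ↾fun p => p.2
      naturality := fun S T f => by ext p; rfl }
  act :=
    { smul := fun g p => (g * p.1, p.2)
      one_smul := fun p => by simp
      mul_smul := fun g h p => by simp [mul_assoc]
      map_smul := fun f g p => by simp }
  isSheaf := by
    intro R' ι _ T u hu y hy
    obtain ⟨g, hg, hg'⟩ := hG R' ι ‹_› T u hu (fun i => (y i).1)
      (fun i j S f f' h => congr_arg Prod.fst (hy i j S f f' h))
    obtain ⟨r, hr, hr'⟩ := isEtaleSheaf_coyoneda R R' ι ‹_› T u hu (fun i => (y i).2)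
      (fun i j S f f' h => congr_arg Prod.snd (hy i j S f f' h))
    refine ⟨(g, r), fun i => Prod.ext (hg i) (hr i), fun p hp => Prod.ext ?_ ?_⟩
    · exact hg' _ fun i => congr_arg Prod.fst (hp i)
    · exact hr' _ fun i => congr_arg Prod.snd (hp i)
  proj_smul := fun g p => rfl
  simply_transitive := by
    rintro S ⟨g, r⟩ ⟨g', r'⟩ h
    obtain rfl : r = r' := h
    refine ⟨g' * g⁻¹, by simp, fun k hk => ?_⟩
    have : k * g = g' := congr_arg Prod.fst hk
    simp [← this]
  locally_nonempty := by
    refine ⟨Unit, inferInstance, fun _ => R, fun _ => 𝟙 R, ⟨fun _ => ?_, fun x => ⟨(), x, rfl⟩⟩,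
      fun _ => ⟨(1, 𝟙 R), rfl⟩⟩
    exact RingHom.Etale.of_bijective Function.bijective_id
  toE :=
    { app := fun S => ↾fun p => a.smul p.1 (E.map p.2 x)
      naturality := fun S T f => by ext p; simp [a.map_smul] }
  toE_smul := fun g p => by simp [a.mul_smul]

/-- The canonical morphism `E → [E / G]`. Here `E` is regarded as a stack through its category of
elements. -/
def fromE (a : GrpAction G E) (hG : IsEtaleSheaf (G ⋙ forget GrpCat)) :
    E.Elements ⥤ QuotientStack a where
  obj X := ofPoint a hG X.1 X.2
  map {X Y} f :=
    { base := f.1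
      tot :=
        { app := fun S => ↾fun p => (p.1, f.1 ≫ p.2)
          naturality := fun S T g => by
            ext p
            exact Prod.ext rfl (Category.assoc f.1 p.2 g).symm }
      proj_comp := by ext S p; rfl
      equivariant := fun g y => rfl
      toE_comp := by
        ext S p
        have h : E.map f.1 X.2 = Y.2 := f.2
        change a.smul p.1 (E.map (f.1 ≫ p.2) X.2) = a.smul p.1 (E.map p.2 Y.2)
        exact congr_arg (a.smul p.1)
          ((Functor.map_comp_apply E f.1 p.2 X.2).trans (congr_arg (E.map p.2) h)) }
  map_id X := by
    apply Hom.ext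
    · rfl
    · ext S p
      exact Prod.ext rfl (Category.id_comp _)
  map_comp {X Y Z} f g := by
    apply Hom.ext
    · rfl
    · ext S p
      exact Prod.ext rfl (Category.assoc _ _ _)

end QuotientStack

end Stacks


/-- The ring homomorphism underlying a morphism of `κ`-algebras. -/
def ringHom {κ : Type u} [Field κ] {R S : CommAlgCat.{u} κ} (u : R ⟶ S) : R →+* S :=
  u.hom.toRingHom

theorem ringHom_apply {κ : Type u} [Field κ] {R S : CommAlgCat.{u} κ} (u : R ⟶ S) (x : R) :
    ringHom u x = u x := rfl

theorem ringHom_id {κ : Type u} [Field κ] (R : CommAlgCat.{u} κ) :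
    ringHom (𝟙 R) = RingHom.id R := rfl

theorem ringHom_comp {κ : Type u} [Field κ] {R S T : CommAlgCat.{u} κ} (u : R ⟶ S) (v : S ⟶ T) :
    ringHom (u ≫ v) = (ringHom v).comp (ringHom u) := rfl

/-! ### Framed extensions, the group `G_n`, and the affine space `V` -/

theorem IsFinLocFree.comp_equiv {A A' B : Type u} [CommRing A] [CommRing A'] [CommRing B]
    {f : A →+* B} {n : ℕ} (h : IsFinLocFree f n) (e : A' ≃+* A) :
    IsFinLocFree (f.comp (e : A' →+* A)) n := by
  obtain ⟨h1, h2, h3, h4⟩ := h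
  refine ⟨h1.comp (RingHom.Finite.of_surjective _ e.surjective),
    RingHom.Flat.comp (RingHom.Flat.of_bijective e.bijective) h2,
    h3.comp (RingHom.FinitePresentation.of_bijective e.bijective), fun x => ?_⟩
  rw [RingHom.finrank_comp_right_of_bijective (e : A' →+* A) f e.bijective h1 h2 x
    (PrimeSpectrum.comap (e.symm : A →+* A') x)]
  · exact h4 _
  · rw [← PrimeSpectrum.comap_comp_apply]
    simp

section Standard

variable (κ : Type u) [Field κ]

/-- The functor `E_{m,d}` of framed extensions: over `R` the pointed homomorphisms
`(R[t]/(t^m), q₀) → (R[t]/(t^{md}), q₀)` of `R`-algebras that are finite locally free of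
degree `d`. -/
noncomputable def framedExt (m d : ℕ) [NeZero m] [NeZero d] : CommAlgCat.{u} κ ⥤ Type u where
  obj R := {φ : Trunc m (R : Type u) →ₐ[R] Trunc (m * d) R //
    (Trunc.pt (m * d) R).comp φ = Trunc.pt m R ∧ IsFinLocFree φ.toRingHom d}
  map u := ↾fun φ => ⟨Trunc.baseChange (ringHom u) φ.1,
    Trunc.baseChange_pointed _ φ.2.1, Trunc.baseChange_isFinLocFree _ φ.2.2⟩
  map_id R := ConcreteCategory.hom_ext _ _ fun φ => Subtype.ext (by
    change Trunc.baseChange (ringHom (𝟙 R)) φ.1 = φ.1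
    rw [ringHom_id, Trunc.baseChange_id])
  map_comp u v := ConcreteCategory.hom_ext _ _ fun φ => Subtype.ext (by
    change Trunc.baseChange (ringHom (u ≫ v)) φ.1 =
      Trunc.baseChange (ringHom v) (Trunc.baseChange (ringHom u) φ.1)
    rw [ringHom_comp, Trunc.baseChange_baseChange])

/-- Automorphisms of the pointed `R`-algebra `(R[t]/(t^n), q₀)`. -/
def pointedAut (n : ℕ) [NeZero n] (R : Type u) [CommRing R] :
    Subgroup (Trunc n R ≃ₐ[R] Trunc n R) where
  carrier := {e | (Trunc.pt n R).comp (e : Trunc n R →ₐ[R] Trunc n R) = Trunc.pt n R}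
  one_mem' := AlgHom.comp_id _
  mul_mem' {e f} he hf := by
    change (Trunc.pt n R).comp (e : Trunc n R →ₐ[R] Trunc n R) = Trunc.pt n R at he
    change (Trunc.pt n R).comp (f : Trunc n R →ₐ[R] Trunc n R) = Trunc.pt n R at hf
    change (Trunc.pt n R).comp ((e : Trunc n R →ₐ[R] Trunc n R).comp
      (f : Trunc n R →ₐ[R] Trunc n R)) = Trunc.pt n R
    rw [← AlgHom.comp_assoc, he, hf]
  inv_mem' {e} he := by
    change (Trunc.pt n R).comp (e : Trunc n R →ₐ[R] Trunc n R) = Trunc.pt n R at he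
    change (Trunc.pt n R).comp (e.symm : Trunc n R →ₐ[R] Trunc n R) = Trunc.pt n R
    conv_lhs => rw [← he]
    ext
    simp

/-- Base change of automorphisms of the standard pointed algebra. -/
noncomputable def pointedAutMap (n : ℕ) [NeZero n] {R S : Type u} [CommRing R] [CommRing S]
    (u : R →+* S) : pointedAut n R →* pointedAut n S where
  toFun e := ⟨AlgEquiv.ofAlgHom (Trunc.baseChange u (e.1 : Trunc n R →ₐ[R] Trunc n R))
      (Trunc.baseChange u (e.1.symm : Trunc n R →ₐ[R] Trunc n R))
      (by rw [← Trunc.baseChange_comp]; simp [Trunc.baseChange_refl])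
      (by rw [← Trunc.baseChange_comp]; simp [Trunc.baseChange_refl]),
    Trunc.baseChange_pointed u e.2⟩
  map_one' := Subtype.ext (AlgEquiv.ext fun x =>
    congr($(Trunc.baseChange_refl (n := n) u) x))
  map_mul' e f := Subtype.ext (AlgEquiv.ext fun x =>
    congr($(Trunc.baseChange_comp u (e.1 : Trunc n R →ₐ[R] Trunc n R)
      (f.1 : Trunc n R →ₐ[R] Trunc n R)) x))

theorem pointedAut_ext {n : ℕ} [NeZero n] {R : Type u} [CommRing R] {e f : pointedAut n R}
    (h : e.1 (Trunc.t n R) = f.1 (Trunc.t n R)) : e = f := by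
  refine Subtype.ext (AlgEquiv.ext fun x => ?_)
  have : (e.1 : Trunc n R →ₐ[R] Trunc n R) = (f.1 : Trunc n R →ₐ[R] Trunc n R) := Trunc.hom_ext h
  exact congr($this x)

theorem pointedAutMap_t {n : ℕ} [NeZero n] {R S : Type u} [CommRing R] [CommRing S]
    (u : R →+* S) (e : pointedAut n R) :
    (pointedAutMap n u e).1 (Trunc.t n S) = Trunc.map n u (e.1 (Trunc.t n R)) :=
  Trunc.baseChange_t u (e.1 : Trunc n R →ₐ[R] Trunc n R)

/-- The group `G_n`, the automorphism group functor of the standard pointed curvilinear algebra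
`(κ[t]/(t^n), q₀)`. -/
noncomputable def autGroup (n : ℕ) [NeZero n] : CommAlgCat.{u} κ ⥤ GrpCat.{u} where
  obj R := GrpCat.of (pointedAut n R)
  map u := GrpCat.ofHom (pointedAutMap n (ringHom u))
  map_id R := ConcreteCategory.hom_ext _ _ fun e => by
    change pointedAutMap n (ringHom (𝟙 R)) e = e
    rw [ringHom_id]
    exact pointedAut_ext (by rw [pointedAutMap_t, Trunc.map_id])
  map_comp u v := ConcreteCategory.hom_ext _ _ fun e => by
    change pointedAutMap n (ringHom (u ≫ v)) e =
      pointedAutMap n (ringHom v) (pointedAutMap n (ringHom u) e)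
    rw [ringHom_comp]
    exact pointedAut_ext (by simp only [pointedAutMap_t, Trunc.map_map])

/-- The left action of `G_m` on `E_{m,d}` by change of the framing of the smaller algebra:
`g • φ = φ ∘ g⁻¹`. -/
noncomputable def autAction (m d : ℕ) [NeZero m] [NeZero d] :
    GrpAction (autGroup κ m) (framedExt κ m d) where
  smul {R} (g : pointedAut m R) φ :=
    ⟨φ.1.comp ((g⁻¹).1 : Trunc m R →ₐ[R] Trunc m R), by
      rw [← AlgHom.comp_assoc, φ.2.1]
      exact (g⁻¹).2, φ.2.2.comp_equiv ((g⁻¹).1 : Trunc m R ≃+* Trunc m R)⟩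
  one_smul φ := Subtype.ext (AlgHom.comp_id _)
  mul_smul {R} (g h : pointedAut m R) φ := Subtype.ext (AlgHom.ext fun x => by
    change φ.1 ((g * h)⁻¹.1 x) = φ.1 (h⁻¹.1 (g⁻¹.1 x))
    rw [mul_inv_rev]
    rfl)
  map_smul {R S} u (g : pointedAut m R) φ := Subtype.ext (by
    have h1 := Trunc.baseChange_comp (ringHom u) φ.1 ((g⁻¹).1 : Trunc m R →ₐ[R] Trunc m R)
    have h2 := map_inv (pointedAutMap m (ringHom u)) g
    refine h1.trans ?_
    change (Trunc.baseChange (ringHom u) φ.1).comp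
      ((pointedAutMap m (ringHom u) g⁻¹).1 : Trunc m S →ₐ[S] Trunc m S) = _
    rw [h2]
    rfl)

/-- The truncated polynomial rings form an étale sheaf. -/
theorem Trunc.descent (n : ℕ) {R : CommAlgCat.{u} κ} {ι : Type} [Finite ι]
    {T : ι → CommAlgCat.{u} κ} {u : ∀ i, R ⟶ T i} (hu : IsEtaleCover T u)
    (x : ∀ i, Trunc n (T i))
    (hx : ∀ (i j : ι) (S : CommAlgCat.{u} κ) (a : T i ⟶ S) (b : T j ⟶ S), u i ≫ a = u j ≫ b →
      Trunc.map n (ringHom a) (x i) = Trunc.map n (ringHom b) (x j)) :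
    ∃! y : Trunc n R, ∀ i, Trunc.map n (ringHom (u i)) y = x i := by
  have key := fun k : ℕ => hu.descent (fun i => Trunc.coeff (x i) k) (fun i j S a b h => by
    have := congr_arg (fun z => Trunc.coeff z k) (hx i j S a b h)
    simp only [Trunc.coeff_map] at this
    exact this)
  choose c hc hc' using key
  refine ⟨AdjoinRoot.mk (X ^ n : (R : Type u)[X]) (∑ i ∈ Finset.range n, C (c i) * X ^ i),
    fun i => Trunc.coeff_ext fun k => ?_, fun y hy => Trunc.coeff_ext fun k => ?_⟩
  · rcases lt_or_ge k n with hk | hk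
    · rw [Trunc.coeff_map, Trunc.coeff_sum c hk]
      exact hc k i
    · rw [Trunc.coeff_of_le _ hk, Trunc.coeff_of_le _ hk]
  · rcases lt_or_ge k n with hk | hk
    · rw [Trunc.coeff_sum c hk]
      refine hc' k _ fun i => ?_
      have := congr_arg (fun z => Trunc.coeff z k) (hy i)
      simp only [Trunc.coeff_map] at this
      exact this
    · rw [Trunc.coeff_of_le _ hk, Trunc.coeff_of_le _ hk]

theorem pointedAut_descent (n : ℕ) [NeZero n] {R : CommAlgCat.{u} κ} {ι : Type} [Finite ι]
    {T : ι → CommAlgCat.{u} κ} {u : ∀ i, R ⟶ T i} (hu : IsEtaleCover T u)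
    (e : ∀ i, pointedAut n (T i))
    (he : ∀ (i j : ι) (S : CommAlgCat.{u} κ) (a : T i ⟶ S) (b : T j ⟶ S), u i ≫ a = u j ≫ b →
      pointedAutMap n (ringHom a) (e i) = pointedAutMap n (ringHom b) (e j)) :
    ∃! g : pointedAut n R, ∀ i, pointedAutMap n (ringHom (u i)) g = e i := by
  have inj : ∀ (k : ℕ) (y z : Trunc k R), (∀ i, Trunc.map k (ringHom (u i)) y =
      Trunc.map k (ringHom (u i)) z) → y = z := fun k y z h =>
    (Trunc.descent κ k hu (fun i => Trunc.map k (ringHom (u i)) z) (fun i j S a b hab => by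
      rw [Trunc.map_map, Trunc.map_map, ← ringHom_comp, ← ringHom_comp, hab])).unique h (fun _ => rfl)
  have ex (f : ∀ i, pointedAut n (T i)) (hf : ∀ (i j : ι) (S : CommAlgCat.{u} κ) (a : T i ⟶ S)
      (b : T j ⟶ S), u i ≫ a = u j ≫ b →
      pointedAutMap n (ringHom a) (f i) = pointedAutMap n (ringHom b) (f j)) :
      ∃ φ : Trunc n R →ₐ[R] Trunc n R, (Trunc.pt n R).comp φ = Trunc.pt n R ∧
        ∀ i, Trunc.baseChange (ringHom (u i)) φ = ((f i).1 : Trunc n (T i) →ₐ[T i] _) := by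
    obtain ⟨y, hy, -⟩ := Trunc.descent κ n hu (fun i => (f i).1 (Trunc.t n (T i)))
      (fun i j S a b h => by
        rw [← pointedAutMap_t, ← pointedAutMap_t, hf i j S a b h])
    have hy0 : y ^ n = 0 := inj n _ _ fun i => by
      rw [map_pow, hy i, ← map_pow, Trunc.t_pow, map_zero, map_zero]
    have hb (i : ι) : Trunc.baseChange (ringHom (u i)) (Trunc.liftHom (R := R) y hy0) =
        ((f i).1 : Trunc n (T i) →ₐ[T i] _) := Trunc.hom_ext (by simpa using hy i)
    refine ⟨Trunc.liftHom y hy0, Trunc.hom_ext ?_, hb⟩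
    refine (hu.descent (fun i => 0) (fun i j S a b h => by simp)).unique (fun i => ?_)
      (fun i => ?_)
    · have h1 := congr($((f i).2) (Trunc.t n (T i)))
      rw [← hb i] at h1
      simp only [AlgHom.comp_apply, Trunc.baseChange_t, Trunc.pt_t] at h1
      rw [Trunc.pt_map] at h1
      exact h1
    · simp
  obtain ⟨φ, hφ, hφ'⟩ := ex e he
  obtain ⟨ψ, hψ, hψ'⟩ := ex (fun i => (e i)⁻¹) (fun i j S a b h => by
    rw [map_inv, map_inv, he i j S a b h])
  have inv1 : φ.comp ψ = AlgHom.id R _ := Trunc.hom_ext (inj n _ _ fun i => by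
    have := Trunc.baseChange_t (ringHom (u i)) (φ.comp ψ)
    rw [← this, Trunc.baseChange_comp, hφ', hψ']
    simp)
  have inv2 : ψ.comp φ = AlgHom.id R _ := Trunc.hom_ext (inj n _ _ fun i => by
    have := Trunc.baseChange_t (ringHom (u i)) (ψ.comp φ)
    rw [← this, Trunc.baseChange_comp, hφ', hψ']
    simp)
  let g : pointedAut n R := ⟨AlgEquiv.ofAlgHom φ ψ inv1 inv2, hφ⟩
  have hg (i : ι) : pointedAutMap n (ringHom (u i)) g = e i := pointedAut_ext (by
    rw [pointedAutMap_t]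
    have := congr($(hφ' i) (Trunc.t n (T i)))
    rw [Trunc.baseChange_t] at this
    exact this)
  refine ⟨g, hg, fun g' hg' => pointedAut_ext (inj n _ _ fun i => ?_)⟩
  have h1 := pointedAutMap_t (ringHom (u i)) g
  have h2 := pointedAutMap_t (ringHom (u i)) g'
  have h3 : pointedAutMap n (ringHom (u i)) g' = e i := hg' i
  rw [← h1, hg i]
  rw [h3] at h2
  exact h2.symm

/-- `G_n` is an étale sheaf. -/
theorem autGroup_isEtaleSheaf (n : ℕ) [NeZero n] :
    IsEtaleSheaf (autGroup κ n ⋙ forget GrpCat) :=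
  fun _ _ _ _ _ hu x hx => pointedAut_descent κ n hu x hx

/-- The subfunctor `V ⊆ E_{m,d}`: the framed extensions `t ↦ t^d p(t)` with `a_0(p) = 1` and
`a_{kd}(p) = 0` for `k = 1, …, m - 2`, where `a_l` is the coefficient of `t^l`. (As `t^{md} = 0`, only
the coefficients `a_l(p)` with `l < d(m - 1)` are determined by the extension.) -/
noncomputable def V (m d : ℕ) [NeZero m] [NeZero d] : CommAlgCat.{u} κ ⥤ Type u where
  obj R := {φ : (framedExt κ m d).obj R // ∃ p : (R : Type u)[X],
    φ.1 (Trunc.t m R) = AdjoinRoot.mk _ (X ^ d * p) ∧ p.coeff 0 = 1 ∧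
      ∀ k : ℕ, 1 ≤ k → k + 2 ≤ m → p.coeff (k * d) = 0}
  map u := ↾fun φ => ⟨(framedExt κ m d).map u φ.1, by
    obtain ⟨p, h1, h2, h3⟩ := φ.2
    refine ⟨p.map (ringHom u), ?_, ?_, fun k hk hk' => ?_⟩
    · refine (Trunc.baseChange_t (ringHom u) φ.1.1).trans ?_
      rw [h1, Trunc.map_mk]
      simp
    · simp [h2]
    · simp [h3 k hk hk']⟩
  map_id R := ConcreteCategory.hom_ext _ _ fun φ =>
    Subtype.ext (Functor.map_id_apply (framedExt κ m d) R φ.1)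
  map_comp u v := ConcreteCategory.hom_ext _ _ fun φ =>
    Subtype.ext (Functor.map_comp_apply (framedExt κ m d) u v φ.1)

/-- The inclusion `V ⊆ E_{m,d}`. -/
noncomputable def V.incl (m d : ℕ) [NeZero m] [NeZero d] : V κ m d ⟶ framedExt κ m d where
  app R := ↾fun φ => φ.1
  naturality R S u := by ext φ; rfl

/-- The canonical morphism `V ⊆ E_{m,d} → [E_{m,d} / G_m]`. -/
noncomputable def V.toQuotient (m d : ℕ) [NeZero m] [NeZero d] :
    (V κ m d).Elements ⥤ QuotientStack (autAction κ m d) :=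
  NatTrans.mapElements (V.incl κ m d) ⋙
    QuotientStack.fromE (autAction κ m d) (autGroup_isEtaleSheaf κ m)

/-- A functor on `κ`-algebras is (represented by) the affine space `𝔸^N` over `κ`. -/
def IsAffineSpace (F : CommAlgCat.{u} κ ⥤ Type u) (N : ℕ) : Prop :=
  Nonempty (F ≅ coyoneda.obj (op (CommAlgCat.of κ (MvPolynomial (Fin N) κ))))

end Standard


/-! ### Pointed curvilinear algebras -/

/-- The `k`-th Fitting ideal of a finitely generated `R`-module `M`: generated by the minors of size
`r - k` of matrices of relations among `r` generators of `M`. -/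
def fittingIdeal (R M : Type*) [CommRing R] [AddCommGroup M] [Module R M] (k : ℕ) : Ideal R :=
  Ideal.span {δ | ∃ (r : ℕ) (x : Fin r → M) (a : Fin (r - k) → Fin r → R) (c : Fin (r - k) → Fin r),
    Submodule.span R (Set.range x) = ⊤ ∧ (∀ i, ∑ j, a i j • x j = 0) ∧
      δ = Matrix.det (Matrix.of fun i j => a i (c j))}

/-- The ideal of `B` that defines the closed subscheme `𝒮_{h+1} ⊆ Spec B`: here `𝒮_1 = Spec B`, and
`𝒮_{h+1} ⊆ 𝒮_h` is defined by the `0`-th Fitting ideal of `Ω_{𝒮_h / R}`. -/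
noncomputable def stratumIdeal (R B : Type*) [CommRing R] [CommRing B] [Algebra R B] : ℕ → Ideal B
  | 0 => ⊥
  | h + 1 => (fittingIdeal (B ⧸ stratumIdeal R B h) (Ω[(B ⧸ stratumIdeal R B h)⁄R]) 0).comap
      (Ideal.Quotient.mk (stratumIdeal R B h))

/-- The pointed algebra `R → B → R` lies in the locally closed locus of curvilinear algebras of
length `n`: the section `Spec R → Spec B` factors through the open complement of the closed subscheme
defined by the first Fitting ideal of `Ω_{B / R}` (the pointed algebra is linear) and through the
closed subscheme `𝒮_n`. -/
def IsCurvilinear {R B : Type*} [CommRing R] [CommRing B] (str : R →+* B) (sec : B →+* R)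
    (n : ℕ) : Prop :=
  letI := str.toAlgebra
  (fittingIdeal B (Ω[B⁄R]) 1).map sec = ⊤ ∧ ∀ b ∈ stratumIdeal R B (n - 1), sec b = 0

/-- A commutative square of ring homomorphisms that exhibits `B'` as the base change of `B`
along `A → A'`. -/
def IsCocartesian {A B A' B' : Type u} [CommRing A] [CommRing B] [CommRing A'] [CommRing B']
    (f : A →+* B) (u : A →+* A') (v : B →+* B') (f' : A' →+* B') : Prop :=
  IsPushout (CommRingCat.ofHom f) (CommRingCat.ofHom u) (CommRingCat.ofHom v)
    (CommRingCat.ofHom f')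

theorem IsCocartesian.id {A B : Type u} [CommRing A] [CommRing B] (f : A →+* B) :
    IsCocartesian f (RingHom.id A) (RingHom.id B) f := by
  rw [IsCocartesian, CommRingCat.ofHom_id, CommRingCat.ofHom_id]
  exact IsPushout.of_vert_isIso ⟨by simp⟩

theorem IsCocartesian.comp {A B A' B' A'' B'' : Type u} [CommRing A] [CommRing B] [CommRing A']
    [CommRing B'] [CommRing A''] [CommRing B''] {f : A →+* B} {u : A →+* A'} {v : B →+* B'}
    {f' : A' →+* B'} {u' : A' →+* A''} {v' : B' →+* B''} {f'' : A'' →+* B''}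
    (h : IsCocartesian f u v f') (h' : IsCocartesian f' u' v' f'') :
    IsCocartesian f (u'.comp u) (v'.comp v) f'' :=
  IsPushout.paste_vert h h'

section Stacks

variable (κ : Type u) [Field κ]

/-- The stack `𝓕_n^c` of pointed curvilinear algebras of length `n`: an object over `Spec base` is a
finite locally free `base`-algebra of degree `n` with a curvilinear section. -/
structure PointedAlg (n : ℕ) where
  base : CommAlgCat.{u} κ
  alg : CommRingCat.{u}
  str : base →+* alg
  sec : alg →+* base
  sec_str : ∀ r, sec (str r) = r
  isFinLocFree : IsFinLocFree str n
  isCurvilinear : IsCurvilinear str sec n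

namespace PointedAlg

variable {κ} {n : ℕ}

/-- Morphisms are base changes of pointed algebras. They are written in the direction of the ring
homomorphisms, i.e. this is the opposite of the usual category fibred over affine `κ`-schemes. -/
@[ext]
structure Hom (X Y : PointedAlg κ n) where
  base : X.base ⟶ Y.base
  alg : X.alg →+* Y.alg
  sec_comp : ∀ b, Y.sec (alg b) = ringHom base (X.sec b)
  isCocartesian : IsCocartesian X.str (ringHom base) alg Y.str

instance : Category (PointedAlg κ n) where
  Hom := Hom
  id X :=
    { base := 𝟙 _, alg := RingHom.id _, sec_comp := fun _ => rfl, isCocartesian := .id _ }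
  comp f g :=
    { base := f.base ≫ g.base
      alg := g.alg.comp f.alg
      sec_comp := fun b => by
        rw [RingHom.comp_apply, g.sec_comp, f.sec_comp]
        rfl
      isCocartesian := f.isCocartesian.comp g.isCocartesian }

variable (κ n) in
/-- The structure functor to `κ`-algebras. -/
def toBase : PointedAlg κ n ⥤ CommAlgCat.{u} κ where
  obj X := X.base
  map f := f.base

/-- The pointed algebra is isomorphic to the standard one `(R[t]/(t^n), q₀)`. -/
def IsStandard [NeZero n] (X : PointedAlg κ n) : Prop :=
  ∃ e : Trunc n X.base ≃+* X.alg, (∀ r, e (algebraMap X.base _ r) = X.str r) ∧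
    ∀ x, X.sec (e x) = Trunc.pt n X.base x

end PointedAlg

/-- The stack `𝓔_{m,d}^c` of extensions of degree `d` of pointed curvilinear algebras: an object over
`Spec base` is a finite locally free `base`-algebra `sub` of degree `m`, a finite locally free
extension `sub → alg` of degree `d` (automatically injective for `0 < d`), and a section of `alg` that
makes it an object of `𝓕_{md}^c`. -/
structure PointedExt (m d : ℕ) extends PointedAlg κ (m * d) where
  sub : CommRingCat.{u}
  subStr : base →+* sub
  incl : sub →+* alg
  incl_subStr : ∀ r, incl (subStr r) = str r
  sub_isFinLocFree : IsFinLocFree subStr m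
  incl_isFinLocFree : IsFinLocFree incl d

namespace PointedExt

variable {κ} {m d : ℕ}

/-- Morphisms are base changes of extensions of pointed algebras. -/
@[ext]
structure Hom (X Y : PointedExt κ m d) extends PointedAlg.Hom X.toPointedAlg Y.toPointedAlg where
  sub : X.sub →+* Y.sub
  incl_comp : ∀ a, Y.incl (sub a) = alg (X.incl a)
  sub_isCocartesian : IsCocartesian X.subStr (ringHom base) sub Y.subStr

instance : Category (PointedExt κ m d) where
  Hom := Hom
  id X :=
    { PointedAlg.Hom.mk (𝟙 X.base) (RingHom.id X.alg) (fun _ => rfl) (.id _) with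
      sub := RingHom.id _
      incl_comp := fun _ => rfl
      sub_isCocartesian := .id _ }
  comp {X Y Z} f g :=
    { (show X.toPointedAlg ⟶ Z.toPointedAlg from
        (show X.toPointedAlg ⟶ Y.toPointedAlg from f.toHom) ≫
        (show Y.toPointedAlg ⟶ Z.toPointedAlg from g.toHom)) with
      sub := g.sub.comp f.sub
      incl_comp := fun a => by
        rw [RingHom.comp_apply, g.incl_comp, f.incl_comp]
        rfl
      sub_isCocartesian := f.sub_isCocartesian.comp g.sub_isCocartesian }

variable (κ m d) in
/-- The morphism `𝓔_{m,d}^c → 𝓕_{md}^c`, `(A ↪ B → R) ↦ (B → R)`. -/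
def forgetSub : PointedExt κ m d ⥤ PointedAlg κ (m * d) where
  obj X := X.toPointedAlg
  map f := f.toHom

end PointedExt

/-! ### Affine bundles -/

variable {κ}

/-- The fibre product `Spec (p ξ) ×_𝓕 𝓔`, the category of objects of `𝓔` with an arrow from `ξ` to
their image in `𝓕`, together with its structure functor to `p ξ`-algebras. Here `𝓔` and `𝓕` are
written as opposites of fibred categories, with `p : 𝓕 ⥤ CommAlgCat κ` in the direction of rings. -/
def fiberProductToBase {𝓔 𝓕 : Type*} [Category 𝓔] [Category 𝓕] (p : 𝓕 ⥤ CommAlgCat.{u} κ)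
    (π : 𝓔 ⥤ 𝓕) (ξ : 𝓕) : StructuredArrow ξ π ⥤ Under (p.obj ξ) where
  obj X := Under.mk (p.map X.hom)
  map f := Under.homMk (p.map (π.map f.right)) (by simp [← Functor.map_comp])

/-- The polynomial ring in `N` variables over a `κ`-algebra `R`, i.e. the affine space `𝔸^N` over
`Spec R`, with its structure map. -/
noncomputable def affineSpaceHom (N : ℕ) (R : CommAlgCat.{u} κ) :
    R ⟶ CommAlgCat.of κ (MvPolynomial (Fin N) R) :=
  CommAlgCat.ofHom (IsScalarTower.toAlgHom κ R (MvPolynomial (Fin N) R))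

/-- The fibre product `Spec (p ξ) ×_𝓕 𝓔` is isomorphic, over `Spec (p ξ)`, to the affine space
`𝔸^N` over `Spec (p ξ)`. -/
def IsTrivialOver {𝓔 𝓕 : Type*} [Category 𝓔] [Category 𝓕] (p : 𝓕 ⥤ CommAlgCat.{u} κ)
    (π : 𝓔 ⥤ 𝓕) (N : ℕ) (ξ : 𝓕) : Prop :=
  ∃ e : StructuredArrow ξ π ≌ Under (CommAlgCat.of κ (MvPolynomial (Fin N) (p.obj ξ))),
    Nonempty (e.functor ⋙ Under.map (affineSpaceHom N (p.obj ξ)) ≅ fiberProductToBase p π ξ)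

/-- A property of objects `ξ` of a stack `p : 𝓕 ⥤ CommAlgCat κ` holds Zariski-locally on the base:
it holds for the restriction of `ξ` to the members of a covering of `Spec (p ξ)` by principal open
subsets. -/
def ZariskiLocally {𝓕 : Type*} [Category 𝓕] (p : 𝓕 ⥤ CommAlgCat.{u} κ) (Q : 𝓕 → Prop)
    (ξ : 𝓕) : Prop :=
  ∃ s : Set (p.obj ξ), Ideal.span s = ⊤ ∧ ∀ f ∈ s, ∃ (ξ' : 𝓕) (a : ξ ⟶ ξ'),
    (letI := (ringHom (p.map a)).toAlgebra; IsLocalization.Away f (p.obj ξ')) ∧ Q ξ'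

/-- The morphism of stacks `π : 𝓔 → 𝓕` is an affine bundle of dimension `N`: its base change to any
affine scheme over `𝓕` is, Zariski-locally on that scheme, isomorphic to the affine space `𝔸^N`. -/
def IsAffineBundle {𝓔 𝓕 : Type*} [Category 𝓔] [Category 𝓕] (p : 𝓕 ⥤ CommAlgCat.{u} κ)
    (π : 𝓔 ⥤ 𝓕) (N : ℕ) : Prop :=
  ∀ ξ : 𝓕, ZariskiLocally p (IsTrivialOver p π N) ξ

end Stacks

end Curvilinear

namespace Curvilinear

namespace Trunc

section Coefficients

variable {n : ℕ} {R : Type*} [CommRing R]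

theorem coeff_mk (p : R[X]) {k : ℕ} (hk : k < n) :
    coeff (AdjoinRoot.mk (X ^ n : R[X]) p) k = p.coeff k := by
  rw [coeff, AdjoinRoot.modByMonicHom_mk]
  conv_rhs => rw [← Polynomial.modByMonic_add_div p (X ^ n : R[X])]
  rw [Polynomial.coeff_add, Polynomial.coeff_X_pow_mul', if_neg (by omega), add_zero]

/-- The coefficient of `t ^ k` as a linear form. -/
noncomputable def coeffHom (n : ℕ) (R : Type*) [CommRing R] (k : ℕ) : Trunc n R →ₗ[R] R :=
  (Polynomial.lcoeff R k).comp (AdjoinRoot.modByMonicHom (monic_X_pow n))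

theorem coeff_zero (k : ℕ) : coeff (0 : Trunc n R) k = 0 := (coeffHom n R k).map_zero

theorem coeff_add (x y : Trunc n R) (k : ℕ) : coeff (x + y) k = coeff x k + coeff y k :=
  (coeffHom n R k).map_add x y

theorem coeff_sub (x y : Trunc n R) (k : ℕ) : coeff (x - y) k = coeff x k - coeff y k :=
  (coeffHom n R k).map_sub x y

theorem coeff_smul (r : R) (x : Trunc n R) (k : ℕ) : coeff (r • x) k = r * coeff x k :=
  (coeffHom n R k).map_smul r x

theorem coeff_finsetSum {ι : Type*} (s : Finset ι) (f : ι → Trunc n R) (k : ℕ) :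
    coeff (∑ i ∈ s, f i) k = ∑ i ∈ s, coeff (f i) k :=
  map_sum (coeffHom n R k) f s

theorem coeff_mul (x y : Trunc n R) {k : ℕ} (hk : k < n) :
    coeff (x * y) k = ∑ p ∈ Finset.HasAntidiagonal.antidiagonal k, coeff x p.1 * coeff y p.2 := by
  obtain ⟨p, rfl⟩ := AdjoinRoot.mk_surjective x
  obtain ⟨q, rfl⟩ := AdjoinRoot.mk_surjective y
  rw [← map_mul, coeff_mk _ hk, Polynomial.coeff_mul]
  refine Finset.sum_congr rfl fun i hi => ?_
  have := Finset.HasAntidiagonal.mem_antidiagonal.mp hi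
  rw [coeff_mk _ (by omega), coeff_mk _ (by omega)]

theorem coeff_mul_zero (hn : 0 < n) (x y : Trunc n R) :
    coeff (x * y) 0 = coeff x 0 * coeff y 0 := by
  simp [coeff_mul x y hn]

theorem coeff_t_pow_mul (j : ℕ) (x : Trunc n R) {k : ℕ} (hk : k < n) :
    coeff (t n R ^ j * x) k = if j ≤ k then coeff x (k - j) else 0 := by
  obtain ⟨p, rfl⟩ := AdjoinRoot.mk_surjective x
  rw [t, ← AdjoinRoot.mk_X, ← map_pow, ← map_mul, coeff_mk _ hk, Polynomial.coeff_X_pow_mul']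
  split_ifs
  · rw [coeff_mk _ (by omega)]
  · rfl

theorem t_pow_of_le {i : ℕ} (hi : n ≤ i) : t n R ^ i = 0 := by
  rw [← Nat.sub_add_cancel hi, pow_add, t_pow, mul_zero]

theorem coeff_one (k : ℕ) (hk : k < n) : coeff (1 : Trunc n R) k = if k = 0 then 1 else 0 := by
  rw [← map_one (AdjoinRoot.mk (X ^ n : R[X])), coeff_mk _ hk, Polynomial.coeff_one]

theorem coeff_t_pow (j : ℕ) {k : ℕ} (hk : k < n) :
    coeff (t n R ^ j) k = if k = j then 1 else 0 := by
  rw [t, ← AdjoinRoot.mk_X, ← map_pow, coeff_mk _ hk, Polynomial.coeff_X_pow]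

theorem coeff_algebraMap (r : R) {k : ℕ} (hk : k < n) :
    coeff (algebraMap R (Trunc n R) r) k = if k = 0 then r else 0 := by
  rw [AdjoinRoot.algebraMap_eq, ← AdjoinRoot.mk_C, coeff_mk _ hk, Polynomial.coeff_C]

theorem coeff_pow_zero (hn : 0 < n) (x : Trunc n R) (j : ℕ) : coeff (x ^ j) 0 = coeff x 0 ^ j := by
  induction j with
  | zero => simp [coeff_one 0 hn]
  | succ j ih => rw [pow_succ, coeff_mul_zero hn, ih, pow_succ]

/-- The class of `∑ a_i t ^ i`. -/
noncomputable def ofCoeff (n : ℕ) (a : ℕ → R) : Trunc n R :=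
  AdjoinRoot.mk (X ^ n : R[X]) (∑ i ∈ Finset.range n, C (a i) * X ^ i)

theorem coeff_ofCoeff (a : ℕ → R) {k : ℕ} (hk : k < n) : coeff (ofCoeff n a) k = a k :=
  coeff_sum a hk

theorem coeff_ext_lt {x y : Trunc n R} (h : ∀ k < n, coeff x k = coeff y k) : x = y :=
  coeff_ext fun k => (lt_or_ge k n).elim (h k) fun hk => by
    rw [coeff_of_le _ hk, coeff_of_le _ hk]

theorem map_ofCoeff {S : Type*} [CommRing S] (u : R →+* S) (a : ℕ → R) :
    map n u (ofCoeff n a) = ofCoeff n (fun k => u (a k)) :=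
  coeff_ext_lt fun k hk => by rw [coeff_map, coeff_ofCoeff _ hk, coeff_ofCoeff _ hk]

theorem eq_sum (x : Trunc n R) : x = ∑ i ∈ Finset.range n, coeff x i • t n R ^ i :=
  coeff_ext_lt fun k hk => by
    rw [coeff_finsetSum, Finset.sum_eq_single k]
    · rw [coeff_smul, coeff_t_pow _ hk, if_pos rfl, mul_one]
    · intro i _ hi
      rw [coeff_smul, coeff_t_pow _ hk, if_neg (Ne.symm hi), mul_zero]
    · intro h
      exact absurd (Finset.mem_range.mpr hk) h

theorem exists_eq_t_pow_mul {x : Trunc n R} {d : ℕ} (h : ∀ i < d, coeff x i = 0) :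
    ∃ y : Trunc n R, x = t n R ^ d * y :=
  ⟨ofCoeff n fun l => coeff x (l + d), coeff_ext_lt fun k hk => by
    rw [coeff_t_pow_mul _ _ hk]
    split_ifs with hd
    · rw [coeff_ofCoeff _ (by omega), Nat.sub_add_cancel hd]
    · exact h k (by omega)⟩

theorem pt_eq_coeff [NeZero n] (x : Trunc n R) : pt n R x = coeff x 0 := by
  have hn : 0 < n := NeZero.pos n
  conv_lhs => rw [eq_sum x]
  rw [map_sum, Finset.sum_eq_single 0]
  · simp
  · intro i _ hi
    simp [hi]
  · intro h
    exact absurd (Finset.mem_range.mpr hn) h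

theorem isUnit_of_coeff_zero {x : Trunc n R} (h : IsUnit (coeff x 0)) : IsUnit x := by
  rcases Nat.eq_zero_or_pos n with rfl | hn
  · have : Subsingleton (Trunc 0 R) := subsingleton_of_zero_eq_one (by
      have := t_pow 0 R
      rw [pow_zero] at this
      exact this.symm)
    exact isUnit_of_subsingleton x
  obtain ⟨y, hy⟩ := exists_eq_t_pow_mul (x := x - algebraMap R _ (coeff x 0)) (d := 1) (by
    intro i hi
    obtain rfl : i = 0 := by omega
    rw [coeff_sub, coeff_algebraMap _ hn, if_pos rfl, sub_self])
  have h1 : IsNilpotent (t n R ^ 1 * y) :=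
    ⟨n, by rw [mul_pow, pow_one, t_pow, zero_mul]⟩
  have h2 : x = algebraMap R (Trunc n R) (coeff x 0) + t n R ^ 1 * y := by rw [← hy]; ring
  rw [h2]
  exact h1.isUnit_add_left_of_commute (h.map _) (Commute.all _ _)

theorem ringHom_ext {S : Type*} [CommRing S] {f g : Trunc n R →+* S}
    (h : ∀ r, f (algebraMap R _ r) = g (algebraMap R _ r)) (ht : f (t n R) = g (t n R)) : f = g := by
  refine AdjoinRoot.ringHom_ext (RingHom.ext fun r => ?_) ht
  have := h r
  rwa [AdjoinRoot.algebraMap_eq] at this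

/-- If all coefficients below `d` of `x` lie in `𝔞`, then modulo `𝔞` the power `x ^ j` starts with
the `j`-th power of the coefficient of `t ^ d`. -/
theorem coeff_pow_mem {x : Trunc n R} {d : ℕ} (𝔞 : Ideal R) (h : ∀ i < d, coeff x i ∈ 𝔞) (j : ℕ) :
    (∀ i < j * d, coeff (x ^ j) i ∈ 𝔞) ∧
      (j * d < n → coeff (x ^ j) (j * d) - coeff x d ^ j ∈ 𝔞) := by
  obtain ⟨y, hy⟩ := exists_eq_t_pow_mul (x := map n (Ideal.Quotient.mk 𝔞) x) (d := d)
    fun i hi => by rw [coeff_map, Ideal.Quotient.eq_zero_iff_mem]; exact h i hi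
  have hj : map n (Ideal.Quotient.mk 𝔞) (x ^ j) = t n _ ^ (j * d) * y ^ j := by
    rw [map_pow, hy, mul_pow, ← pow_mul, mul_comm d]
  constructor
  · intro i hi
    rcases lt_or_ge i n with hn | hn
    · rw [← Ideal.Quotient.eq_zero_iff_mem, ← coeff_map, hj, coeff_t_pow_mul _ _ hn,
        if_neg (by omega)]
    · rw [coeff_of_le _ hn]
      exact 𝔞.zero_mem
  · intro hn
    rw [← Ideal.Quotient.eq_zero_iff_mem, RingHom.map_sub, RingHom.map_pow, ← coeff_map, hj,
      coeff_t_pow_mul _ _ hn, if_pos le_rfl, Nat.sub_self, coeff_pow_zero (by omega)]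
    rcases Nat.eq_zero_or_pos j with rfl | hj
    · simp
    · have hd : d < n := lt_of_le_of_lt (Nat.le_mul_of_pos_left d hj) hn
      rw [← coeff_map, hy, coeff_t_pow_mul _ _ hd, if_pos le_rfl, Nat.sub_self, sub_self]

/-- The basis of powers of `t`. -/
noncomputable def basis (n : ℕ) (R : Type*) [CommRing R] : Module.Basis (Fin n) R (Trunc n R) :=
  Module.Basis.ofEquivFun
    { toFun := fun x i => coeff x i
      map_add' := fun x y => funext fun i => coeff_add x y i
      map_smul' := fun r x => funext fun i => coeff_smul r x i
      invFun := fun a => ofCoeff n fun k => if h : k < n then a ⟨k, h⟩ else 0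
      left_inv := fun x => coeff_ext_lt fun k hk => by rw [coeff_ofCoeff _ hk, dif_pos hk]
      right_inv := fun a => funext fun i => (coeff_ofCoeff _ i.2).trans (dif_pos i.2) }

end Coefficients

end Trunc

theorem IsFinLocFree.of_basis {A B : Type*} [CommRing A] [CommRing B] [Algebra A B] {n : ℕ}
    (b : Module.Basis (Fin n) A B) : IsFinLocFree (algebraMap A B) n := by
  have : Module.Finite A B := .of_basis b
  have : Module.Free A B := .of_basis b
  refine ⟨RingHom.finite_algebraMap.mpr inferInstance,
    RingHom.flat_algebraMap_iff.mpr inferInstance, ?_, fun x => ?_⟩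
  · rw [RingHom.finitePresentation_algebraMap]
    have : Module.FinitePresentation A B := Module.finitePresentation_of_projective A B
    exact inferInstance
  · have : Nontrivial A := ⟨0, 1, fun h => x.2.ne_top (Ideal.eq_top_of_isUnit_mem _
      x.1.zero_mem (h ▸ isUnit_one))⟩
    rw [RingHom.finrank_algebraMap, Module.rankAtStalk_eq_finrank_of_free,
      Module.finrank_eq_card_basis b]
    simp

theorem IsFinLocFree.equiv_comp {A B B' : Type u} [CommRing A] [CommRing B] [CommRing B']
    {f : A →+* B} {n : ℕ} (h : IsFinLocFree f n) (e : B ≃+* B') :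
    IsFinLocFree ((e : B →+* B').comp f) n := by
  obtain ⟨h1, h2, h3, h4⟩ := h
  refine ⟨(RingHom.Finite.of_surjective _ e.surjective).comp h1,
    h2.comp (RingHom.Flat.of_bijective e.bijective),
    (RingHom.FinitePresentation.of_bijective e.bijective).comp h3, fun x => ?_⟩
  rw [RingHom.finrank_comp_left_of_bijective f (e : B →+* B') e.bijective h1 h2]
  exact h4 x

theorem Trunc.algebraMap_isFinLocFree (n : ℕ) (R : Type*) [CommRing R] :
    IsFinLocFree (algebraMap R (Trunc n R)) n :=
  .of_basis (Trunc.basis n R)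

/-- A homomorphism `t ↦ s = t ^ d * (unit)` of truncated polynomial rings is finite locally free. -/
theorem Trunc.isFinLocFree_of_coeff {m d : ℕ} {R : Type u} [CommRing R]
    (φ : Trunc m R →ₐ[R] Trunc (m * d) R) (h : ∀ i < d, coeff (φ (t m R)) i = 0)
    (h' : 1 < m → IsUnit (coeff (φ (t m R)) d)) : IsFinLocFree φ.toRingHom d := by
  let := φ.toRingHom.toAlgebra
  have htow : IsScalarTower R (Trunc m R) (Trunc (m * d) R) :=
    .of_algebraMap_eq fun x => (φ.commutes x).symm
  let f : (Fin d → Trunc m R) →ₗ[Trunc m R] Trunc (m * d) R :=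
    Fintype.linearCombination (Trunc m R) fun i : Fin d => t (m * d) R ^ (i : ℕ)
  have hf (a : Fin d → Trunc m R) : f a = ∑ i, φ (a i) * t (m * d) R ^ (i : ℕ) := by
    simp only [f, Fintype.linearCombination_apply]
    exact Finset.sum_congr rfl fun i _ => Algebra.smul_def _ _
  have key : ∀ k, ∀ l, m * d ≤ l + k → ∀ x : Trunc (m * d) R, t (m * d) R ^ l * x ∈ LinearMap.range f := by
    intro k
    induction k with
    | zero =>
      intro l hl x
      rw [t_pow_of_le (show m * d ≤ l from hl), zero_mul]
      exact zero_mem _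
    | succ k ih =>
      intro l hl x
      rcases lt_or_ge l (m * d) with hlt | hge
      swap
      · exact ih l (by omega) x
      have hd : 0 < d := Nat.pos_of_ne_zero fun h => by simp [h] at hlt
      have hjm : l / d < m := Nat.div_lt_of_lt_mul (by rwa [mul_comm] at hlt)
      obtain ⟨y, hy⟩ := exists_eq_t_pow_mul h
      have hu : IsUnit (coeff (y ^ (l / d)) 0) := by
        rw [coeff_pow_zero (by omega)]
        rcases Nat.eq_zero_or_pos (l / d) with h0 | h0
        · simp [h0]
        · have h1 : 1 < m := by omega
          refine IsUnit.pow _ ?_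
          have := h' h1
          have hdn : d < m * d := by nlinarith
          rwa [hy, coeff_t_pow_mul _ _ hdn, if_pos le_rfl, Nat.sub_self] at this
      obtain ⟨w, hw⟩ := (isUnit_of_coeff_zero hu).exists_right_inv
      let c := coeff (w * x) 0
      obtain ⟨z, hz⟩ := exists_eq_t_pow_mul (x := w * x - algebraMap R _ c) (d := 1) (by
        intro i hi
        obtain rfl : i = 0 := by omega
        rw [coeff_sub, coeff_algebraMap _ (by omega), if_pos rfl, sub_self])
      have e1 : t (m * d) R ^ l * x =
          f (Pi.single ⟨l % d, Nat.mod_lt _ hd⟩ (algebraMap R _ c * t m R ^ (l / d))) +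
            t (m * d) R ^ (l + 1) * (y ^ (l / d) * z) := by
        rw [hf, Finset.sum_eq_single ⟨l % d, Nat.mod_lt _ hd⟩]
        · rw [Pi.single_eq_same, map_mul, φ.commutes, map_pow, hy, mul_pow, ← pow_mul]
          have e2 : x = y ^ (l / d) * (w * x) := by rw [← mul_assoc, hw, one_mul]
          have e3 : w * x = algebraMap R _ c + t (m * d) R ^ 1 * z := by rw [← hz]; ring
          rw [e2, e3]
          have e4 : t (m * d) R ^ l = t (m * d) R ^ (d * (l / d)) * t (m * d) R ^ (l % d) := by
            rw [← pow_add, Nat.div_add_mod]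
          rw [pow_succ (t (m * d) R) l, e4, pow_one]
          ring
        · intro i _ hi
          rw [Pi.single_eq_of_ne hi, map_zero, zero_mul]
        · simp
      rw [e1]
      exact add_mem (LinearMap.mem_range_self f _) (ih (l + 1) (by omega) _)
  have hsurj : Function.Surjective f := fun x => by
    have := key (m * d) 0 (by omega) x
    rwa [pow_zero, one_mul] at this
  have hinj : Function.Injective f := by
    let e : (Fin d → Trunc m R) ≃ₗ[R] Trunc (m * d) R :=
      (LinearEquiv.piCongrRight fun _ => (basis m R).equivFun) ≪≫ₗ
        (LinearEquiv.curry R R (Fin d) (Fin m)).symm ≪≫ₗ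
        (LinearEquiv.funCongrLeft R R ((finProdFinEquiv.symm.trans (Equiv.prodComm _ _)))) ≪≫ₗ
        (basis (m * d) R).equivFun.symm
    have : Module.Finite R (Trunc (m * d) R) := .of_basis (basis (m * d) R)
    exact (OrzechProperty.injective_of_surjective_of_injective
      (e : (Fin d → Trunc m R) →ₗ[R] Trunc (m * d) R) (f.restrictScalars R) e.injective hsurj)
  exact IsFinLocFree.of_basis (Module.Basis.ofEquivFun (LinearEquiv.ofBijective f ⟨hinj, hsurj⟩).symm)

open TensorProduct in
attribute [local instance] Algebra.TensorProduct.rightAlgebra in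
/-- Let `S → A → S[t]/(t^n)` with the second map finite locally free of degree `d`. At every point of
`Spec S`, the elements of the augmentation ideal of `A` have `t`-order at least `d`, and the order `d`
occurs if `d < n`. -/
theorem fiber_order {S A : Type u} [CommRing S] [CommRing A] {n d : ℕ} [NeZero n] (σ : S →+* A)
    (ι : A →+* Trunc n S) (h : ∀ r, ι (σ r) = algebraMap S _ r) (hι : IsFinLocFree ι d)
    (x : Ideal S) [x.IsPrime] :
    (∀ a, Trunc.coeff (ι a) 0 = 0 → ∀ i < d, Trunc.coeff (ι a) i ∈ x) ∧
      (d < n → ∃ a, Trunc.coeff (ι a) 0 = 0 ∧ Trunc.coeff (ι a) d ∉ x) := by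
  let k := x.ResidueField
  let q : A →+* S := (Trunc.pt n S : Trunc n S →+* S).comp ι
  have hq (a : A) : q a = Trunc.coeff (ι a) 0 := Trunc.pt_eq_coeff _
  have hqσ (r : S) : q (σ r) = r := by
    rw [hq, h, Trunc.coeff_algebraMap _ (NeZero.pos n), if_pos rfl]
  let := ι.toAlgebra
  let := ((algebraMap S k).comp q).toAlgebra
  let C := k ⊗[A] Trunc n S
  have hC : IsFinLocFree (algebraMap k C) d :=
    IsFinLocFree.baseChange (A := A) (B := Trunc n S) (A' := k) (B' := C) hι
  have hfin : Module.finrank k C = d := by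
    have : Module.Finite k C := RingHom.finite_algebraMap.mp hC.1
    rw [← hC.2.2.2 ⊥, RingHom.finrank_algebraMap, Module.rankAtStalk_eq_finrank_of_free]
    rfl
  let g : Trunc n S →+* C :=
    (Algebra.TensorProduct.includeRight : Trunc n S →ₐ[A] C)
  have hgι (a : A) : g (ι a) = algebraMap k C (algebraMap S k (q a)) :=
    (Algebra.TensorProduct.includeRight : Trunc n S →ₐ[A] C).commutes a
  have hgS (r : S) : g (algebraMap S _ r) = algebraMap k C (algebraMap S k r) := by
    rw [← h, hgι, hqσ]
  let τ : C := g (Trunc.t n S)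
  have hmem (r : S) : algebraMap S k r = 0 ↔ r ∈ x := Ideal.algebraMap_residueField_eq_zero
  have first : ∀ a, Trunc.coeff (ι a) 0 = 0 → ∀ i < d, Trunc.coeff (ι a) i ∈ x := by
    classical
    intro a ha i hi
    by_contra hcon
    have hex : ∃ i, Trunc.coeff (ι a) i ∉ x := ⟨i, hcon⟩
    obtain ⟨e, he, hmin⟩ : ∃ e, Trunc.coeff (ι a) e ∉ x ∧ ∀ i < e, Trunc.coeff (ι a) i ∈ x :=
      ⟨Nat.find hex, Nat.find_spec hex, fun i hi => not_not.mp (Nat.find_min hex hi)⟩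
    have hed : e < d := lt_of_le_of_lt (not_lt.mp fun h' => hcon (hmin i h')) hi
    have hen : e < n := by
      by_contra hcon
      rw [Trunc.coeff_of_le _ (not_lt.mp hcon)] at he
      exact he x.zero_mem
    have hτn : τ ^ n = 0 := (map_pow g _ n).symm.trans (by rw [Trunc.t_pow, map_zero])
    let G : Trunc n k →ₐ[k] C := Trunc.liftHom τ hτn
    have hGt : G (Trunc.t n k) = τ := Trunc.liftHom_t τ hτn
    have hG (y : Trunc n S) : G (Trunc.map n (algebraMap S k) y) = g y := by
      have : (G : Trunc n k →+* C).comp (Trunc.map n (algebraMap S k)) = g := by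
        refine Trunc.ringHom_ext (fun r => ?_) ?_
        · simp only [RingHom.comp_apply, Trunc.map_algebraMap, hgS]
          exact G.commutes _
        · simp only [RingHom.comp_apply, Trunc.map_t]
          exact hGt
      exact congr($this y)
    have hGs : Function.Surjective G := by
      intro z
      induction z using TensorProduct.induction_on with
      | zero => exact ⟨0, map_zero G⟩
      | add z w hz hw =>
        obtain ⟨z', rfl⟩ := hz
        obtain ⟨w', rfl⟩ := hw
        exact ⟨z' + w', map_add G _ _⟩
      | tmul c b =>
        refine ⟨c • Trunc.map n (algebraMap S k) b, ?_⟩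
        rw [map_smul, hG]
        change c • ((1 : k) ⊗ₜ[A] b) = _
        rw [TensorProduct.smul_tmul', smul_eq_mul, mul_one]
    obtain ⟨y, hy⟩ := Trunc.exists_eq_t_pow_mul (x := Trunc.map n (algebraMap S k) (ι a)) (d := e)
      fun i hi => by rw [Trunc.coeff_map, hmem]; exact hmin i hi
    have hyu : IsUnit y := Trunc.isUnit_of_coeff_zero (IsUnit.mk0 _ (by
      have := Trunc.coeff_map (algebraMap S k) (ι a) e
      rw [hy, Trunc.coeff_t_pow_mul _ _ hen, if_pos le_rfl, Nat.sub_self] at this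
      rw [this, Ne, hmem]
      exact he))
    have hτ : τ ^ e = 0 := by
      have h1 : G (Trunc.t n k ^ e * y) = 0 := by
        rw [← hy, hG, hgι, hq, ha, map_zero, map_zero]
      rw [map_mul, map_pow, hGt] at h1
      exact (hyu.map G).mul_left_eq_zero.mp h1
    let H : Trunc e k →ₐ[k] C := Trunc.liftHom τ hτ
    have hHs : Function.Surjective H := by
      intro z
      obtain ⟨w, rfl⟩ := hGs z
      obtain ⟨p, rfl⟩ := AdjoinRoot.mk_surjective w
      refine ⟨AdjoinRoot.mk _ p, ?_⟩
      rw [← AdjoinRoot.aeval_eq, ← AdjoinRoot.aeval_eq, ← Polynomial.aeval_algHom_apply,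
        ← Polynomial.aeval_algHom_apply]
      congr 2
    have : Module.Finite k (Trunc e k) := .of_basis (Trunc.basis e k)
    have hle := LinearMap.finrank_le_finrank_of_surjective (f := H.toLinearMap) hHs
    rw [hfin, Module.finrank_eq_card_basis (Trunc.basis e k), Fintype.card_fin] at hle
    exact absurd hed (not_lt.mpr hle)
  refine ⟨first, fun hdn => ?_⟩
  by_contra hcon
  push Not at hcon
  let T := Trunc (d + 1) k
  let P : Trunc n S →+* T := ((Trunc.liftHom (R := k) (Trunc.t (d + 1) k) 
    (Trunc.t_pow_of_le hdn) :
      Trunc n k →ₐ[k] T) : Trunc n k →+* T).comp (Trunc.map n (algebraMap S k))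
  have hPt : P (Trunc.t n S) = Trunc.t (d + 1) k := by
    simp only [P, RingHom.comp_apply, Trunc.map_t]
    exact Trunc.liftHom_t _ (Trunc.t_pow_of_le hdn)
  have hPS (r : S) : P (algebraMap S _ r) = algebraMap k T (algebraMap S k r) := by
    simp only [P, RingHom.comp_apply, Trunc.map_algebraMap]
    exact (Trunc.liftHom (R := k) (Trunc.t (d + 1) k) (Trunc.t_pow_of_le hdn)).commutes _
  have hP0 (y : Trunc n S) (hy : ∀ i < d + 1, Trunc.coeff y i ∈ x) : P y = 0 := by
    rw [Trunc.eq_sum y, map_sum]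
    refine Finset.sum_eq_zero fun i _ => ?_
    rw [Algebra.smul_def, map_mul, map_pow, hPt, hPS]
    rcases lt_or_ge i (d + 1) with hi | hi
    · rw [(hmem _).mpr (hy i hi), map_zero, zero_mul]
    · rw [Trunc.t_pow_of_le hi, mul_zero]
  have hPι (a : A) : P (ι a) = algebraMap k T (algebraMap S k (q a)) := by
    have h0 : Trunc.coeff (ι (a - σ (q a))) 0 = 0 := by rw [← hq, map_sub, hqσ, sub_self]
    have h1 : P (ι (a - σ (q a))) = 0 := hP0 _ fun i hi => by
      rcases Nat.lt_succ_iff_lt_or_eq.mp hi with hi | rfl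
      · exact first _ h0 i hi
      · exact hcon _ h0
    rw [map_sub, map_sub, h, hPS, sub_eq_zero] at h1
    exact h1
  let P' : Trunc n S →ₐ[A] T :=
    { P with commutes' := fun a => (hPι a).trans (IsScalarTower.algebraMap_apply A k T a).symm }
  let K : C →ₐ[k] T := Algebra.TensorProduct.lift (Algebra.ofId k T) P' fun _ _ => Commute.all _ _
  have hK : Function.Surjective K := by
    intro y
    rw [Trunc.eq_sum y]
    refine ⟨∑ i ∈ Finset.range (d + 1), Trunc.coeff y i • ((1 : k) ⊗ₜ[A] Trunc.t n S) ^ i, ?_⟩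
    rw [map_sum]
    refine Finset.sum_congr rfl fun i _ => ?_
    rw [map_smul, map_pow]
    congr 2
    refine (Algebra.TensorProduct.lift_tmul _ _ _ _ _).trans ?_
    rw [map_one, one_mul]
    exact hPt
  have : Module.Finite k C := RingHom.finite_algebraMap.mp hC.1
  have hle := LinearMap.finrank_le_finrank_of_surjective (f := K.toLinearMap) hK
  rw [hfin, Module.finrank_eq_card_basis (Trunc.basis (d + 1) k), Fintype.card_fin] at hle
  omega

theorem add_pow_of_mul_self_eq_zero {R : Type*} [CommRing R] {w g : R} (hg : g * g = 0) (j : ℕ) :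
    (w + g) ^ j = w ^ j + j * w ^ (j - 1) * g := by
  induction j with
  | zero => simp
  | succ j ih =>
    rw [pow_succ, ih]
    rcases Nat.eq_zero_or_pos j with rfl | hj
    · simp
    · have h1 : w ^ j = w ^ (j - 1) * w := by rw [← pow_succ, Nat.sub_add_cancel hj]
      rw [Nat.add_sub_cancel, pow_succ, h1]
      push_cast
      linear_combination (j * w ^ (j - 1) : R) * hg

/-- The linearized form of the rigidity of `t ^ d * (unit)` under the equation `s ^ m = ∑ a_j s ^ j`. -/
theorem coeff_eq_zero_of_square_zero {m d : ℕ} {S : Type*} [CommRing S] (hm : 1 < m)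
    (hmd : d = 1 ∨ IsUnit (m : S)) (s : Trunc (m * d) S) (a : ℕ → S)
    (h0 : Trunc.coeff s 0 = 0) (hd : IsUnit (Trunc.coeff s d))
    (hs : s ^ m = ∑ j ∈ Finset.range m, a j • s ^ j)
    (hss : ∀ i < d, ∀ i' < d, Trunc.coeff s i * Trunc.coeff s i' = 0)
    (has : ∀ j < m, ∀ i < d, a j * Trunc.coeff s i = 0) :
    (∀ i < d, Trunc.coeff s i = 0) ∧ ∀ j < m, a j = 0 := by
  rcases Nat.eq_zero_or_pos d with rfl | hd0
  · rw [h0] at hd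
    have : Subsingleton S := isUnit_zero_iff.mp hd |> fun h => subsingleton_of_zero_eq_one h
    exact ⟨fun _ _ => Subsingleton.elim _ _, fun _ _ => Subsingleton.elim _ _⟩
  have hdn : d < m * d := by nlinarith
  let t := Trunc.t (m * d) S
  let g : Trunc (m * d) S := ∑ i ∈ Finset.range d, Trunc.coeff s i • t ^ i
  have hgc (k : ℕ) (hk : k < m * d) : Trunc.coeff g k = if k < d then Trunc.coeff s k else 0 := by
    simp only [g, Trunc.coeff_finsetSum, Trunc.coeff_smul, t, Trunc.coeff_t_pow _ hk]
    simp
  obtain ⟨p, hp⟩ := Trunc.exists_eq_t_pow_mul (x := s - g) (d := d) fun i hi => by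
    rw [Trunc.coeff_sub, hgc i (by omega), if_pos hi, sub_self]
  have hg2 : g * g = 0 := by
    rw [Finset.sum_mul_sum]
    refine Finset.sum_eq_zero fun i hi => Finset.sum_eq_zero fun i' hi' => ?_
    rw [smul_mul_smul_comm, hss i (Finset.mem_range.mp hi) i' (Finset.mem_range.mp hi'), zero_smul]
  have hag (j : ℕ) (hj : j < m) : a j • g = 0 := by
    rw [Finset.smul_sum]
    refine Finset.sum_eq_zero fun i hi => ?_
    rw [smul_smul, has j hj i (Finset.mem_range.mp hi), zero_smul]
  have hsw : s = t ^ d * p + g := by rw [← hp]; ring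
  have hpow (j : ℕ) : (t ^ d * p) ^ j = t ^ (j * d) * p ^ j := by
    rw [mul_pow, ← pow_mul, mul_comm d]
  have hp0 : Trunc.coeff p 0 = Trunc.coeff s d := by
    have := Trunc.coeff_t_pow_mul d p hdn
    rw [← hp, Trunc.coeff_sub, hgc d hdn, if_neg (lt_irrefl d), if_pos le_rfl, Nat.sub_self,
      sub_zero] at this
    exact this.symm
  have hpu : IsUnit p := Trunc.isUnit_of_coeff_zero (by rwa [hp0])
  have hg0 : Trunc.coeff g 0 = 0 := by rw [hgc 0 (by omega), if_pos hd0, h0]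
  have key : (m : Trunc (m * d) S) * (t ^ ((m - 1) * d) * (p ^ (m - 1) * g)) =
      ∑ j ∈ Finset.range m, a j • (t ^ (j * d) * p ^ j) := by
    have h1 : s ^ m = (m : Trunc (m * d) S) * (t ^ ((m - 1) * d) * (p ^ (m - 1) * g)) := by
      rw [hsw, add_pow_of_mul_self_eq_zero hg2, hpow, hpow, Trunc.t_pow, zero_mul, zero_add]
      ring
    rw [← h1, hs]
    refine Finset.sum_congr rfl fun j hj => ?_
    rw [hsw, add_pow_of_mul_self_eq_zero hg2, hpow, smul_add,
      ← mul_smul_comm (a j) _ g, hag j (Finset.mem_range.mp hj), mul_zero, add_zero]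
  have ha : ∀ j < m, a j = 0 := by
    intro j
    induction j using Nat.strong_induction_on with
    | _ j ih =>
      intro hj
      have hjn : j * d < m * d := Nat.mul_lt_mul_of_pos_right hj hd0
      have h1 := congr_arg (fun z => Trunc.coeff z (j * d)) key
      rw [← nsmul_eq_mul, ← Nat.cast_smul_eq_nsmul S, Trunc.coeff_smul,
        Trunc.coeff_t_pow_mul _ _ hjn, Trunc.coeff_finsetSum, Finset.sum_eq_single j,
        Trunc.coeff_smul, Trunc.coeff_t_pow_mul _ _ hjn, if_pos le_rfl, Nat.sub_self,
        Trunc.coeff_pow_zero (by omega), hp0] at h1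
      · have h2 : (if (m - 1) * d ≤ j * d then
            Trunc.coeff (p ^ (m - 1) * g) (j * d - (m - 1) * d) else 0) = 0 := by
          split_ifs with h
          · have : (m - 1) * d = j * d := le_antisymm h (Nat.mul_le_mul_right d (by omega))
            rw [this, Nat.sub_self, Trunc.coeff_mul_zero (by omega), hg0, mul_zero]
          · rfl
        rw [h2, mul_zero] at h1
        exact (hd.pow j).mul_left_eq_zero.mp h1.symm
      · intro i hi hij
        rcases lt_or_gt_of_ne hij with h | h
        · rw [ih i h (Finset.mem_range.mp hi), zero_smul, Trunc.coeff_zero]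
        · rw [Trunc.coeff_smul, Trunc.coeff_t_pow_mul _ _ hjn,
            if_neg (not_le.mpr (Nat.mul_lt_mul_of_pos_right h hd0)), mul_zero]
      · intro h
        exact absurd (Finset.mem_range.mpr hj) h
  refine ⟨fun i hi => ?_, ha⟩
  rcases hmd with rfl | hmu
  · obtain rfl : i = 0 := by omega
    exact h0
  · rw [Finset.sum_eq_zero fun j hj => by rw [ha j (Finset.mem_range.mp hj), zero_smul]] at key
    have hmu' : IsUnit (m : Trunc (m * d) S) := by
      simpa using hmu.map (algebraMap S (Trunc (m * d) S))
    have h1 : t ^ ((m - 1) * d) * (p ^ (m - 1) * g) = 0 := hmu'.mul_right_eq_zero.mp key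
    have h2 : t ^ ((m - 1) * d) * g = 0 :=
      (hpu.pow (m - 1)).mul_right_eq_zero.mp (by rw [← h1]; ring)
    have hlt : (m - 1) * d + i < m * d := by
      have : m * d = (m - 1) * d + d := by
        rw [← Nat.succ_mul, Nat.succ_eq_add_one, Nat.sub_add_cancel hm.le]
      omega
    have h3 := Trunc.coeff_t_pow_mul ((m - 1) * d) g hlt
    rw [show t = Trunc.t (m * d) S from rfl] at h2
    rw [h2, Trunc.coeff_zero, if_pos (by omega), Nat.add_sub_cancel_left, hgc i (by omega),
      if_pos hi] at h3
    exact h3.symm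

/-- If `s ∈ S[t]/(t^{md})` has order `d` up to nilpotents and satisfies a monic equation of degree
`m` with nilpotent lower coefficients, then `s = t ^ d * (unit)`. -/
theorem coeff_eq_zero_of_isNilpotent {m d : ℕ} {S : Type*} [CommRing S] (hm : 1 < m)
    (hmd : d = 1 ∨ IsUnit (m : S)) (s : Trunc (m * d) S) (a : ℕ → S)
    (h0 : Trunc.coeff s 0 = 0) (hd : IsUnit (Trunc.coeff s d))
    (hs : s ^ m = ∑ j ∈ Finset.range m, a j • s ^ j)
    (hsn : ∀ i < d, IsNilpotent (Trunc.coeff s i)) (han : ∀ j < m, IsNilpotent (a j)) :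
    ∀ i < d, Trunc.coeff s i = 0 := by
  let G : Set S := (Trunc.coeff s '' Set.Iio d) ∪ (a '' Set.Iio m)
  let 𝔟 : Ideal S := Ideal.span G
  have hsmem (i : ℕ) (hi : i < d) : Trunc.coeff s i ∈ 𝔟 :=
    Ideal.subset_span (Or.inl ⟨i, hi, rfl⟩)
  have hamem (j : ℕ) (hj : j < m) : a j ∈ 𝔟 := Ideal.subset_span (Or.inr ⟨j, hj, rfl⟩)
  have hfg : 𝔟.FG := Submodule.fg_span
    (((Set.finite_Iio d).image _).union ((Set.finite_Iio m).image _))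
  have hnil : IsNilpotent 𝔟 := by
    rw [Ideal.FG.isNilpotent_iff_le_nilradical hfg]
    refine Ideal.span_le.mpr ?_
    rintro _ (⟨i, hi, rfl⟩ | ⟨j, hj, rfl⟩)
    · exact hsn i hi
    · exact han j hj
  let π := Ideal.Quotient.mk (𝔟 * 𝔟)
  have hz (x y : S) (hx : x ∈ 𝔟) (hy : y ∈ 𝔟) : π x * π y = 0 := by
    rw [← map_mul, Ideal.Quotient.eq_zero_iff_mem]
    exact Ideal.mul_mem_mul hx hy
  obtain ⟨h1, h2⟩ := coeff_eq_zero_of_square_zero hm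
    (hmd.imp_right fun h => by simpa using h.map π) (Trunc.map (m * d) π s) (fun j => π (a j))
    (by rw [Trunc.coeff_map, h0, map_zero]) (by rw [Trunc.coeff_map]; exact hd.map π)
    (by
      rw [← map_pow, hs, map_sum]
      exact Finset.sum_congr rfl fun j _ => by
        rw [Algebra.smul_def, Algebra.smul_def, map_mul, Trunc.map_algebraMap, map_pow])
    (fun i hi i' hi' => by
      rw [Trunc.coeff_map, Trunc.coeff_map]; exact hz _ _ (hsmem i hi) (hsmem i' hi'))
    (fun j hj i hi => by rw [Trunc.coeff_map]; exact hz _ _ (hamem j hj) (hsmem i hi))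
  have hle : 𝔟 ≤ 𝔟 * 𝔟 := by
    refine Ideal.span_le.mpr ?_
    rintro _ (⟨i, hi, rfl⟩ | ⟨j, hj, rfl⟩)
    · have := h1 i hi
      rw [Trunc.coeff_map] at this
      exact Ideal.Quotient.eq_zero_iff_mem.mp this
    · exact Ideal.Quotient.eq_zero_iff_mem.mp (h2 j hj)
  have hpow (k : ℕ) : 𝔟 ≤ 𝔟 ^ (k + 1) := by
    induction k with
    | zero => simp
    | succ k ih =>
      rw [pow_succ]
      exact hle.trans (Ideal.mul_mono_left ih)
  obtain ⟨k, hk⟩ := hnil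
  have hbot : 𝔟 = 0 := le_bot_iff.mp ((hpow k).trans (by rw [pow_succ, hk, zero_mul]; exact le_rfl))
  intro i hi
  have := hsmem i hi
  rwa [hbot] at this

/-- The normal form of the generator of a subalgebra of `S[t]/(t^{md})` of degree `m`:
`s = t ^ d * p` with `p` as in the definition of `V`. -/
def IsNormal {m d : ℕ} {S : Type*} [CommRing S] (s : Trunc (m * d) S) : Prop :=
  (∀ l < d, Trunc.coeff s l = 0) ∧ ∀ k < m, Trunc.coeff s (k * d) = if k = 1 then 1 else 0

theorem IsNormal.map {m d : ℕ} {S T : Type*} [CommRing S] [CommRing T] {s : Trunc (m * d) S}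
    (hs : IsNormal s) (u : S →+* T) : IsNormal (Trunc.map (m * d) u s) := by
  refine ⟨fun l hl => by rw [Trunc.coeff_map, hs.1 l hl, map_zero], fun k hk => ?_⟩
  rw [Trunc.coeff_map, hs.2 k hk]
  split_ifs <;> simp

theorem IsNormal.pow_eq_zero {m d : ℕ} {S : Type*} [CommRing S] {s : Trunc (m * d) S}
    (hs : IsNormal s) : s ^ m = 0 := by
  obtain ⟨y, rfl⟩ := Trunc.exists_eq_t_pow_mul hs.1
  rw [mul_pow, ← pow_mul, mul_comm d, Trunc.t_pow, zero_mul]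

/-- The coefficients of `t ^ (k d)` of the powers of `a`, for `k < m`. -/
noncomputable def powMatrix {m d : ℕ} {S : Type*} [CommRing S] (a : Trunc (m * d) S) :
    Matrix (Fin m) (Fin m) S :=
  Matrix.of fun i k => Trunc.coeff (a ^ (i : ℕ)) (k * d)

theorem det_powMatrix_notMem {m d : ℕ} [NeZero d] {S : Type*} [CommRing S] (a : Trunc (m * d) S)
    (x : Ideal S) [x.IsPrime] (h : ∀ i < d, Trunc.coeff a i ∈ x)
    (hd : 1 < m → Trunc.coeff a d ∉ x) : (powMatrix a).det ∉ x := by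
  have hd0 : 0 < d := NeZero.pos d
  rw [← Ideal.Quotient.eq_zero_iff_mem, RingHom.map_det, Matrix.det_of_isUpperTriangular]
  · rw [Finset.prod_eq_zero_iff]
    rintro ⟨i, -, hi⟩
    have h1 := (Trunc.coeff_pow_mem x h (i : ℕ)).2 (Nat.mul_lt_mul_of_pos_right i.2 hd0)
    rw [← Ideal.Quotient.eq_zero_iff_mem, RingHom.map_sub, sub_eq_zero] at h1
    have h2 : Ideal.Quotient.mk x (Trunc.coeff a d ^ (i : ℕ)) = 0 := h1.symm.trans hi
    rw [RingHom.map_pow] at h2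
    rcases Nat.eq_zero_or_pos (i : ℕ) with h0 | h0
    · rw [h0, pow_zero] at h2
      exact one_ne_zero h2
    · exact hd (by omega) (Ideal.Quotient.eq_zero_iff_mem.mp (eq_zero_of_pow_eq_zero h2))
  · intro i k hik
    exact Ideal.Quotient.eq_zero_iff_mem.mpr
      ((Trunc.coeff_pow_mem x h (i : ℕ)).1 _ (Nat.mul_lt_mul_of_pos_right hik hd0))

/-- A subalgebra `A` of degree `m` of `S[t]/(t^{md})` over which the latter is finite locally free of
degree `d` is `S[s]/(s^m)` for a unique normal element `s`. -/
theorem exists_frame {S A : Type u} [CommRing S] [CommRing A] {m d : ℕ} [NeZero m] [NeZero d]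
    (hmd : d = 1 ∨ IsUnit (m : S)) (σ : S →+* A) (ι : A →+* Trunc (m * d) S)
    (h : ∀ r, ι (σ r) = algebraMap S _ r) (hσ : IsFinLocFree σ m) (hι : IsFinLocFree ι d) :
    ∃ e : Trunc m S ≃+* A, (∀ r, e (algebraMap S _ r) = σ r) ∧ IsNormal (ι (e (Trunc.t m S))) ∧
      Function.Injective ι ∧ ∀ a, IsNormal (ι a) → a = e (Trunc.t m S) := by
  have hd0 : 0 < d := NeZero.pos d
  have hm0 : 0 < m := NeZero.pos m
  have hn0 : 0 < m * d := Nat.mul_pos hm0 hd0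
  let := σ.toAlgebra
  have hfin : Module.Finite S A := RingHom.finite_algebraMap.mp hσ.1
  have hflat : Module.Flat S A := RingHom.flat_algebraMap_iff.mp hσ.2.1
  let ι' : A →ₐ[S] Trunc (m * d) S := { ι with commutes' := h }
  let Λ : A →ₗ[S] (Fin m → S) :=
    LinearMap.pi fun k => (Trunc.coeffHom (m * d) S (k * d)).comp ι'.toLinearMap
  have hΛ (a : A) (k : Fin m) : Λ a k = Trunc.coeff (ι a) (k * d) := rfl
  have hΛM (a : A) (c : Fin m → S) :
      Λ (∑ i, c i • a ^ (i : ℕ)) = Matrix.vecMul c (powMatrix (ι a)) := by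
    rw [map_sum]
    ext k
    simp only [map_smul, Finset.sum_apply, Pi.smul_apply, hΛ, map_pow, Matrix.vecMul, dotProduct,
      powMatrix, Matrix.of_apply, smul_eq_mul]
  have hsurj : Function.Surjective Λ := by
    intro y
    let K : Ideal S := (LinearMap.range Λ).comap (LinearMap.toSpanSingleton S _ y)
    have hK : K = ⊤ := by
      by_contra hne
      obtain ⟨x, hx, hKx⟩ := Ideal.exists_le_maximal K hne
      have := hx.isPrime
      obtain ⟨h1, h2⟩ := fiber_order σ ι h hι x
      obtain ⟨a, ha0, had⟩ : ∃ a, Trunc.coeff (ι a) 0 = 0 ∧ (1 < m → Trunc.coeff (ι a) d ∉ x) := by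
        by_cases hm : 1 < m
        · obtain ⟨a, ha, had⟩ := h2 (by nlinarith)
          exact ⟨a, ha, fun _ => had⟩
        · exact ⟨0, by rw [map_zero, Trunc.coeff_zero], fun h => absurd h hm⟩
      refine det_powMatrix_notMem (ι a) x (h1 a ha0) had (hKx ?_)
      refine ⟨∑ i, (Matrix.vecMul y (powMatrix (ι a)).adjugate) i • a ^ (i : ℕ), ?_⟩
      rw [hΛM, Matrix.vecMul_vecMul, Matrix.adjugate_mul, Matrix.vecMul_smul, Matrix.vecMul_one]
      rfl
    have h1 : (1 : S) ∈ K := hK ▸ Submodule.mem_top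
    simpa [K] using h1
  have hbij : Function.Bijective Λ := by
    refine Module.bijective_of_surjective_of_rankAtStalk_eq hsurj fun x hx => ?_
    have : Nontrivial S := ⟨0, 1, fun h => hx.ne_top (Ideal.eq_top_of_isUnit_mem _
      x.zero_mem (h ▸ isUnit_one))⟩
    rw [Module.rankAtStalk_eq_finrank_of_free (M := Fin m → S)]
    have := hσ.2.2.2 ⟨x, inferInstance⟩
    rw [show σ = algebraMap S A from rfl, RingHom.finrank_algebraMap] at this
    simp [this]
  have hinj : Function.Injective ι := by
    rw [injective_iff_map_eq_zero]
    intro a ha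
    refine hbij.1 (funext fun k => ?_)
    rw [hΛ, ha, Trunc.coeff_zero, map_zero]
    rfl
  obtain ⟨s, hs⟩ := hsurj fun k => if (k : ℕ) = 1 then 1 else 0
  have hsk (k : ℕ) (hk : k < m) : Trunc.coeff (ι s) (k * d) = if k = 1 then 1 else 0 := by
    rw [← hΛ s ⟨k, hk⟩, hs]
  have hs0 : Trunc.coeff (ι s) 0 = 0 := by simpa using hsk 0 hm0
  have hsx (x : Ideal S) [x.IsPrime] : ∀ i < d, Trunc.coeff (ι s) i ∈ x :=
    (fiber_order σ ι h hι x).1 s hs0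
  have hsd (hm : 1 < m) : Trunc.coeff (ι s) d = 1 := by simpa using hsk 1 hm
  have hdet : IsUnit (powMatrix (ι s)).det := by
    by_contra hne
    obtain ⟨x, hx, hmem⟩ := exists_max_ideal_of_mem_nonunits hne
    have := hx.isPrime
    refine det_powMatrix_notMem (ι s) x (hsx x) (fun hm hmem => ?_) hmem
    rw [hsd hm] at hmem
    exact hx.ne_top ((Ideal.eq_top_iff_one x).mpr hmem)
  have hnormal : IsNormal (ι s) := by
    refine ⟨?_, hsk⟩
    rcases lt_or_ge 1 m with hm | hm
    · let c : Fin m → S := Matrix.vecMul (Λ (s ^ m)) (powMatrix (ι s))⁻¹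
      have hc : s ^ m = ∑ i, c i • s ^ (i : ℕ) := by
        refine hbij.1 ?_
        rw [hΛM, Matrix.vecMul_vecMul, Matrix.nonsing_inv_mul _ hdet, Matrix.vecMul_one]
      have hcn (i : Fin m) : IsNilpotent (c i) := by
        rw [nilpotent_iff_mem_prime]
        intro x hx
        change ∑ k, Λ (s ^ m) k * (powMatrix (ι s))⁻¹ k i ∈ x
        refine x.sum_mem fun k _ => x.mul_mem_right _ ?_
        rw [hΛ, map_pow]
        exact (Trunc.coeff_pow_mem x (hsx x) m).1 _ (Nat.mul_lt_mul_of_pos_right k.2 hd0)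
      refine coeff_eq_zero_of_isNilpotent hm hmd (ι s) (fun j => if hj : j < m then c ⟨j, hj⟩ else 0)
        hs0 (by rw [hsd hm]; exact isUnit_one) ?_
        (fun i hi => nilpotent_iff_mem_prime.mpr fun x hx => hsx x i hi) (fun j hj => ?_)
      · rw [← map_pow, hc, map_sum, Finset.sum_range]
        refine Finset.sum_congr rfl fun i _ => ?_
        rw [dif_pos i.2]
        exact (map_smul ι' _ _).trans (by rw [map_pow]; rfl)
      · simpa [hj] using hcn ⟨j, hj⟩
    · have : s = 0 := hbij.1 (by
        rw [hs, map_zero]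
        exact funext fun k => if_neg (by omega))
      intro l _
      rw [this, map_zero, Trunc.coeff_zero]
  have hsm : s ^ m = 0 := hinj (by rw [map_pow, hnormal.pow_eq_zero, map_zero])
  let e : Trunc m S →ₐ[S] A := Trunc.liftHom s hsm
  have he (y : Trunc m S) : e y = ∑ i : Fin m, Trunc.coeff y i • s ^ (i : ℕ) := by
    conv_lhs => rw [Trunc.eq_sum y]
    rw [map_sum, Finset.sum_range]
    refine Finset.sum_congr rfl fun i _ => ?_
    rw [map_smul, map_pow, Trunc.liftHom_t]
  have hebij : Function.Bijective e := by
    constructor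
    · rw [injective_iff_map_eq_zero]
      intro y hy
      have h1 := congr_arg Λ hy
      rw [he, hΛM (c := fun i => Trunc.coeff y i), map_zero] at h1
      have h2 := congr_arg (fun v => Matrix.vecMul v (powMatrix (ι s))⁻¹) h1
      simp only [Matrix.vecMul_vecMul, Matrix.mul_nonsing_inv _ hdet, Matrix.vecMul_one,
        Matrix.zero_vecMul] at h2
      exact Trunc.coeff_ext_lt fun k hk => (congr_fun h2 ⟨k, hk⟩).trans (Trunc.coeff_zero k).symm
    · intro a
      let c : Fin m → S := Matrix.vecMul (Λ a) (powMatrix (ι s))⁻¹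
      refine ⟨Trunc.ofCoeff m fun k => if hk : k < m then c ⟨k, hk⟩ else 0, hbij.1 ?_⟩
      rw [he, hΛM (c := fun i => Trunc.coeff _ i)]
      have : (fun i : Fin m => Trunc.coeff
          (Trunc.ofCoeff m fun k => if hk : k < m then c ⟨k, hk⟩ else 0) i) = c := by
        funext i
        rw [Trunc.coeff_ofCoeff _ i.2, dif_pos i.2]
      rw [this, Matrix.vecMul_vecMul, Matrix.nonsing_inv_mul _ hdet, Matrix.vecMul_one]
  have het : e (Trunc.t m S) = s := Trunc.liftHom_t s hsm
  refine ⟨(AlgEquiv.ofBijective e hebij).toRingEquiv, fun r => e.commutes r, ?_, hinj,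
    fun a ha => ?_⟩
  · change IsNormal (ι (e (Trunc.t m S)))
    rwa [het]
  · change a = e (Trunc.t m S)
    rw [het]
    refine hbij.1 (funext fun k => ?_)
    rw [hΛ, hΛ, ha.2 k k.2, hsk k k.2]

/-! ### Coordinates of normal elements -/

/-- The coefficients of a normal element: `1` at `d`, and the given coordinates at the exponents
between `d` and `m * d` that are not divisible by `d`. -/
def normalCoeff (m d : ℕ) {S : Type*} [CommRing S] (c : Fin ((m - 1) * (d - 1)) → S) (l : ℕ) : S :=
  if l = d then 1 else
    if h : d ≤ l ∧ l < m * d ∧ l % d ≠ 0 then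
      c (finProdFinEquiv
        (⟨l / d - 1, by
          have hd : 0 < d := Nat.pos_of_ne_zero fun h0 => by
            have := h.2.1
            simp [h0] at this
          have h1 : l / d < m := Nat.div_lt_of_lt_mul (by rw [mul_comm]; exact h.2.1)
          have h2 : 0 < l / d := Nat.div_pos h.1 hd
          omega⟩,
        ⟨l % d - 1, by
          have hd : 0 < d := Nat.pos_of_ne_zero fun h0 => by
            have := h.2.1
            simp [h0] at this
          have h1 : l % d < d := Nat.mod_lt l hd
          have h2 := h.2.2
          omega⟩))
    else 0

/-- The normal element with given coordinates. -/
noncomputable def normalElt (m d : ℕ) {S : Type*} [CommRing S]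
    (c : Fin ((m - 1) * (d - 1)) → S) : Trunc (m * d) S :=
  Trunc.ofCoeff (m * d) (normalCoeff m d c)

/-- The exponent of `t` that belongs to a coordinate. -/
def coordExp (m d : ℕ) (i : Fin ((m - 1) * (d - 1))) : ℕ :=
  ((finProdFinEquiv.symm i).1 + 1) * d + (finProdFinEquiv.symm i).2 + 1

/-- The coordinates of a normal element. -/
noncomputable def normalCoords {m d : ℕ} {S : Type*} [CommRing S] (s : Trunc (m * d) S)
    (i : Fin ((m - 1) * (d - 1))) : S :=
  Trunc.coeff s (coordExp m d i)

section Coordinates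

variable {m d : ℕ} {S T : Type*} [CommRing S] [CommRing T]

theorem normalElt_isNormal [NeZero d] (c : Fin ((m - 1) * (d - 1)) → S) :
    IsNormal (normalElt m d c) := by
  have hd : 0 < d := NeZero.pos d
  constructor
  · intro l hl
    rcases lt_or_ge l (m * d) with h | h
    · rw [normalElt, Trunc.coeff_ofCoeff _ h, normalCoeff, if_neg (by omega), dif_neg (by omega)]
    · exact Trunc.coeff_of_le _ h
  · intro k hk
    rw [normalElt, Trunc.coeff_ofCoeff _ (Nat.mul_lt_mul_of_pos_right hk hd), normalCoeff]
    have : k * d = d ↔ k = 1 := by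
      constructor
      · intro h
        exact Nat.eq_of_mul_eq_mul_right hd (h.trans (one_mul d).symm)
      · rintro rfl
        exact one_mul d
    simp [this]

theorem map_normalElt (u : S →+* T) (c : Fin ((m - 1) * (d - 1)) → S) :
    Trunc.map (m * d) u (normalElt m d c) = normalElt m d (fun i => u (c i)) := by
  rw [normalElt, Trunc.map_ofCoeff, normalElt]
  congr 1
  funext l
  simp only [normalCoeff]
  split_ifs <;> simp

theorem normalCoords_map (u : S →+* T) (s : Trunc (m * d) S) (i : Fin ((m - 1) * (d - 1))) :
    normalCoords (Trunc.map (m * d) u s) i = u (normalCoords s i) :=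
  Trunc.coeff_map u s _

theorem coordExp_spec (i : Fin ((m - 1) * (d - 1))) :
    coordExp m d i / d = (finProdFinEquiv.symm i).1 + 1 ∧
      coordExp m d i % d = (finProdFinEquiv.symm i).2 + 1 ∧ coordExp m d i < m * d := by
  have h1 := (finProdFinEquiv.symm i).1.2
  have h2 := (finProdFinEquiv.symm i).2.2
  have hlt : ((finProdFinEquiv.symm i).2 : ℕ) + 1 < d := by omega
  have he : coordExp m d i =
      (((finProdFinEquiv.symm i).2 : ℕ) + 1) + d * ((finProdFinEquiv.symm i).1 + 1) := by
    rw [coordExp]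
    ring
  refine ⟨?_, ?_, ?_⟩
  · rw [he, Nat.add_mul_div_left _ _ (by omega), Nat.div_eq_of_lt hlt, zero_add]
  · rw [he, Nat.add_mul_mod_self_left, Nat.mod_eq_of_lt hlt]
  · rw [he]
    calc _ < d + d * ((finProdFinEquiv.symm i).1 + 1) := by omega
      _ = d * ((finProdFinEquiv.symm i).1 + 1 + 1) := by ring
      _ ≤ d * m := Nat.mul_le_mul_left d (by omega)
      _ = m * d := mul_comm _ _

theorem normalCoords_normalElt (c : Fin ((m - 1) * (d - 1)) → S) :
    normalCoords (normalElt m d c) = c := by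
  funext i
  obtain ⟨h1, h2, h3⟩ := coordExp_spec i
  have h4 : d ≤ coordExp m d i := by
    by_contra hcon
    rw [Nat.div_eq_of_lt (not_le.mp hcon)] at h1
    omega
  rw [normalCoords, normalElt, Trunc.coeff_ofCoeff _ h3, normalCoeff, if_neg, dif_pos ⟨h4, h3, by omega⟩]
  · congr 1
    rw [← Equiv.eq_symm_apply]
    ext <;> simp [h1, h2]
  · intro h
    rw [h, Nat.mod_self] at h2
    omega

theorem normalElt_normalCoords [NeZero d] {s : Trunc (m * d) S} (hs : IsNormal s) :
    normalElt m d (normalCoords s) = s := by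
  have hd : 0 < d := NeZero.pos d
  refine Trunc.coeff_ext_lt fun l hl => ?_
  rw [normalElt, Trunc.coeff_ofCoeff _ hl, normalCoeff]
  have hlm : l / d < m := Nat.div_lt_of_lt_mul (by rwa [mul_comm] at hl)
  by_cases hmod : l % d = 0
  · have hk : l / d * d = l := Nat.div_mul_cancel (Nat.dvd_of_mod_eq_zero hmod)
    have h1 := hs.2 (l / d) hlm
    rw [hk] at h1
    rw [h1, dif_neg (by omega)]
    have : l = d ↔ l / d = 1 := by
      constructor
      · rintro rfl
        exact Nat.div_self hd
      · intro h
        rw [← hk, h, one_mul]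
    simp [this]
  · rw [if_neg (fun h => hmod (by rw [h, Nat.mod_self]))]
    split_ifs with h
    · rw [normalCoords, coordExp]
      congr 1
      simp only [Equiv.symm_apply_apply]
      have h2 : 0 < l / d := Nat.div_pos h.1 hd
      have h3 := Nat.div_add_mod l d
      rw [Nat.sub_add_cancel h2, mul_comm]
      omega
    · exact (hs.1 l (by omega)).symm

end Coordinates

/-! ### The affine space `V` -/

section

variable (κ : Type u) [Field κ] (m d : ℕ) [NeZero m] [NeZero d]

/-- The homomorphism `R[t]/(t^m) → R[t]/(t^{md})` that sends `t` to a normal element. -/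
noncomputable def normalHom {m d : ℕ} {R : Type u} [CommRing R] (s : Trunc (m * d) R)
    (hs : IsNormal s) : Trunc m R →ₐ[R] Trunc (m * d) R :=
  Trunc.liftHom s hs.pow_eq_zero

theorem normalHom_t {m d : ℕ} {R : Type u} [CommRing R] (s : Trunc (m * d) R)
    (hs : IsNormal s) : normalHom s hs (Trunc.t m R) = s :=
  Trunc.liftHom_t _ _

theorem normalHom_isFinLocFree {m d : ℕ} {R : Type u} [CommRing R] (s : Trunc (m * d) R)
    (hs : IsNormal s) : IsFinLocFree (normalHom s hs).toRingHom d := by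
  refine Trunc.isFinLocFree_of_coeff _ (by rw [normalHom_t]; exact hs.1) fun hm => ?_
  have := hs.2 1 hm
  rw [one_mul, if_pos rfl] at this
  rw [normalHom_t, this]
  exact isUnit_one

/-- The framed extension given by a normal element. -/
noncomputable def framedExtOfNormal {R : CommAlgCat.{u} κ} (s : Trunc (m * d) R)
    (hs : IsNormal s) : (framedExt κ m d).obj R :=
  ⟨normalHom s hs, Trunc.hom_ext (by
    rw [AlgHom.comp_apply, normalHom_t, Trunc.pt_eq_coeff, Trunc.pt_t]
    exact hs.1 0 (NeZero.pos d)), normalHom_isFinLocFree s hs⟩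

variable {κ m d}

theorem framedExtOfNormal_t {R : CommAlgCat.{u} κ} (s : Trunc (m * d) R) (hs : IsNormal s) :
    (framedExtOfNormal κ m d s hs).1 (Trunc.t m R) = s :=
  normalHom_t s hs

theorem framedExt_ext {R : CommAlgCat.{u} κ} {φ ψ : (framedExt κ m d).obj R}
    (h : φ.1 (Trunc.t m R) = ψ.1 (Trunc.t m R)) : φ = ψ :=
  Subtype.ext (Trunc.hom_ext h)

theorem mem_V_iff {R : CommAlgCat.{u} κ} (φ : (framedExt κ m d).obj R) :
    (∃ p : (R : Type u)[X], φ.1 (Trunc.t m R) = AdjoinRoot.mk _ (X ^ d * p) ∧ p.coeff 0 = 1 ∧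
      ∀ k : ℕ, 1 ≤ k → k + 2 ≤ m → p.coeff (k * d) = 0) ↔ IsNormal (φ.1 (Trunc.t m R)) := by
  have hd : 0 < d := NeZero.pos d
  constructor
  · rintro ⟨p, h, h0, hp⟩
    rw [h]
    constructor
    · intro l hl
      rcases lt_or_ge l (m * d) with hlt | hge
      · rw [Trunc.coeff_mk _ hlt, Polynomial.coeff_X_pow_mul', if_neg (by omega)]
      · exact Trunc.coeff_of_le _ hge
    · intro k hk
      rw [Trunc.coeff_mk _ (Nat.mul_lt_mul_of_pos_right hk hd), Polynomial.coeff_X_pow_mul']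
      match k with
      | 0 => simp [hd.ne']
      | 1 => simp [h0]
      | k + 2 =>
        rw [if_pos (by nlinarith), show (k + 2) * d - d = (k + 1) * d by
          rw [show (k + 2) * d = (k + 1) * d + d by ring, Nat.add_sub_cancel],
          hp (k + 1) (by omega) (by omega), if_neg (by omega)]
  · intro hs
    set s := φ.1 (Trunc.t m R) with hsdef
    refine ⟨C 1 + ∑ l ∈ Finset.Ico 1 (m * d), C (Trunc.coeff s (l + d)) * X ^ l, ?_, ?_, ?_⟩
    · refine Trunc.coeff_ext_lt fun k hk => ?_
      rw [Trunc.coeff_mk _ hk, Polynomial.coeff_X_pow_mul']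
      split_ifs with hdk
      · simp only [Polynomial.coeff_add, Polynomial.finsetSum_coeff, Polynomial.coeff_C_mul,
          Polynomial.coeff_X_pow, Polynomial.coeff_C]
        rcases Nat.eq_or_lt_of_le hdk with rfl | hlt
        · have hm : 1 < m := by
            by_contra hcon
            have : m = 1 := by have := NeZero.pos m; omega
            subst this
            omega
          have := hs.2 1 hm
          rw [one_mul, if_pos rfl] at this
          rw [this, Nat.sub_self, if_pos rfl, Finset.sum_eq_zero, add_zero]
          intro l hl
          have := (Finset.mem_Ico.mp hl).1
          rw [if_neg (by omega), mul_zero]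
        · rw [if_neg (by omega), zero_add, Finset.sum_eq_single (k - d)]
          · rw [if_pos rfl, mul_one, Nat.sub_add_cancel hdk]
          · intro l _ hl
            rw [if_neg (Ne.symm hl), mul_zero]
          · intro h
            exact absurd (Finset.mem_Ico.mpr ⟨by omega, by omega⟩) h
      · exact hs.1 k (by omega)
    · simp only [Polynomial.coeff_add, Polynomial.finsetSum_coeff, Polynomial.coeff_C_mul,
        Polynomial.coeff_X_pow, Polynomial.coeff_C]
      rw [if_pos trivial, Finset.sum_eq_zero, add_zero]
      intro l hl
      have := (Finset.mem_Ico.mp hl).1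
      rw [if_neg (by omega), mul_zero]
    · intro k hk hkm
      simp only [Polynomial.coeff_add, Polynomial.finsetSum_coeff, Polynomial.coeff_C_mul,
        Polynomial.coeff_X_pow, Polynomial.coeff_C]
      have hk0 : 0 < k * d := Nat.mul_pos hk hd
      rw [if_neg hk0.ne', zero_add]
      refine Finset.sum_eq_zero fun l hl => ?_
      split_ifs with h
      · rw [← h, show k * d + d = (k + 1) * d by ring, hs.2 (k + 1) (by omega), if_neg (by omega),
          zero_mul]
      · exact mul_zero _

/-- The points of `V` are given by their coordinates. -/
noncomputable def VEquiv (R : CommAlgCat.{u} κ) :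
    (V κ m d).obj R ≃ (CommAlgCat.of κ (MvPolynomial (Fin ((m - 1) * (d - 1))) κ) ⟶ R) where
  toFun φ := CommAlgCat.ofHom (MvPolynomial.aeval (normalCoords (φ.1.1 (Trunc.t m R))))
  invFun f := ⟨framedExtOfNormal κ m d (normalElt m d fun i => f.hom (MvPolynomial.X i))
    (normalElt_isNormal _), (mem_V_iff _).mpr (by
      rw [framedExtOfNormal_t]
      exact normalElt_isNormal _)⟩
  left_inv φ := Subtype.ext (framedExt_ext (by
    refine (framedExtOfNormal_t _ (normalElt_isNormal _)).trans ?_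
    simp only [CommAlgCat.hom_ofHom, MvPolynomial.aeval_X]
    exact normalElt_normalCoords ((mem_V_iff _).mp φ.2)))
  right_inv f := by
    refine CommAlgCat.hom_ext (MvPolynomial.algHom_ext fun i => ?_)
    rw [CommAlgCat.hom_ofHom, MvPolynomial.aeval_X]
    refine (congr_arg (fun s => normalCoords s i)
      (framedExtOfNormal_t _ (normalElt_isNormal _))).trans ?_
    exact congr_fun (normalCoords_normalElt _) i

theorem V_isAffineSpace : IsAffineSpace κ (V κ m d) ((m - 1) * (d - 1)) := by
  refine ⟨NatIso.ofComponents (fun R => (VEquiv R).toIso) fun {R S} u => ?_⟩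
  ext φ
  refine CommAlgCat.hom_ext (MvPolynomial.algHom_ext fun i => ?_)
  change MvPolynomial.aeval (normalCoords (Trunc.baseChange (ringHom u) φ.1.1 (Trunc.t m S)))
    (MvPolynomial.X i) = u.hom (MvPolynomial.aeval (normalCoords (φ.1.1 (Trunc.t m R)))
      (MvPolynomial.X i))
  rw [MvPolynomial.aeval_X, MvPolynomial.aeval_X, Trunc.baseChange_t, normalCoords_map]
  rfl

end

section Slice

variable {κ : Type u} [Field κ] {G : CommAlgCat.{u} κ ⥤ GrpCat.{u}}
  {E W : CommAlgCat.{u} κ ⥤ Type u} (a : GrpAction G E) (hG : IsEtaleSheaf (G ⋙ forget GrpCat))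
  (i : W ⟶ E)

/-- `W → E` is a slice of the action of `G` on `E`: it is injective and every point of `E` is moved
into `W` by a unique element of `G`. -/
structure GrpAction.IsSlice : Prop where
  injective : ∀ R, Function.Injective (i.app R)
  existsUnique : ∀ {R : CommAlgCat.{u} κ} (e : E.obj R), ∃! g : G.obj R, ∃ w, i.app R w = a.smul g e

variable {a i}

theorem GrpAction.IsSlice.eq_one (h : a.IsSlice i) {R : CommAlgCat.{u} κ} {g : G.obj R}
    {v w : W.obj R} (hg : a.smul g (i.app R v) = i.app R w) : g = 1 ∧ v = w := by
  have : g = 1 := (h.existsUnique (i.app R v)).unique ⟨w, hg.symm⟩ ⟨v, (a.one_smul _).symm⟩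
  subst this
  rw [a.one_smul] at hg
  exact ⟨rfl, h.injective R hg⟩

/-- A morphism in `[E / G]` is invertible if its two components are. -/
theorem QuotientStack.isIso_of_isIso {X Y : QuotientStack a} (f : X ⟶ Y)
    [IsIso (QuotientStack.Hom.base f)] [IsIso (QuotientStack.Hom.tot f)] : IsIso f := by
  let g : Y ⟶ X :=
    { base := inv (QuotientStack.Hom.base f)
      tot := inv (QuotientStack.Hom.tot f)
      proj_comp := by
        rw [IsIso.inv_comp_eq, ← Category.assoc, QuotientStack.Hom.proj_comp f, Category.assoc,
          ← Functor.map_comp, ← op_comp]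
        simp
      equivariant := fun {S} g y => by
        have hinj : Function.Injective ((QuotientStack.Hom.tot f).app S) :=
          ((isIso_iff_bijective ((QuotientStack.Hom.tot f).app S)).mp inferInstance).1
        have hinv (z : X.tot.obj S) : (QuotientStack.Hom.tot f).app S
            ((inv (QuotientStack.Hom.tot f)).app S z) = z := by
          have := congr_arg (fun q => NatTrans.app q S) (IsIso.inv_hom_id (QuotientStack.Hom.tot f))
          exact congr($this z)
        apply hinj
        rw [hinv, QuotientStack.Hom.equivariant f, hinv]
      toE_comp := by rw [IsIso.inv_comp_eq, QuotientStack.Hom.toE_comp f] }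
  refine ⟨g, ?_, ?_⟩
  · exact QuotientStack.Hom.ext (IsIso.hom_inv_id _) (IsIso.inv_hom_id _)
  · exact QuotientStack.Hom.ext (IsIso.inv_hom_id _) (IsIso.hom_inv_id _)

/-- The canonical morphism from a slice to the quotient stack. -/
def sliceToQuotient (i : W ⟶ E) : W.Elements ⥤ QuotientStack a :=
  NatTrans.mapElements i ⋙ QuotientStack.fromE a hG

theorem GrpAction.IsSlice.faithful : (sliceToQuotient (a := a) hG i).Faithful where
  map_injective {X Y} f g h := by
    have := congr_arg QuotientStack.Hom.base h
    exact Subtype.ext this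

theorem GrpAction.IsSlice.full (h : a.IsSlice i) : (sliceToQuotient (a := a) hG i).Full where
  map_surjective {X Y} f := by
    obtain ⟨R, x⟩ := X
    obtain ⟨S, y⟩ := Y
    let b : R ⟶ S := QuotientStack.Hom.base f
    let τ : (QuotientStack.ofPoint a hG S (i.app S y)).tot ⟶
      (QuotientStack.ofPoint a hG R (i.app R x)).tot := QuotientStack.Hom.tot f
    have hproj (T : CommAlgCat.{u} κ) (p : G.obj T × (S ⟶ T)) : (τ.app T p).2 = b ≫ p.2 :=
      congr($(congr_arg (fun q => NatTrans.app q T) (QuotientStack.Hom.proj_comp f)) p)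
    have hE (T : CommAlgCat.{u} κ) (p : G.obj T × (S ⟶ T)) :
        a.smul (τ.app T p).1 (E.map (τ.app T p).2 (i.app R x)) =
          a.smul p.1 (E.map p.2 (i.app S y)) :=
      congr($(congr_arg (fun q => NatTrans.app q T) (QuotientStack.Hom.toE_comp f)) p)
    have hnat {T : CommAlgCat.{u} κ} (u : R ⟶ T) : E.map u (i.app R x) = i.app T (W.map u x) :=
      (NatTrans.naturality_apply i u x).symm
    have h1 := hE S (1, 𝟙 S)
    rw [hproj, hnat, a.one_smul, Category.comp_id, Functor.map_id_apply] at h1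
    obtain ⟨h2, h3⟩ := h.eq_one h1
    have h4 (T : CommAlgCat.{u} κ) (p : G.obj T × (S ⟶ T)) : τ.app T p = (p.1, b ≫ p.2) := by
      let o : (QuotientStack.ofPoint a hG S (i.app S y)).tot.obj S := ((1 : G.obj S), 𝟙 S)
      have h5 : p = (QuotientStack.ofPoint a hG S (i.app S y)).act.smul p.1
          ((QuotientStack.ofPoint a hG S (i.app S y)).tot.map p.2 o) := by
        refine Prod.ext ?_ ?_
        · change p.1 = p.1 * G.map p.2 1
          rw [map_one, mul_one]
        · exact (Category.id_comp _).symm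
      have h6 : τ.app T p = (p.1 * G.map p.2 (τ.app S o).1, (τ.app S o).2 ≫ p.2) := by
        conv_lhs => rw [h5]
        refine (QuotientStack.Hom.equivariant f p.1 _).trans ?_
        exact congr_arg _ (NatTrans.naturality_apply τ p.2 o)
      have h7 : (τ.app S o).1 = 1 := h2
      have h8 : (τ.app S o).2 = b := (hproj S o).trans (Category.comp_id b)
      rw [h6, h7, h8, map_one, mul_one]
    refine ⟨⟨b, h3⟩, QuotientStack.Hom.ext rfl ?_⟩
    ext T p
    exact (h4 T p).symm

/-- Every object of `[E / G]` has a section over its base that is mapped into the slice. -/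
theorem GrpAction.IsSlice.exists_section (h : a.IsSlice i) (X : QuotientStack a) :
    ∃ (y : X.tot.obj X.base) (w : W.obj X.base), X.proj.app _ y = 𝟙 X.base ∧
      i.app _ w = X.toE.app _ y := by
  obtain ⟨ι, hι, T, u, hu, hx⟩ := X.locally_nonempty
  have hloc (j : ι) : ∃ (y : X.tot.obj (T j)) (w : W.obj (T j)), X.proj.app _ y = u j ∧
      i.app _ w = X.toE.app _ y := by
    obtain ⟨x, hx⟩ := hx j
    obtain ⟨g, ⟨w, hw⟩, -⟩ := h.existsUnique (X.toE.app _ x)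
    exact ⟨X.act.smul g x, w, by rw [X.proj_smul, hx], by rw [hw, X.toE_smul]⟩
  choose y w hy hw using hloc
  obtain ⟨z, hz, -⟩ := X.isSheaf X.base ι hι T u hu y fun j k S b c hbc => by
    have hp {l : ι} (b : T l ⟶ S) : X.proj.app S (X.tot.map b (y l)) = u l ≫ b := by
      rw [← hy l]
      exact NatTrans.naturality_apply X.proj b (y l)
    have hE {l : ι} (b : T l ⟶ S) : X.toE.app S (X.tot.map b (y l)) = i.app S (W.map b (w l)) := by
      refine (NatTrans.naturality_apply X.toE b (y l)).trans ?_
      rw [← hw l]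
      exact (NatTrans.naturality_apply i b (w l)).symm
    obtain ⟨g, hg, -⟩ := X.simply_transitive (X.tot.map b (y j)) (X.tot.map c (y k))
      (by rw [hp, hp, hbc])
    have h1 := X.toE_smul g (X.tot.map b (y j))
    rw [hg, hE, hE] at h1
    obtain ⟨rfl, -⟩ := h.eq_one h1.symm
    rw [← hg, X.act.one_smul]
  have hzp : X.proj.app _ z = 𝟙 X.base := by
    refine (isEtaleSheaf_coyoneda X.base X.base ι hι T u hu u fun j k S b c hbc => hbc).unique
      (fun j => ?_) (fun j => by exact Category.id_comp (u j))
    refine (NatTrans.naturality_apply X.proj (u j) z).symm.trans ?_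
    rw [hz, hy]
  obtain ⟨g, ⟨v, hv⟩, -⟩ := h.existsUnique (X.toE.app _ z)
  exact ⟨X.act.smul g z, v, by rw [X.proj_smul, hzp], by rw [hv, X.toE_smul]⟩

theorem GrpAction.IsSlice.essSurj (h : a.IsSlice i) :
    (sliceToQuotient (a := a) hG i).EssSurj where
  mem_essImage X := by
    obtain ⟨y, w, hy, hw⟩ := h.exists_section X
    have hp {S : CommAlgCat.{u} κ} (r : X.base ⟶ S) : X.proj.app S (X.tot.map r y) = r := by
      refine (NatTrans.naturality_apply X.proj r y).trans ?_
      rw [hy]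
      exact Category.id_comp r
    let f : X ⟶ QuotientStack.ofPoint a hG X.base (i.app _ w) :=
      { base := 𝟙 _
        tot :=
          { app := fun S => ↾fun p => X.act.smul p.1 (X.tot.map p.2 y)
            naturality := fun S T r => by
              ext p
              change X.act.smul (G.map r p.1) (X.tot.map (p.2 ≫ r) y) =
                X.tot.map r (X.act.smul p.1 (X.tot.map p.2 y))
              rw [X.act.map_smul, Functor.map_comp_apply] }
        proj_comp := by
          ext S p
          change X.proj.app S (X.act.smul p.1 (X.tot.map p.2 y)) = 𝟙 _ ≫ p.2
          rw [X.proj_smul, hp, Category.id_comp]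
        equivariant := fun g p => X.act.mul_smul g p.1 _
        toE_comp := by
          ext S p
          change X.toE.app S (X.act.smul p.1 (X.tot.map p.2 y)) = a.smul p.1 (E.map p.2 (i.app _ w))
          rw [X.toE_smul, hw]
          exact congr_arg _ (NatTrans.naturality_apply X.toE p.2 y) }
    have hb : IsIso (QuotientStack.Hom.base f) := inferInstanceAs (IsIso (𝟙 _))
    have ht : IsIso (QuotientStack.Hom.tot f) := by
      have (S : CommAlgCat.{u} κ) : IsIso ((QuotientStack.Hom.tot f).app S) := by
        rw [isIso_iff_bijective]
        constructor
        · rintro ⟨g, r⟩ ⟨g', r'⟩ h1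
          have h2 : X.act.smul g (X.tot.map r y) = X.act.smul g' (X.tot.map r' y) := h1
          have h3 := congr_arg (X.proj.app S) h2
          rw [X.proj_smul, X.proj_smul, hp, hp] at h3
          subst h3
          exact Prod.ext ((X.simply_transitive (X.tot.map r y) _ (X.proj_smul g _).symm).unique
            rfl h2.symm) rfl
        · intro z
          obtain ⟨g, hg, -⟩ := X.simply_transitive (X.tot.map (X.proj.app S z) y) z (hp _)
          exact ⟨(g, X.proj.app S z), hg⟩
      exact NatIso.isIso_of_isIso_app _
    have := QuotientStack.isIso_of_isIso f
    exact ⟨⟨X.base, w⟩, ⟨(asIso f).symm⟩⟩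

theorem GrpAction.IsSlice.isEquivalence (h : a.IsSlice i) :
    (sliceToQuotient (a := a) hG i).IsEquivalence where
  faithful := GrpAction.IsSlice.faithful hG
  full := h.full hG
  essSurj := h.essSurj hG

end Slice

section

variable {κ : Type u} [Field κ] {m d : ℕ} [NeZero m] [NeZero d]

theorem autAction_isSlice (h : d = 1 ∨ (m : κ) ≠ 0) : (autAction κ m d).IsSlice (V.incl κ m d) where
  injective R := Subtype.val_injective
  existsUnique {R} φ := by
    have hmd : d = 1 ∨ IsUnit (m : R) := h.imp_right fun h => by
      simpa using (IsUnit.mk0 _ h).map (algebraMap κ R)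
    obtain ⟨e, he, hn, -, hu⟩ := exists_frame hmd (algebraMap R (Trunc m R)) φ.1.toRingHom
      φ.1.commutes (Trunc.algebraMap_isFinLocFree m R) φ.2.2
    let e' : Trunc m R ≃ₐ[R] Trunc m R := AlgEquiv.ofRingEquiv he
    have he' : (Trunc.pt m R).comp (e' : Trunc m R →ₐ[R] Trunc m R) = Trunc.pt m R := by
      refine Trunc.hom_ext ?_
      rw [AlgHom.comp_apply, ← φ.2.1, AlgHom.comp_apply, AlgHom.comp_apply, Trunc.pt_eq_coeff]
      refine (hn.1 0 (NeZero.pos d)).trans ?_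
      rw [← AlgHom.comp_apply, φ.2.1, Trunc.pt_t]
    let g : pointedAut m R := ⟨e', he'⟩
    refine ⟨(g⁻¹ : pointedAut m R), ⟨⟨(autAction κ m d).smul (g⁻¹ : pointedAut m R) φ,
      (mem_V_iff _).mpr ?_⟩, rfl⟩, ?_⟩
    · change IsNormal (φ.1 ((g⁻¹)⁻¹.1 (Trunc.t m R)))
      rw [inv_inv]
      exact hn
    · rintro (g' : pointedAut m R) ⟨v, hv⟩
      have h1 := (mem_V_iff v.1).mp v.2
      have h2 : v.1.1 (Trunc.t m R) = φ.1 (g'⁻¹.1 (Trunc.t m R)) :=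
        congr_arg (fun ψ => ψ.1 (Trunc.t m R)) hv
      rw [h2] at h1
      have h3 : g'⁻¹ = g := pointedAut_ext (hu _ h1)
      exact (inv_eq_iff_eq_inv.mp h3)

theorem V_toQuotient_isEquivalence (h : d = 1 ∨ (m : κ) ≠ 0) :
    (V.toQuotient κ m d).IsEquivalence :=
  (autAction_isSlice h).isEquivalence (autGroup_isEtaleSheaf κ m)

end

/-! ### Fitting ideals -/

section Fitting

variable {B M : Type*} [CommRing B] [AddCommGroup M] [Module B M]

theorem det_smul_eq_zero {r : ℕ} (N : Matrix (Fin r) (Fin r) B) (y : Fin r → M)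
    (h : ∀ i, ∑ j, N i j • y j = 0) (j : Fin r) : N.det • y j = 0 := by
  have h1 : ∑ i, N.adjugate j i • ∑ k, N i k • y k = 0 :=
    Finset.sum_eq_zero fun i _ => by rw [h i, smul_zero]
  simp only [Finset.smul_sum, smul_smul] at h1
  rw [Finset.sum_comm] at h1
  simp only [← Finset.sum_smul, ← Matrix.mul_apply, Matrix.adjugate_mul] at h1
  rw [Finset.sum_eq_single j] at h1
  · simpa using h1
  · intro k _ hk
    simp [Matrix.one_apply_ne (Ne.symm hk)]
  · simp

theorem smul_eq_zero_of_mem_fittingIdeal {δ : B} (hδ : δ ∈ fittingIdeal B M 0) (y : M) :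
    δ • y = 0 := by
  refine Submodule.span_induction (p := fun δ _ => δ • y = 0) ?_ (zero_smul _ _)
    (fun a b _ _ ha hb => by rw [add_smul, ha, hb, add_zero])
    (fun a b _ hb => by rw [smul_eq_mul, mul_smul, hb, smul_zero]) hδ
  rintro _ ⟨r, x, a, c, hx, ha, rfl⟩
  change Fin r → Fin r → B at a
  change Fin r → Fin r at c
  change ∀ i : Fin r, ∑ j, a i j • x j = 0 at ha
  change (Matrix.of fun i j : Fin r => a i (c j)).det • y = 0
  by_cases hc : Function.Injective c
  · have hcb : Function.Bijective c := Finite.injective_iff_bijective.mp hc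
    have h1 : ∀ j, (Matrix.of fun i j => a i (c j)).det • x (c j) = 0 :=
      det_smul_eq_zero _ (fun j => x (c j)) fun i => by
        simp only [Matrix.of_apply]
        rw [hcb.sum_comp fun j => a i j • x j]
        exact ha i
    have hy : y ∈ Submodule.span B (Set.range x) := hx ▸ Submodule.mem_top
    induction hy using Submodule.span_induction with
    | mem z hz =>
      obtain ⟨j, rfl⟩ := hz
      obtain ⟨k, rfl⟩ := hcb.2 j
      exact h1 k
    | zero => exact smul_zero _
    | add z w _ _ hz hw => rw [smul_add, hz, hw, add_zero]
    | smul b z _ hz => rw [smul_comm, hz, smul_zero]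
  · simp only [Function.Injective, not_forall] at hc
    obtain ⟨j, k, hjk, hne⟩ := hc
    rw [Matrix.det_zero_of_column_eq hne fun i => by simp [hjk], zero_smul]

/-- If `M` is cyclic up to multiplication by `v`, generated by `y`, then every annihilator of `y`
lies in the `0`-th Fitting ideal up to a power of `v`. -/
theorem exists_pow_mul_mem_fittingIdeal [Module.Finite B M] {v w : B} {y : M}
    (hv : ∀ z : M, ∃ b : B, v • z = b • y) (hw : w • y = 0) :
    ∃ r : ℕ, v ^ r * w ∈ fittingIdeal B M 0 := by
  obtain ⟨r, x, hx⟩ := Module.Finite.exists_fin (R := B) (M := M)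
  choose b hb using fun j => hv (x j)
  refine ⟨r, Ideal.subset_span ⟨r + 1, Fin.cons y x,
    Fin.cons (Fin.cons w 0) fun j => Fin.cons (-b j) (Pi.single j v), id, ?_, ?_, ?_⟩⟩
  · rw [eq_top_iff, ← hx]
    refine Submodule.span_mono ?_
    rintro _ ⟨j, rfl⟩
    exact ⟨j.succ, rfl⟩
  · intro i
    refine Fin.cases ?_ (fun j => ?_) i
    · rw [Fin.sum_univ_succ]
      simp [hw]
    · rw [Fin.sum_univ_succ]
      simp [Pi.single_apply, ite_smul, hb]
  · rw [eq_comm]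
    refine (Matrix.det_of_isLowerTriangular _ ?_).trans ?_
    · intro i j
      refine Fin.cases ?_ (fun i => ?_) i
      · refine Fin.cases ?_ (fun j => ?_) j
        · intro h
          exact absurd h (lt_irrefl _)
        · intro _
          rfl
      · refine Fin.cases ?_ (fun j => ?_) j
        · intro h
          exact absurd (OrderDual.toDual_lt_toDual.mp h) (by simp)
        · intro h
          have hij : i ≠ j := by
            rintro rfl
            exact lt_irrefl _ h
          exact Pi.single_eq_of_ne (M := fun _ => B) hij.symm v
    · refine (Fin.prod_univ_succ _).trans ?_
      simp [mul_comm]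

end Fitting

theorem stratumIdeal_mono (R B : Type*) [CommRing R] [CommRing B] [Algebra R B] :
    Monotone (stratumIdeal R B) :=
  monotone_nat_of_le_succ fun h b hb => by
    change Ideal.Quotient.mk (stratumIdeal R B h) b ∈
      fittingIdeal (B ⧸ stratumIdeal R B h) (Ω[(B ⧸ stratumIdeal R B h)⁄R]) 0
    rw [Ideal.Quotient.eq_zero_iff_mem.mpr hb]
    exact zero_mem _

theorem isCurvilinear_iff {R B : Type*} [CommRing R] [CommRing B] (str : R →+* B)
    (sec : B →+* R) (n : ℕ) {inst : Algebra R B} (h : str.toAlgebra = inst) :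
    IsCurvilinear str sec n ↔
      (fittingIdeal B (Ω[B⁄R]) 1).map sec = ⊤ ∧ ∀ b ∈ stratumIdeal R B (n - 1), sec b = 0 := by
  subst h
  exact Iff.rfl

/-! ### The standard object -/

section Standard

variable {n : ℕ} {R : Type*} [CommRing R]

/-- The reduction `R[t]/(t^n) → R[t]/(t^k)`. -/
noncomputable def Trunc.reduce {n k : ℕ} (R : Type*) [CommRing R] (h : k ≤ n) :
    Trunc n R →ₐ[R] Trunc k R :=
  Trunc.liftHom (Trunc.t k R) (Trunc.t_pow_of_le h)

theorem Trunc.reduce_mk {k : ℕ} (h : k ≤ n) (p : R[X]) :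
    Trunc.reduce R h (AdjoinRoot.mk _ p) = AdjoinRoot.mk _ p := by
  rw [← AdjoinRoot.aeval_eq, ← Polynomial.aeval_algHom_apply, Trunc.reduce, Trunc.liftHom_t,
    AdjoinRoot.aeval_eq]

theorem Trunc.coeff_reduce {k i : ℕ} (h : k ≤ n) (hi : i < k) (x : Trunc n R) :
    Trunc.coeff (Trunc.reduce R h x) i = Trunc.coeff x i := by
  obtain ⟨p, rfl⟩ := AdjoinRoot.mk_surjective x
  rw [Trunc.reduce_mk, Trunc.coeff_mk _ hi, Trunc.coeff_mk _ (by omega)]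

/-- The derivative as a linear map `R[t]/(t^{e+1}) → R[t]/(t^e)`. -/
noncomputable def Trunc.derivLin (e : ℕ) (R : Type*) [CommRing R] :
    Trunc (e + 1) R →ₗ[R] Trunc e R where
  toFun x := Trunc.ofCoeff e fun k => Trunc.coeff x (k + 1) * (k + 1)
  map_add' x y := Trunc.coeff_ext_lt fun k hk => by
    rw [Trunc.coeff_add, Trunc.coeff_ofCoeff _ hk, Trunc.coeff_ofCoeff _ hk,
      Trunc.coeff_ofCoeff _ hk, Trunc.coeff_add, add_mul]
  map_smul' r x := Trunc.coeff_ext_lt fun k hk => by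
    rw [Trunc.coeff_ofCoeff _ hk, RingHom.id_apply, Trunc.coeff_smul, Trunc.coeff_smul,
      Trunc.coeff_ofCoeff _ hk, mul_assoc]

theorem Trunc.derivLin_mk (e : ℕ) (p : R[X]) :
    Trunc.derivLin e R (AdjoinRoot.mk _ p) = AdjoinRoot.mk _ (derivative p) :=
  Trunc.coeff_ext_lt fun k hk => by
    refine (Trunc.coeff_ofCoeff _ hk).trans ?_
    rw [Trunc.coeff_mk _ (by omega), Trunc.coeff_mk _ hk, Polynomial.coeff_derivative]

theorem Trunc.derivLin_mul (e : ℕ) (x y : Trunc (e + 1) R) :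
    Trunc.derivLin e R (x * y) =
      Trunc.reduce R (Nat.le_succ e) x * Trunc.derivLin e R y +
        Trunc.reduce R (Nat.le_succ e) y * Trunc.derivLin e R x := by
  obtain ⟨p, rfl⟩ := AdjoinRoot.mk_surjective x
  obtain ⟨q, rfl⟩ := AdjoinRoot.mk_surjective y
  rw [← map_mul, Trunc.derivLin_mk, Trunc.derivLin_mk, Trunc.derivLin_mk, Trunc.reduce_mk,
    Trunc.reduce_mk, ← map_mul, ← map_mul, ← map_add, Polynomial.derivative_mul]
  congr 1
  ring

theorem Trunc.coeff_eq_zero_of_mem_stratumIdeal (h : ℕ) (b : Trunc n R)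
    (hb : b ∈ stratumIdeal R (Trunc n R) h) : ∀ i < n - h, Trunc.coeff b i = 0 := by
  induction h generalizing b with
  | zero =>
    intro i _
    rw [show b = 0 from hb, Trunc.coeff_zero]
  | succ h ih =>
    rcases le_or_gt n h with hn | hn
    · intro i hi
      omega
    obtain ⟨e, he⟩ : ∃ e, n = e + 1 + h := ⟨n - (h + 1), by omega⟩
    have he1 : n - h = e + 1 := by omega
    have he2 : n - (h + 1) = e := by omega
    have hle : e + 1 ≤ n := by omega
    let J := stratumIdeal R (Trunc n R) h
    let π : (Trunc n R ⧸ J) →ₐ[R] Trunc (e + 1) R :=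
      Ideal.Quotient.liftₐ J (Trunc.reduce R hle) fun a ha =>
        Trunc.coeff_ext_lt fun k hk => by
          rw [Trunc.coeff_reduce hle hk, Trunc.coeff_zero]
          exact ih a ha k (by omega)
    have hπ (a : Trunc n R) : π (Ideal.Quotient.mk J a) = Trunc.reduce R hle a := rfl
    let ρ : (Trunc n R ⧸ J) →ₐ[R] Trunc e R := (Trunc.reduce R (Nat.le_succ e)).comp π
    let : Module (Trunc n R ⧸ J) (Trunc e R) := Module.compHom _ (ρ : (Trunc n R ⧸ J) →+* Trunc e R)
    have hsmul (a : Trunc n R ⧸ J) (y : Trunc e R) : a • y = ρ a * y := rfl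
    have : IsScalarTower R (Trunc n R ⧸ J) (Trunc e R) := ⟨fun r a y => by
      rw [hsmul, hsmul, map_smul, smul_mul_assoc]⟩
    let D : Derivation R (Trunc n R ⧸ J) (Trunc e R) :=
      Derivation.mk' ((Trunc.derivLin e R).comp π.toLinearMap) fun x y => by
        change Trunc.derivLin e R (π (x * y)) = ρ x * Trunc.derivLin e R (π y) +
          ρ y * Trunc.derivLin e R (π x)
        rw [map_mul, Trunc.derivLin_mul]
        rfl
    have h1 := smul_eq_zero_of_mem_fittingIdeal (show Ideal.Quotient.mk J b ∈ _ from hb)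
      (KaehlerDifferential.D R (Trunc n R ⧸ J) (Ideal.Quotient.mk J (Trunc.t n R)))
    have h2 := congr_arg D.liftKaehlerDifferential h1
    rw [map_smul, Derivation.liftKaehlerDifferential_comp_D, map_zero, hsmul] at h2
    have h3 : D (Ideal.Quotient.mk J (Trunc.t n R)) = 1 := by
      change Trunc.derivLin e R (Trunc.reduce R hle (Trunc.t n R)) = 1
      rw [Trunc.t, ← AdjoinRoot.mk_X, Trunc.reduce_mk, Trunc.derivLin_mk, derivative_X, map_one]
    rw [h3, mul_one] at h2
    intro i hi
    rw [he2] at hi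
    have h4 : Trunc.reduce R (Nat.le_succ e) (Trunc.reduce R hle b) = 0 := h2
    rw [← Trunc.coeff_reduce hle (show i < e + 1 by omega), ← Trunc.coeff_reduce (Nat.le_succ e) hi,
      h4, Trunc.coeff_zero]

theorem Trunc.isCurvilinear (n : ℕ) [NeZero n] (R : Type*) [CommRing R] :
    IsCurvilinear (algebraMap R (Trunc n R)) (Trunc.pt n R : Trunc n R →+* R) n := by
  rw [isCurvilinear_iff _ _ _ toAlgebra_algebraMap]
  constructor
  · have h1 : fittingIdeal (Trunc n R) (Ω[Trunc n R⁄R]) 1 = ⊤ := by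
      rw [Ideal.eq_top_iff_one]
      refine Ideal.subset_span ⟨1, fun _ => KaehlerDifferential.D R _ (Trunc.t n R), Fin.elim0,
        Fin.elim0, ?_, fun i => i.elim0, ?_⟩
      · rw [eq_top_iff, ← KaehlerDifferential.span_range_derivation, Submodule.span_le]
        rintro _ ⟨b, rfl⟩
        obtain ⟨p, rfl⟩ := AdjoinRoot.mk_surjective b
        rw [← AdjoinRoot.aeval_eq, Derivation.map_aeval]
        exact Submodule.smul_mem _ _ (Submodule.subset_span ⟨0, rfl⟩)
      · exact (Matrix.det_isEmpty (n := Fin 0)).symm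
    rw [h1, Ideal.map_top]
  · intro b hb
    have := Trunc.coeff_eq_zero_of_mem_stratumIdeal (n - 1) b hb 0
      (by have := NeZero.pos n; omega)
    rw [← Trunc.pt_eq_coeff] at this
    exact this

variable (κ : Type u) [Field κ]

/-- The standard pointed curvilinear algebra `(R[t]/(t^n), q₀)`. -/
noncomputable def standardPointedAlg (n : ℕ) [NeZero n] (R : CommAlgCat.{u} κ) :
    PointedAlg κ n where
  base := R
  alg := CommRingCat.of (Trunc n R)
  str := algebraMap R (Trunc n R)
  sec := (Trunc.pt n R : Trunc n R →+* R)
  sec_str := (Trunc.pt n R).commutes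
  isFinLocFree := Trunc.algebraMap_isFinLocFree n R
  isCurvilinear := Trunc.isCurvilinear n R

theorem standardPointedAlg_isStandard (n : ℕ) [NeZero n] (R : CommAlgCat.{u} κ) :
    (standardPointedAlg κ n R).IsStandard :=
  ⟨RingEquiv.refl _, fun _ => rfl, fun _ => rfl⟩

end Standard

/-! ### Local structure of pointed curvilinear algebras -/

section LocalStructure

variable {R B : Type*} [CommRing R] [CommRing B] [Algebra R B]

theorem exists_dvd_generator_of_minor {M : Type*} [AddCommGroup M] [Module B M] {r : ℕ}
    {y : Fin (r + 1) → M} {a : Fin r → Fin (r + 1) → B} {c : Fin r → Fin (r + 1)}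
    (hy : Submodule.span B (Set.range y) = ⊤) (ha : ∀ i, ∑ j, a i j • y j = 0)
    (hdet : (Matrix.of fun i j => a i (c j)).det ≠ 0) :
    ∃ j₀, ∀ z : M, ∃ w : B, (Matrix.of fun i j => a i (c j)).det • z = w • y j₀ := by
  classical
  have hc : Function.Injective c := fun j k hjk => by
    by_contra hne
    exact hdet (Matrix.det_zero_of_column_eq hne fun i => by simp [hjk])
  have hcard : ((Finset.univ.image c)ᶜ).card = 1 := by
    rw [Finset.card_compl, Finset.card_image_of_injective _ hc]
    simp
  obtain ⟨j₀, hj₀⟩ := Finset.card_eq_one.mp hcard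
  have hrange (k : Fin (r + 1)) (hk : k ∉ Set.range c) : k = j₀ := by
    rw [← Finset.mem_singleton, ← hj₀, Finset.mem_compl, Finset.mem_image]
    rintro ⟨j, -, hj⟩
    exact hk ⟨j, hj⟩
  let Q := Submodule.span B {y j₀}
  have h0 : Q.mkQ (y j₀) = 0 := by
    rw [Submodule.mkQ_apply, Submodule.Quotient.mk_eq_zero]
    exact Submodule.mem_span_singleton_self _
  have h1 (j : Fin r) : (Matrix.of fun i j => a i (c j)).det • Q.mkQ (y (c j)) = 0 := by
    refine det_smul_eq_zero _ (fun j => Q.mkQ (y (c j))) (fun i => ?_) j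
    have h2 := congr_arg Q.mkQ (ha i)
    rw [map_sum, map_zero] at h2
    rw [← h2]
    refine Fintype.sum_of_injective c hc _ _ (fun k hk => ?_) fun j => by simp
    rw [hrange k hk, map_smul, h0, smul_zero]
  have h2 (z : M) : (Matrix.of fun i j => a i (c j)).det • Q.mkQ z = 0 := by
    have hz : z ∈ Submodule.span B (Set.range y) := hy ▸ Submodule.mem_top
    induction hz using Submodule.span_induction with
    | mem z hz =>
      obtain ⟨k, rfl⟩ := hz
      by_cases hk : k ∈ Set.range c
      · obtain ⟨j, rfl⟩ := hk
        exact h1 j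
      · rw [hrange k hk, h0, smul_zero]
    | zero => rw [map_zero, smul_zero]
    | add z w _ _ hz hw => rw [map_add, smul_add, hz, hw, add_zero]
    | smul b z _ hz => rw [map_smul, smul_comm, hz, smul_zero]
  refine ⟨j₀, fun z => ?_⟩
  have h3 := h2 z
  rw [← map_smul, Submodule.mkQ_apply, Submodule.Quotient.mk_eq_zero] at h3
  obtain ⟨w, hw⟩ := Submodule.mem_span_singleton.mp h3
  exact ⟨w, hw.symm⟩

/-- If the section `q` avoids the first Fitting ideal of `Ω`, then near every point of the base there
is `t` in the augmentation ideal whose differential generates `Ω` along the section. -/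
theorem exists_local_parameter (q : B →ₐ[R] R)
    (hq : (fittingIdeal B (Ω[B⁄R]) 1).map (q : B →+* R) = ⊤) (x : Ideal R) [hx : x.IsPrime] :
    ∃ t v : B, q t = 0 ∧ q v ∉ x ∧
      ∀ z : Ω[B⁄R], ∃ w : B, v • z = w • KaehlerDifferential.D R B t := by
  obtain ⟨δ, ⟨r, y, a, c, hy, ha, hδ⟩, hδx⟩ : ∃ δ ∈ {δ : B | ∃ (r : ℕ) (x : Fin r → Ω[B⁄R])
      (a : Fin (r - 1) → Fin r → B) (c : Fin (r - 1) → Fin r),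
      Submodule.span B (Set.range x) = ⊤ ∧ (∀ i, ∑ j, a i j • x j = 0) ∧
        δ = Matrix.det (Matrix.of fun i j => a i (c j))}, q δ ∉ x := by
    by_contra hcon
    push Not at hcon
    refine hx.ne_top (top_le_iff.mp ?_)
    rw [← hq, Ideal.map_le_iff_le_comap]
    exact Ideal.span_le.mpr hcon
  rcases r with _ | r
  · refine ⟨0, 1, map_zero q, by rw [map_one]; exact hx.one_notMem, fun z => ⟨0, ?_⟩⟩
    have hz : z ∈ Submodule.span B (Set.range y) := hy ▸ Submodule.mem_top
    rw [Set.range_eq_empty, Submodule.span_empty, Submodule.mem_bot] at hz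
    rw [hz, smul_zero, zero_smul]
  change Fin r → Fin (r + 1) → B at a
  change Fin r → Fin (r + 1) at c
  change δ = (Matrix.of fun i j : Fin r => a i (c j)).det at hδ
  obtain ⟨j₀, hj₀⟩ := exists_dvd_generator_of_minor hy ha (by
    rw [← hδ]
    rintro rfl
    exact hδx (by rw [map_zero]; exact x.zero_mem))
  rw [← hδ] at hj₀
  set ω := y j₀
  let I : Ideal B := RingHom.ker (q : B →+* R)
  have hI (b : B) : b - algebraMap R B (q b) ∈ I := by
    change q (b - algebraMap R B (q b)) = 0
    rw [map_sub, q.commutes, Algebra.algebraMap_self_apply, sub_self]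
  have hdiff (z : Ω[B⁄R]) : ∃ t : B, q t = 0 ∧
      z - KaehlerDifferential.D R B t ∈ I • (⊤ : Submodule B (Ω[B⁄R])) := by
    have hz : z ∈ Submodule.span B (Set.range (KaehlerDifferential.D R B)) := by
      rw [KaehlerDifferential.span_range_derivation]
      exact Submodule.mem_top
    induction hz using Submodule.span_induction with
    | mem z hz =>
      obtain ⟨b, rfl⟩ := hz
      refine ⟨b - algebraMap R B (q b), hI b, ?_⟩
      rw [map_sub, Derivation.map_algebraMap, sub_zero, sub_self]
      exact zero_mem _
    | zero => exact ⟨0, map_zero q, by rw [map_zero, sub_zero]; exact zero_mem _⟩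
    | add z w _ _ hz hw =>
      obtain ⟨t, ht, hzt⟩ := hz
      obtain ⟨s, hs, hws⟩ := hw
      refine ⟨t + s, by rw [map_add, ht, hs, add_zero], ?_⟩
      rw [map_add, add_sub_add_comm]
      exact add_mem hzt hws
    | smul b z _ hz =>
      obtain ⟨t, ht, hzt⟩ := hz
      refine ⟨q b • t, by rw [map_smul, ht, smul_zero], ?_⟩
      have h1 : b • z - KaehlerDifferential.D R B (q b • t) =
          (b - algebraMap R B (q b)) • z +
            algebraMap R B (q b) • (z - KaehlerDifferential.D R B t) := by
        rw [Derivation.map_smul, smul_sub, sub_smul, algebraMap_smul, algebraMap_smul]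
        abel
      rw [h1]
      exact add_mem (Submodule.smul_mem_smul (hI b) Submodule.mem_top)
        (Submodule.smul_mem _ _ hzt)
  have hsmul (z : Ω[B⁄R]) (hz : z ∈ I • (⊤ : Submodule B (Ω[B⁄R]))) :
      ∃ i : B, q i = 0 ∧ δ • z = i • ω := by
    induction hz using Submodule.smul_induction_on' with
    | smul i hi z _ =>
      obtain ⟨w, hw⟩ := hj₀ z
      refine ⟨i * w, ?_, by rw [smul_comm, hw, smul_smul]⟩
      rw [map_mul, show q i = 0 from hi, zero_mul]
    | add z _ w _ hz hw =>
      obtain ⟨i, hi, hiz⟩ := hz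
      obtain ⟨j, hj, hjw⟩ := hw
      exact ⟨i + j, by rw [map_add, hi, hj, add_zero], by rw [smul_add, hiz, hjw, add_smul]⟩
  obtain ⟨t, ht, htω⟩ := hdiff ω
  obtain ⟨i, hi, hiω⟩ := hsmul _ htω
  refine ⟨t, (δ - i) * δ, ht, ?_, fun z => ?_⟩
  · rw [map_mul, map_sub, hi, sub_zero]
    exact fun h => (hx.mem_or_mem h).elim hδx hδx
  · obtain ⟨w, hw⟩ := hj₀ z
    refine ⟨w * δ, ?_⟩
    have h1 : (δ - i) • ω = δ • KaehlerDifferential.D R B t := by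
      rw [sub_smul, ← hiω, smul_sub, sub_sub_cancel]
    rw [mul_smul, hw, smul_comm, h1, smul_smul]

/-- The derivatives of a polynomial relation for `t` modulo an ideal of the base lie in the ideals of
the strata, up to multiplication by powers of `v`. -/
theorem exists_mem_stratumIdeal [Algebra.FiniteType R B] {t v : B}
    (hv : ∀ z : Ω[B⁄R], ∃ w : B, v • z = w • KaehlerDifferential.D R B t) (𝔞 : Ideal R) (F : R[X])
    (hF : aeval t F ∈ 𝔞.map (algebraMap R B)) (h : ℕ) :
    ∃ N : ℕ, ∃ j ∈ stratumIdeal R B h,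
      j - v ^ N * aeval t (derivative^[h] F) ∈ 𝔞.map (algebraMap R B) := by
  induction h with
  | zero => exact ⟨0, 0, zero_mem _, by simpa using hF⟩
  | succ h ih =>
    obtain ⟨N, j, hj, hz⟩ := ih
    set 𝔟 := 𝔞.map (algebraMap R B)
    set f := aeval t (derivative^[h] F)
    set f' := aeval t (derivative^[h + 1] F) with hf'
    set z := j - v ^ N * f
    let J := stratumIdeal R B h
    let π := Ideal.Quotient.mk J
    let D := KaehlerDifferential.D R (B ⧸ J)
    let ω := D (π t)
    have hvD (b : B) : ∃ w : B, π v • D (π b) = π w • ω := by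
      obtain ⟨w, hw⟩ := hv (KaehlerDifferential.D R B b)
      refine ⟨w, ?_⟩
      have h1 := congr_arg (KaehlerDifferential.map R R B (B ⧸ J)) hw
      rw [map_smul, map_smul, KaehlerDifferential.map_D, KaehlerDifferential.map_D,
        ← algebraMap_smul (B ⧸ J), ← algebraMap_smul (B ⧸ J) w] at h1
      exact h1
    have hvz : ∃ z' ∈ 𝔟, π v • D (π z) = π z' • ω := by
      refine Submodule.span_induction (p := fun z _ => ∃ z' ∈ 𝔟, π v • D (π z) = π z' • ω)
        ?_ ?_ ?_ ?_ hz
      · rintro _ ⟨r, -, rfl⟩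
        refine ⟨0, zero_mem _, ?_⟩
        rw [show π (algebraMap R B r) = algebraMap R (B ⧸ J) r from rfl, Derivation.map_algebraMap,
          smul_zero, map_zero, zero_smul]
      · exact ⟨0, zero_mem _, by rw [map_zero, map_zero, smul_zero, zero_smul]⟩
      · rintro y w - - ⟨y', hy', hy⟩ ⟨w', hw', hw⟩
        exact ⟨y' + w', add_mem hy' hw', by
          rw [map_add, map_add, smul_add, hy, hw, map_add, add_smul]⟩
      · rintro b y hyb ⟨y', hy', hy⟩
        obtain ⟨w, hw⟩ := hvD b
        refine ⟨b * y' + y * w, add_mem (𝔟.mul_mem_left _ hy') (𝔟.mul_mem_right _ hyb), ?_⟩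
        rw [smul_eq_mul, map_mul, Derivation.leibniz, smul_add, smul_comm, hy,
          smul_comm (π v) (π y), hw, smul_smul, smul_smul, ← map_mul, ← map_mul, ← add_smul,
          ← map_add]
    obtain ⟨z', hz', hvz'⟩ := hvz
    obtain ⟨w, hw⟩ := hvD (v ^ N)
    have hDf : D (π f) = π f' • ω := by
      have h1 (P : R[X]) : π (aeval t P) = aeval (π t) P :=
        (Polynomial.aeval_algHom_apply (Ideal.Quotient.mkₐ R J) t P).symm
      rw [h1, Derivation.map_aeval, ← h1, hf', Function.iterate_succ_apply']
    have hπz : π z = -(π (v ^ N) * π f) := by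
      rw [map_sub, map_mul, Ideal.Quotient.eq_zero_iff_mem.mpr hj, zero_sub]
    let e := v ^ N * z' - z * w
    have hu : π (v ^ N * v ^ N * v * f' + e) • ω = 0 := by
      have h1 : D (π z) + (π (v ^ N) • π f' • ω + π f • D (π (v ^ N))) = 0 := by
        rw [← hDf, ← Derivation.leibniz, ← map_add, hπz, neg_add_cancel, map_zero]
      have h2 := congr_arg (fun y => π (v ^ N) • π v • y) h1
      simp only [smul_add, smul_zero] at h2
      rw [hvz', smul_comm (π v) (π f), hw] at h2
      have h3 : π e = π (v ^ N) * π z' + π (v ^ N) * π f * π w := by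
        rw [map_sub, map_mul, map_mul, hπz]
        ring
      rw [map_add, h3, add_smul, add_smul, ← h2]
      simp only [smul_smul, map_mul, mul_assoc]
      have : π (v ^ N) * (π v * (π (v ^ N) * π f')) = π (v ^ N) * (π (v ^ N) * (π v * π f')) := by
        ring
      rw [this]
      abel
    have hgen (y : Ω[(B ⧸ J)⁄R]) : ∃ b : B ⧸ J, π v • y = b • ω := by
      have hy : y ∈ Submodule.span (B ⧸ J) (Set.range D) := by
        rw [KaehlerDifferential.span_range_derivation]
        exact Submodule.mem_top
      induction hy using Submodule.span_induction with
      | mem y hy =>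
        obtain ⟨b, rfl⟩ := hy
        obtain ⟨b, rfl⟩ := Ideal.Quotient.mk_surjective b
        obtain ⟨w, hw⟩ := hvD b
        exact ⟨_, hw⟩
      | zero => exact ⟨0, by rw [smul_zero, zero_smul]⟩
      | add y y' _ _ hy hy' =>
        obtain ⟨b, hb⟩ := hy
        obtain ⟨b', hb'⟩ := hy'
        exact ⟨b + b', by rw [smul_add, hb, hb', add_smul]⟩
      | smul c y _ hy =>
        obtain ⟨b, hb⟩ := hy
        exact ⟨c * b, by rw [smul_comm, hb, smul_smul]⟩
    obtain ⟨r, hr⟩ := exists_pow_mul_mem_fittingIdeal hgen hu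
    refine ⟨r + (N + N + 1), v ^ r * (v ^ N * v ^ N * v * f' + e), ?_, ?_⟩
    · change π (v ^ r * (v ^ N * v ^ N * v * f' + e)) ∈ fittingIdeal (B ⧸ J) (Ω[(B ⧸ J)⁄R]) 0
      rwa [map_mul, map_pow]
    · have h1 : v ^ r * (v ^ N * v ^ N * v * f' + e) - v ^ (r + (N + N + 1)) * f' = v ^ r * e := by
        ring
      rw [h1]
      exact 𝔟.mul_mem_left _ (sub_mem (𝔟.mul_mem_left _ hz') (𝔟.mul_mem_right _ hz))

/-- A relation for the local parameter modulo an ideal of the base is trivial in degrees below `n`. -/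
theorem exists_pow_mul_coeff_mem [Algebra.FiniteType R B] {q : B →ₐ[R] R} {t v : B} {n : ℕ}
    (hq : ∀ b ∈ stratumIdeal R B (n - 1), q b = 0) (hn : IsUnit ((n - 1).factorial : R))
    (ht : q t = 0) (hv : ∀ z : Ω[B⁄R], ∃ w : B, v • z = w • KaehlerDifferential.D R B t)
    (𝔞 : Ideal R) (F : R[X]) (hF : aeval t F ∈ 𝔞.map (algebraMap R B)) {h : ℕ} (hh : h < n) :
    ∃ N : ℕ, q v ^ N * F.coeff h ∈ 𝔞 := by
  obtain ⟨N, j, hj, hjz⟩ := exists_mem_stratumIdeal hv 𝔞 F hF h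
  have h1 : 𝔞.map (algebraMap R B) ≤ 𝔞.comap (q : B →+* R) :=
    Ideal.map_le_iff_le_comap.mpr fun r hr => by
      change q (algebraMap R B r) ∈ 𝔞
      rwa [q.commutes]
  have h2 : q (j - v ^ N * aeval t (derivative^[h] F)) ∈ 𝔞 := h1 hjz
  rw [map_sub, hq j (stratumIdeal_mono R B (by omega) hj), zero_sub, neg_mem_iff, map_mul, map_pow,
    ← Polynomial.aeval_algHom_apply, ht, ← Polynomial.coeff_zero_eq_aeval_zero,
    Polynomial.coeff_iterate_derivative, zero_add, Nat.descFactorial_self, nsmul_eq_mul] at h2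
  obtain ⟨c, hc⟩ := Nat.factorial_dvd_factorial (show h ≤ n - 1 by omega)
  have h3 : IsUnit (h.factorial : R) := by
    rw [hc, Nat.cast_mul] at hn
    exact isUnit_of_mul_isUnit_left hn
  obtain ⟨w, hw⟩ := h3.exists_left_inv
  refine ⟨N, ?_⟩
  have h4 : q v ^ N * F.coeff h = w * (q v ^ N * (h.factorial * F.coeff h)) := by
    linear_combination (-(q v ^ N * F.coeff h)) * hw
  rw [h4]
  exact 𝔞.mul_mem_left _ h2

end LocalStructure

section Trivialization

open TensorProduct

variable {R B : Type*} [CommRing R] [CommRing B] [Algebra R B]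

/-- Elements of `B` that are linearly independent modulo the prime ideal `x` are linearly independent
in the fibre at `x`. -/
theorem linearIndependent_fiber {ι : Type*} [Fintype ι] (x : Ideal R) [x.IsPrime] (b : ι → B)
    (h : ∀ c : ι → R, ∑ i, c i • b i ∈ x.map (algebraMap R B) → ∀ i, c i ∈ x) :
    LinearIndependent x.ResidueField
      (fun i => (1 : x.ResidueField) ⊗ₜ[R] b i : ι → x.ResidueField ⊗[R] B) := by
  have h1 : LinearIndependent (R ⧸ x) (fun i => (1 : R ⧸ x) ⊗ₜ[R] b i : ι → (R ⧸ x) ⊗[R] B) := by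
    rw [Fintype.linearIndependent_iff]
    intro g hg i
    choose c hc using fun i => Ideal.Quotient.mk_surjective (g i)
    rw [← hc, Ideal.Quotient.eq_zero_iff_mem]
    refine h c ?_ i
    have h2 : ∑ i, g i • (1 : R ⧸ x) ⊗ₜ[R] b i =
        Ideal.Quotient.mk x 1 ⊗ₜ[R] ∑ i, c i • b i := by
      rw [TensorProduct.tmul_sum]
      refine Finset.sum_congr rfl fun i _ => ?_
      rw [← hc, map_one, TensorProduct.tmul_smul]
      exact algebraMap_smul (R ⧸ x) (c i) _
    rw [h2] at hg
    have h3 := congr_arg (TensorProduct.quotTensorEquivQuotSMul B x) hg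
    rw [TensorProduct.quotTensorEquivQuotSMul_mk_tmul, one_smul, map_zero,
      Submodule.Quotient.mk_eq_zero, Ideal.smul_top_eq_map] at h3
    exact h3
  let f : (R ⧸ x) ⊗[R] B →ₗ[R ⧸ x] x.ResidueField ⊗[R] B :=
    TensorProduct.AlgebraTensorModule.map (Algebra.linearMap (R ⧸ x) x.ResidueField) LinearMap.id
  have hf : IsBaseChange x.ResidueField f := by
    refine IsBaseChange.of_comp (TensorProduct.isBaseChange R B (R ⧸ x)) ?_
    convert TensorProduct.isBaseChange R B x.ResidueField
    ext b
    simp [f]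
  have : IsLocalizedModule (nonZeroDivisors (R ⧸ x)) f :=
    (isLocalizedModule_iff_isBaseChange (nonZeroDivisors (R ⧸ x)) x.ResidueField f).mpr hf
  have h2 := h1.of_isLocalizedModule x.ResidueField (nonZeroDivisors (R ⧸ x)) f
  have h3 : f ∘ (fun i => (1 : R ⧸ x) ⊗ₜ[R] b i) = fun i => (1 : x.ResidueField) ⊗ₜ[R] b i := by
    ext i
    simp [f]
  rw [h3] at h2
  exact h2

/-- As many linearly independent elements of the fibre as the rank generate near the point. -/
theorem exists_smul_mem_span [Module.Finite R B] [Module.Flat R B] {ι : Type*} [Fintype ι]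
    (x : Ideal R) [hx : x.IsPrime] (b : ι → B)
    (hrank : Module.rankAtStalk B (⟨x, hx⟩ : PrimeSpectrum R) = Fintype.card ι)
    (hb : LinearIndependent x.ResidueField
      (fun i => (1 : x.ResidueField) ⊗ₜ[R] b i : ι → x.ResidueField ⊗[R] B)) :
    ∃ g, g ∉ x ∧ ∀ y : B, g • y ∈ Submodule.span R (Set.range b) := by
  let N := Submodule.span R (Set.range b)
  have htop := hb.span_eq_top_of_card_eq_finrank' (by
    rw [← hrank]
    exact (Ideal.finrank_fiber_eq_rankAtStalk x).symm)
  have hzero : ¬ Nontrivial (x.ResidueField ⊗[R] (B ⧸ N)) := by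
    rw [not_nontrivial_iff_subsingleton]
    let F : x.ResidueField ⊗[R] B →ₗ[x.ResidueField] x.ResidueField ⊗[R] (B ⧸ N) :=
      TensorProduct.AlgebraTensorModule.map LinearMap.id N.mkQ
    have hF (z : x.ResidueField ⊗[R] (B ⧸ N)) : ∃ y, F y = z := by
      induction z using TensorProduct.induction_on with
      | zero => exact ⟨0, map_zero F⟩
      | tmul c y =>
        obtain ⟨y, rfl⟩ := N.mkQ_surjective y
        exact ⟨c ⊗ₜ y, rfl⟩
      | add y z hy hz =>
        obtain ⟨y, rfl⟩ := hy
        obtain ⟨z, rfl⟩ := hz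
        exact ⟨y + z, map_add F y z⟩
    have hF0 : ∀ z, F z = 0 := fun z => by
      have hz : z ∈ Submodule.span x.ResidueField
          (Set.range fun i => (1 : x.ResidueField) ⊗ₜ[R] b i) := by
        rw [htop]
        exact Submodule.mem_top
      induction hz using Submodule.span_induction with
      | mem z hz =>
        obtain ⟨i, rfl⟩ := hz
        have : N.mkQ (b i) = 0 := by
          rw [Submodule.mkQ_apply, Submodule.Quotient.mk_eq_zero]
          exact Submodule.subset_span ⟨i, rfl⟩
        change (1 : x.ResidueField) ⊗ₜ[R] N.mkQ (b i) = 0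
        rw [this, TensorProduct.tmul_zero]
      | zero => exact map_zero F
      | add z w _ _ hz hw => rw [map_add, hz, hw, add_zero]
      | smul c z _ hz => rw [map_smul, hz, smul_zero]
    refine ⟨fun y z => ?_⟩
    obtain ⟨y, rfl⟩ := hF y
    obtain ⟨z, rfl⟩ := hF z
    rw [hF0, hF0]
  rw [← Module.mem_support_iff_nontrivial_residueField_tensorProduct (⟨x, hx⟩ : PrimeSpectrum R),
    Module.mem_support_iff_of_finite, SetLike.not_le_iff_exists] at hzero
  obtain ⟨g, hg, hgx⟩ := hzero
  refine ⟨g, hgx, fun y => ?_⟩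
  have := Module.mem_annihilator.mp hg (N.mkQ y)
  rwa [← map_smul, Submodule.mkQ_apply, Submodule.Quotient.mk_eq_zero] at this

/-- Near every point of the base, the powers of a local parameter of a curvilinear algebra form a
basis. -/
theorem exists_trivialization {n : ℕ} (hB : IsFinLocFree (algebraMap R B) n) (q : B →ₐ[R] R)
    (hc : IsCurvilinear (algebraMap R B) (q : B →+* R) n)
    (hn : IsUnit ((n - 1).factorial : R)) (x : Ideal R) [hx : x.IsPrime] :
    ∃ g, g ∉ x ∧ ∃ t : B, q t = 0 ∧
      (∀ b : B, g • b ∈ Submodule.span R (Set.range fun i : Fin n => t ^ (i : ℕ))) ∧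
      (∀ c : Fin n → R, ∑ i, c i • t ^ (i : ℕ) = 0 → ∀ i, ∃ N : ℕ, g ^ N * c i = 0) ∧
      ∃ N : ℕ, g ^ N • t ^ n = 0 := by
  rw [isCurvilinear_iff _ _ _ toAlgebra_algebraMap] at hc
  obtain ⟨hfit, hstr⟩ := hc
  have : Module.Finite R B := RingHom.finite_algebraMap.mp hB.1
  have : Module.Flat R B := RingHom.flat_algebraMap_iff.mp hB.2.1
  obtain ⟨t, v, ht, hvx, hv⟩ := exists_local_parameter q hfit x
  have hrel (𝔞 : Ideal R) (c : Fin n → R)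
      (h : ∑ i, c i • t ^ (i : ℕ) ∈ 𝔞.map (algebraMap R B)) (i : Fin n) :
      ∃ N : ℕ, q v ^ N * c i ∈ 𝔞 := by
    obtain ⟨N, hN⟩ := exists_pow_mul_coeff_mem (h := i) hstr hn ht hv 𝔞
      (∑ i : Fin n, C (c i) * X ^ (i : ℕ))
      (by simpa [map_sum, Algebra.smul_def] using h) i.2
    refine ⟨N, ?_⟩
    simpa [Polynomial.finsetSum_coeff, Polynomial.coeff_C_mul, Polynomial.coeff_X_pow,
      Fin.val_inj] using hN
  obtain ⟨g, hgx, hg⟩ := exists_smul_mem_span x (fun i : Fin n => t ^ (i : ℕ))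
    (by rw [← RingHom.finrank_algebraMap, hB.2.2.2, Fintype.card_fin])
    (linearIndependent_fiber x _ fun c h i => by
      obtain ⟨N, hN⟩ := hrel x c h i
      exact (hx.mem_or_mem hN).resolve_left fun h => hvx (hx.mem_of_pow_mem N h))
  refine ⟨g * q v, fun h => (hx.mem_or_mem h).elim hgx hvx, t, ht, fun b => ?_, fun c h i => ?_, ?_⟩
  · rw [mul_comm, mul_smul]
    exact Submodule.smul_mem _ _ (hg b)
  · obtain ⟨N, hN⟩ := hrel ⊥ c (by rw [h]; exact zero_mem _) i
    refine ⟨N, ?_⟩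
    rw [mul_pow, mul_assoc, show q v ^ N * c i = 0 from hN, mul_zero]
  · obtain ⟨a, ha⟩ := (Submodule.mem_span_range_iff_exists_fun R).mp (hg (t ^ n))
    have hN (i : Fin n) : ∃ N : ℕ, q v ^ N * a i = 0 := by
      obtain ⟨N, hN⟩ := exists_pow_mul_coeff_mem (h := i) hstr hn ht hv ⊥
        (C g * X ^ n - ∑ i : Fin n, C (a i) * X ^ (i : ℕ)) (by
          have : aeval t (C g * X ^ n - ∑ i : Fin n, C (a i) * X ^ (i : ℕ)) = 0 := by
            rw [map_sub, map_sum, sub_eq_zero]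
            simpa [Algebra.smul_def] using ha.symm
          rw [this]
          exact zero_mem _) i.2
      refine ⟨N, ?_⟩
      have hi : (i : ℕ) ≠ n := i.2.ne
      have h2 : (C g * X ^ n - ∑ i : Fin n, C (a i) * X ^ (i : ℕ)).coeff (i : ℕ) = -a i := by
        simp [Polynomial.finsetSum_coeff, Polynomial.coeff_C_mul, Polynomial.coeff_X_pow,
          Fin.val_inj, hi]
      rw [h2, Ideal.mem_bot, mul_neg, neg_eq_zero] at hN
      exact hN
    choose N hN using hN
    refine ⟨∑ i, N i + 1, ?_⟩
    have h1 : q v ^ (∑ i, N i) • ∑ i, a i • t ^ (i : ℕ) = 0 := by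
      rw [Finset.smul_sum]
      refine Finset.sum_eq_zero fun i _ => ?_
      obtain ⟨k, hk⟩ := Nat.exists_eq_add_of_le (Finset.single_le_sum (f := N)
        (fun _ _ => Nat.zero_le _) (Finset.mem_univ i))
      rw [smul_smul, hk, pow_add, mul_right_comm, hN, zero_mul, zero_smul]
    rw [ha, smul_smul] at h1
    rw [show (g * q v) ^ (∑ i, N i + 1) = (g ^ (∑ i, N i) * q v) * (q v ^ (∑ i, N i) * g) by ring,
      mul_smul, h1, smul_zero]

end Trivialization

section LocalTriviality

open TensorProduct

theorem Trunc.lift_bijective_of_isLocalization {R B : Type*} [CommRing R] [CommRing B] [Algebra R B]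
    (S : Type*) [CommRing S] [Algebra R S] {n : ℕ} {g : R} [IsLocalization.Away g S] {t : B}
    (hspan : ∀ b : B, g • b ∈ Submodule.span R (Set.range fun i : Fin n => t ^ (i : ℕ)))
    (hind : ∀ c : Fin n → R, ∑ i, c i • t ^ (i : ℕ) = 0 → ∀ i, ∃ N : ℕ, g ^ N * c i = 0)
    (ht : ((1 : S) ⊗ₜ[R] t) ^ n = 0) :
    Function.Bijective (Trunc.liftHom (R := S) ((1 : S) ⊗ₜ[R] t) ht) := by
  have hg : IsUnit (algebraMap R S g) := IsLocalization.Away.algebraMap_isUnit g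
  have hpow (s : S) (i : ℕ) : Trunc.liftHom (R := S) ((1 : S) ⊗ₜ[R] t) ht (s • Trunc.t n S ^ i) =
      s ⊗ₜ (t ^ i) := by
    rw [map_smul, map_pow, Trunc.liftHom_t, Algebra.TensorProduct.tmul_pow, one_pow,
      TensorProduct.smul_tmul', smul_eq_mul, mul_one]
  constructor
  · rw [injective_iff_map_eq_zero]
    intro x hx
    rw [Trunc.eq_sum x, Finset.sum_range, map_sum] at hx
    simp only [hpow] at hx
    obtain ⟨⟨_, M, rfl⟩, hM⟩ := IsLocalization.exist_integer_multiples_of_finite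
      (Submonoid.powers g) fun i : Fin n => Trunc.coeff x i
    choose r hr using hM
    have h1 : (1 : S) ⊗ₜ[R] ∑ i : Fin n, r i • t ^ (i : ℕ) = 0 := by
      have h2 := congr_arg (fun z => g ^ M • z) hx
      rw [smul_zero, Finset.smul_sum] at h2
      rw [← h2, TensorProduct.tmul_sum]
      refine Finset.sum_congr rfl fun i _ => ?_
      rw [TensorProduct.tmul_smul, TensorProduct.smul_tmul', ← Algebra.algebraMap_eq_smul_one, hr]
      exact (TensorProduct.smul_tmul' _ _ _).symm
    have h2 : IsLocalizedModule (Submonoid.powers g) (TensorProduct.mk R S B 1) :=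
      (isLocalizedModule_iff_isBaseChange (Submonoid.powers g) S _).mpr
        (TensorProduct.isBaseChange R B S)
    obtain ⟨⟨_, K, rfl⟩, hK⟩ := (IsLocalizedModule.eq_zero_iff (Submonoid.powers g)
      (TensorProduct.mk R S B 1)).mp h1
    rw [Submonoid.smul_def, Finset.smul_sum] at hK
    simp only [smul_smul] at hK
    refine Trunc.coeff_ext_lt fun i hi => ?_
    obtain ⟨N, hN⟩ := hind _ hK ⟨i, hi⟩
    have h3 := congr_arg (algebraMap R S) hN
    rw [map_mul, map_mul, hr, map_zero, Algebra.smul_def] at h3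
    simp only [map_pow] at h3
    rw [(hg.pow N).mul_right_eq_zero, (hg.pow K).mul_right_eq_zero,
      (hg.pow M).mul_right_eq_zero] at h3
    rw [h3, Trunc.coeff_zero]
  · intro z
    obtain ⟨w, hw⟩ := hg.exists_right_inv
    suffices h : ∃ x, Trunc.liftHom (R := S) ((1 : S) ⊗ₜ[R] t) ht x = algebraMap R S g • z by
      obtain ⟨x, hx⟩ := h
      exact ⟨w • x, by rw [map_smul, hx, smul_smul, mul_comm, hw, one_smul]⟩
    induction z using TensorProduct.induction_on with
    | zero => exact ⟨0, by rw [map_zero, smul_zero]⟩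
    | tmul s b =>
      obtain ⟨c, hc⟩ := (Submodule.mem_span_range_iff_exists_fun R).mp (hspan b)
      refine ⟨∑ i : Fin n, (s * algebraMap R S (c i)) • Trunc.t n S ^ (i : ℕ), ?_⟩
      rw [map_sum, algebraMap_smul, TensorProduct.smul_tmul', TensorProduct.smul_tmul, ← hc,
        TensorProduct.tmul_sum]
      refine Finset.sum_congr rfl fun i _ => ?_
      rw [hpow, ← TensorProduct.smul_tmul, Algebra.smul_def, mul_comm]
    | add y z hy hz =>
      obtain ⟨x, hx⟩ := hy
      obtain ⟨x', hx'⟩ := hz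
      exact ⟨x + x', by rw [map_add, hx, hx', smul_add]⟩

/-- The morphism to the standard object over `S` given by a trivialization of the base change. -/
theorem exists_hom_standardPointedAlg {κ : Type u} [Field κ] {n : ℕ} [NeZero n]
    (ξ : PointedAlg κ n) (S : CommAlgCat.{u} κ) (u : ξ.base ⟶ S) (g : ξ.base)
    (hloc : letI := (ringHom u).toAlgebra; IsLocalization.Away g S) (t : ξ.alg)
    (hqt : ξ.sec t = 0)
    (hspan : letI := ξ.str.toAlgebra; ∀ b : ξ.alg,
      g • b ∈ Submodule.span ξ.base (Set.range fun i : Fin n => t ^ (i : ℕ)))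
    (hind : letI := ξ.str.toAlgebra; ∀ c : Fin n → ξ.base,
      ∑ i, c i • t ^ (i : ℕ) = 0 → ∀ i, ∃ N : ℕ, g ^ N * c i = 0)
    (ht : letI := ξ.str.toAlgebra; ∃ N : ℕ, g ^ N • t ^ n = 0) :
    ∃ a : ξ ⟶ standardPointedAlg κ n S, a.base = u := by
  let : Algebra ξ.base ξ.alg := ξ.str.toAlgebra
  let : Algebra ξ.base S := (ringHom u).toAlgebra
  have : IsLocalization.Away g S := hloc
  have ht' : ((1 : S) ⊗ₜ[ξ.base] t) ^ n = 0 := by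
    obtain ⟨N, hN⟩ := ht
    have hg : IsUnit (algebraMap ξ.base S (g ^ N)) := by
      rw [map_pow]
      exact (IsLocalization.Away.algebraMap_isUnit g).pow N
    rw [Algebra.TensorProduct.tmul_pow, one_pow, ← hg.smul_eq_zero, algebraMap_smul,
      TensorProduct.smul_tmul', TensorProduct.smul_tmul, hN, TensorProduct.tmul_zero]
  let Ψ := AlgEquiv.ofBijective _ (Trunc.lift_bijective_of_isLocalization S hspan hind ht')
  let q : ξ.alg →ₐ[ξ.base] ξ.base := { ξ.sec with commutes' := ξ.sec_str }
  let q' : S ⊗[ξ.base] ξ.alg →ₐ[S] S := Algebra.TensorProduct.lift (AlgHom.id S S)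
    ((Algebra.ofId ξ.base S).comp q) fun _ _ => Commute.all _ _
  have hq' : q'.comp (Ψ : Trunc n S →ₐ[S] S ⊗[ξ.base] ξ.alg) = Trunc.pt n S := by
    refine Trunc.hom_ext ?_
    rw [Trunc.pt_t]
    change q' (Trunc.liftHom _ ht' (Trunc.t n S)) = 0
    rw [Trunc.liftHom_t, Algebra.TensorProduct.lift_tmul]
    change 1 * ringHom u (ξ.sec t) = 0
    rw [hqt, map_zero, mul_zero]
  refine ⟨⟨u, (Ψ.symm : S ⊗[ξ.base] ξ.alg →+* Trunc n S).comp
    Algebra.TensorProduct.includeRight.toRingHom, fun b => ?_, ?_⟩, rfl⟩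
  · change Trunc.pt n S (Ψ.symm (1 ⊗ₜ b)) = _
    rw [← hq']
    change q' (Ψ (Ψ.symm (1 ⊗ₜ b))) = _
    rw [Ψ.apply_symm_apply, Algebra.TensorProduct.lift_tmul]
    change 1 * ringHom u (ξ.sec b) = ringHom u (ξ.sec b)
    rw [one_mul]
  · have h := (CommRingCat.isPushout_tensorProduct ξ.base S ξ.alg).flip
    refine h.of_iso (Iso.refl _) (Iso.refl _) (Iso.refl _) Ψ.symm.toRingEquiv.toCommRingCatIso
      ?_ ?_ ?_ ?_
    · rfl
    · rfl
    · rfl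
    · ext s
      exact Ψ.symm.commutes s

/-- Pointed curvilinear algebras are Zariski-locally standard. -/
theorem zariskiLocally_of_standardPointedAlg {κ : Type u} [Field κ] {n : ℕ} [NeZero n]
    (hn : ((n - 1).factorial : κ) ≠ 0) {Q : PointedAlg κ n → Prop}
    (hQ : ∀ R, Q (standardPointedAlg κ n R)) (ξ : PointedAlg κ n) :
    ZariskiLocally (PointedAlg.toBase κ n) Q ξ := by
  let : Algebra ξ.base ξ.alg := ξ.str.toAlgebra
  let q : ξ.alg →ₐ[ξ.base] ξ.base := { ξ.sec with commutes' := ξ.sec_str }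
  have hn' : IsUnit ((n - 1).factorial : ξ.base) := by
    have := hn.isUnit.map (algebraMap κ ξ.base)
    rwa [map_natCast] at this
  have key := exists_trivialization (q := q) ξ.isFinLocFree ξ.isCurvilinear hn'
  let s : Set ξ.base := {g | ∃ t : ξ.alg, q t = 0 ∧
      (∀ b : ξ.alg, g • b ∈ Submodule.span ξ.base (Set.range fun i : Fin n => t ^ (i : ℕ))) ∧
      (∀ c : Fin n → ξ.base, ∑ i, c i • t ^ (i : ℕ) = 0 → ∀ i, ∃ N : ℕ, g ^ N * c i = 0) ∧
      ∃ N : ℕ, g ^ N • t ^ n = 0}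
  have hs : Ideal.span s = ⊤ := by
    by_contra hs
    obtain ⟨x, hx, hsx⟩ := Ideal.exists_le_maximal _ hs
    have := hx.isPrime
    obtain ⟨g, hgx, hg⟩ := key x
    exact hgx (hsx (Ideal.subset_span hg))
  refine ⟨s, hs, ?_⟩
  rintro (g : ξ.base) ⟨t, ht, h1, h2, h3⟩
  let S : CommAlgCat κ := CommAlgCat.of κ (Localization.Away (g : ξ.base))
  let u : ξ.base ⟶ S :=
    CommAlgCat.ofHom (IsScalarTower.toAlgHom κ ξ.base (Localization.Away (g : ξ.base)))
  have hloc : @IsLocalization.Away ξ.base _ g S _ (ringHom u).toAlgebra := by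
    have h : (ringHom u).toAlgebra = (inferInstance : Algebra ξ.base (Localization.Away g)) :=
      toAlgebra_algebraMap
    rw [h]
    exact (inferInstance : IsLocalization.Away g (Localization.Away g))
  obtain ⟨a, ha⟩ := exists_hom_standardPointedAlg ξ S u g hloc t ht h1 h2 h3
  refine ⟨standardPointedAlg κ n S, a, ?_, hQ S⟩
  change @IsLocalization.Away ξ.base _ g S _ (ringHom a.base).toAlgebra
  rw [ha]
  exact hloc

end LocalTriviality

/-! ### Extensions of the standard object -/

theorem Trunc.isCocartesian (n : ℕ) {R S : Type u} [CommRing R] [CommRing S] (u : R →+* S) :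
    IsCocartesian (algebraMap R (Trunc n R)) u (Trunc.map n u) (algebraMap S (Trunc n S)) := by
  let := u.toAlgebra
  let := (Trunc.map n u).toAlgebra
  have : IsScalarTower R (Trunc n R) (Trunc n S) :=
    .of_algebraMap_eq fun x => (Trunc.map_algebraMap n u x).symm
  have := (Trunc.isPushout n R S rfl).symm
  exact CommRingCat.isPushout_iff_isPushout.mpr this

theorem IsCocartesian.of_ringEquiv {A B A' B' C C' : Type u} [CommRing A] [CommRing B] [CommRing A']
    [CommRing B'] [CommRing C] [CommRing C'] {f : A →+* B} {u : A →+* A'} {v : B →+* B'}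
    {f' : A' →+* B'} (h : IsCocartesian f u v f') (e : B ≃+* C) (e' : B' ≃+* C') {g : A →+* C}
    {w : C →+* C'} {g' : A' →+* C'} (hg : ∀ a, e (f a) = g a) (hw : ∀ b, e' (v b) = w (e b))
    (hg' : ∀ a, e' (f' a) = g' a) : IsCocartesian g u w g' := by
  refine IsPushout.of_iso h (Iso.refl _) e.toCommRingCatIso (Iso.refl _) e'.toCommRingCatIso
    ?_ ?_ ?_ ?_
  · ext a
    exact hg a
  · rfl
  · ext b
    exact hw b
  · ext a
    exact hg' a

theorem IsCocartesian.hom_ext {A B A' B' C : Type u} [CommRing A] [CommRing B] [CommRing A']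
    [CommRing B'] [CommRing C] {f : A →+* B} {u : A →+* A'} {v : B →+* B'}
    {f' : A' →+* B'} (h : IsCocartesian f u v f') {g g' : B' →+* C}
    (hv : ∀ b, g (v b) = g' (v b)) (hf : ∀ a, g (f' a) = g' (f' a)) (x : B') : g x = g' x := by
  have : CommRingCat.ofHom g = CommRingCat.ofHom g' := IsPushout.hom_ext h
    (by ext b; exact hv b) (by ext a; exact hf a)
  exact congr($(this).hom x)

theorem IsCocartesian.exists_ringEquiv {A B A' B' C' : Type u} [CommRing A] [CommRing B]
    [CommRing A'] [CommRing B'] [CommRing C'] {f : A →+* B} {u : A →+* A'} {v : B →+* B'}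
    {f' : A' →+* B'} {w : B →+* C'} {g' : A' →+* C'} (h : IsCocartesian f u v f')
    (h' : IsCocartesian f u w g') :
    ∃ e : B' ≃+* C', (∀ b, e (v b) = w b) ∧ ∀ a, e (f' a) = g' a := by
  refine ⟨(IsPushout.isoIsPushout _ _ h h').commRingCatIsoToRingEquiv, fun b => ?_, fun a => ?_⟩
  · exact congr($(IsPushout.inl_isoIsPushout_hom _ _ h h').hom b)
  · exact congr($(IsPushout.inr_isoIsPushout_hom _ _ h h').hom a)

section Points

variable {κ : Type u} [Field κ] {N : ℕ} {R S T : CommAlgCat.{u} κ}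

/-- The point of the affine space over `R` with coordinates `c`. -/
noncomputable def pointHom (u : R ⟶ S) (c : Fin N → S) :
    CommAlgCat.of κ (MvPolynomial (Fin N) R) ⟶ S :=
  CommAlgCat.ofHom
    { MvPolynomial.eval₂Hom (ringHom u) c with
      commutes' := fun r => by
        change MvPolynomial.eval₂Hom (ringHom u) c (MvPolynomial.C (algebraMap κ R r)) = _
        rw [MvPolynomial.eval₂Hom_C]
        exact u.hom.commutes r }

theorem pointHom_C (u : R ⟶ S) (c : Fin N → S) (r : R) :
    (pointHom u c).hom (MvPolynomial.C r) = ringHom u r :=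
  MvPolynomial.eval₂Hom_C (ringHom u) c r

theorem pointHom_X (u : R ⟶ S) (c : Fin N → S) (i : Fin N) :
    (pointHom u c).hom (MvPolynomial.X i) = c i :=
  MvPolynomial.eval₂Hom_X' (ringHom u) c i

theorem affineSpaceHom_comp_pointHom (u : R ⟶ S) (c : Fin N → S) :
    affineSpaceHom N R ≫ pointHom u c = u :=
  CommAlgCat.hom_ext (AlgHom.ext fun r => pointHom_C u c r)

theorem affineSpace_hom_ext {f g : CommAlgCat.of κ (MvPolynomial (Fin N) R) ⟶ S}
    (h : affineSpaceHom N R ≫ f = affineSpaceHom N R ≫ g)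
    (hX : ∀ i, f.hom (MvPolynomial.X i) = g.hom (MvPolynomial.X i)) : f = g := by
  have : ringHom f = ringHom g := MvPolynomial.ringHom_ext (fun r => congr($(h).hom r)) hX
  exact CommAlgCat.hom_ext (AlgHom.ext fun x => congr($this x))

theorem pointHom_comp (u : R ⟶ S) (c : Fin N → S) (v : S ⟶ T) :
    pointHom u c ≫ v = pointHom (u ≫ v) fun i => ringHom v (c i) := by
  refine affineSpace_hom_ext ?_ fun i => ?_
  · rw [affineSpaceHom_comp_pointHom, ← Category.assoc, affineSpaceHom_comp_pointHom]
  · rw [pointHom_X]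
    exact congr_arg (ringHom v) (pointHom_X u c i)

end Points

section Chart

variable {κ : Type u} [Field κ] {m d : ℕ} [NeZero m] [NeZero d]
  {R : CommAlgCat.{u} κ}

/-- The category of extensions over `R`-algebras of the standard object. -/
abbrev StandardExt (κ : Type u) [Field κ] (m d : ℕ) [NeZero m] [NeZero d]
    (R : CommAlgCat.{u} κ) :=
  StructuredArrow (standardPointedAlg κ (m * d) R) (PointedExt.forgetSub κ m d)

namespace StandardExt

/-- The structure map of the base. -/
noncomputable def baseHom (Y : StandardExt κ m d R) : R ⟶ Y.right.base := PointedAlg.Hom.base Y.hom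

/-- The map from the standard algebra over `R`. -/
noncomputable def algHom (Y : StandardExt κ m d R) :
    Trunc (m * d) R →+* Y.right.alg := PointedAlg.Hom.alg Y.hom

theorem isCocartesian (Y : StandardExt κ m d R) :
    IsCocartesian (algebraMap R (Trunc (m * d) R)) (ringHom Y.baseHom) Y.algHom Y.right.str :=
  PointedAlg.Hom.isCocartesian Y.hom

theorem baseHom_comp {Y Z : StandardExt κ m d R} (g : Y ⟶ Z) :
    Y.baseHom ≫ g.right.base = Z.baseHom :=
  congr_arg PointedAlg.Hom.base (StructuredArrow.w g)

theorem algHom_comp {Y Z : StandardExt κ m d R} (g : Y ⟶ Z) (x : Trunc (m * d) R) :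
    g.right.alg (Y.algHom x) = Z.algHom x :=
  congr($(congr_arg PointedAlg.Hom.alg (StructuredArrow.w g)) x)

/-- The identification of an extension of the standard object with an extension of truncated
polynomial rings in normal form. -/
structure Chart (Y : StandardExt κ m d R) where
  alg : Y.right.alg ≃+* Trunc (m * d) Y.right.base
  alg_algHom : ∀ x, alg (Y.algHom x) = Trunc.map (m * d) (ringHom Y.baseHom) x
  alg_str : ∀ s, alg (Y.right.str s) = algebraMap _ _ s
  sub : Trunc m Y.right.base ≃+* Y.right.sub
  sub_algebraMap : ∀ s, sub (algebraMap _ _ s) = Y.right.subStr s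
  isNormal : IsNormal (alg (Y.right.incl (sub (Trunc.t m Y.right.base))))
  incl_injective : Function.Injective Y.right.incl
  eq_of_isNormal : ∀ a, IsNormal (alg (Y.right.incl a)) → a = sub (Trunc.t m Y.right.base)

theorem exists_chart (hmd : d = 1 ∨ (m : κ) ≠ 0) (Y : StandardExt κ m d R) :
    Nonempty Y.Chart := by
  obtain ⟨θ, h1, h2⟩ := Y.isCocartesian.exists_ringEquiv
    (Trunc.isCocartesian (m * d) (ringHom Y.baseHom))
  obtain ⟨e, he, hn, hinj, huniq⟩ := exists_frame (S := Y.right.base) (m := m) (d := d)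
    (hmd.imp_right fun h => by
      have := h.isUnit.map (algebraMap κ Y.right.base)
      rwa [map_natCast] at this)
    Y.right.subStr ((θ : Y.right.alg →+* Trunc (m * d) Y.right.base).comp Y.right.incl)
    (fun r => by
      change θ (Y.right.incl (Y.right.subStr r)) = _
      rw [Y.right.incl_subStr, h2])
    Y.right.sub_isFinLocFree (Y.right.incl_isFinLocFree.equiv_comp θ)
  exact ⟨⟨θ, h1, h2, e, he, hn, fun a b h => hinj (congr_arg θ h), huniq⟩⟩

namespace Chart

/-- The normal form of an extension. -/
noncomputable def elt {Y : StandardExt κ m d R} (c : Y.Chart) : Trunc (m * d) Y.right.base :=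
  c.alg (Y.right.incl (c.sub (Trunc.t m Y.right.base)))

theorem elt_isNormal {Y : StandardExt κ m d R} (c : Y.Chart) : IsNormal c.elt := c.isNormal

theorem alg_comp {Y Z : StandardExt κ m d R} (c : Y.Chart) (c' : Z.Chart) (g : Y ⟶ Z)
    (b : Y.right.alg) :
    c'.alg (g.right.alg b) = Trunc.map (m * d) (ringHom g.right.base) (c.alg b) := by
  refine Y.isCocartesian.hom_ext
    (g := (c'.alg : Z.right.alg →+* _).comp g.right.alg)
    (g' := (Trunc.map (m * d) (ringHom g.right.base)).comp (c.alg : Y.right.alg →+* _))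
    (fun x => ?_) (fun s => ?_) b
  · change c'.alg (g.right.alg (Y.algHom x)) =
      Trunc.map (m * d) (ringHom g.right.base) (c.alg (Y.algHom x))
    rw [algHom_comp, c'.alg_algHom, c.alg_algHom, Trunc.map_map, ← ringHom_comp, baseHom_comp]
  · change c'.alg (g.right.alg (Y.right.str s)) =
      Trunc.map (m * d) (ringHom g.right.base) (c.alg (Y.right.str s))
    rw [c.alg_str, Trunc.map_algebraMap, ← c'.alg_str]
    exact congr_arg c'.alg congr($(g.right.isCocartesian.w).hom s)

theorem elt_comp {Y Z : StandardExt κ m d R} (c : Y.Chart) (c' : Z.Chart) (g : Y ⟶ Z) :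
    c'.elt = Trunc.map (m * d) (ringHom g.right.base) c.elt := by
  have h : c'.alg (Z.right.incl (g.right.sub (c.sub (Trunc.t m Y.right.base)))) =
      Trunc.map (m * d) (ringHom g.right.base) c.elt := by
    rw [g.right.incl_comp, alg_comp c c' g]
    rfl
  rw [← h, elt, ← c'.eq_of_isNormal]
  rw [h]
  exact c.isNormal.map _

theorem sec_eq {Y : StandardExt κ m d R} (c : Y.Chart) (b : Y.right.alg) :
    Y.right.sec b = Trunc.pt (m * d) Y.right.base (c.alg b) := by
  refine Y.isCocartesian.hom_ext (g := Y.right.sec)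
    (g' := (Trunc.pt (m * d) Y.right.base : Trunc (m * d) Y.right.base →+* _).comp
      (c.alg : Y.right.alg →+* _)) (fun x => ?_) (fun s => ?_) b
  · change Y.right.sec (Y.algHom x) = Trunc.pt (m * d) Y.right.base (c.alg (Y.algHom x))
    rw [c.alg_algHom, Trunc.pt_map]
    exact PointedAlg.Hom.sec_comp Y.hom x
  · change Y.right.sec (Y.right.str s) = Trunc.pt (m * d) Y.right.base (c.alg (Y.right.str s))
    rw [c.alg_str, Y.right.sec_str]
    exact ((Trunc.pt (m * d) Y.right.base).commutes s).symm

theorem hom_ext {Y Z : StandardExt κ m d R} (c : Y.Chart) (c' : Z.Chart) {g g' : Y ⟶ Z}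
    (h : g.right.base = g'.right.base) : g = g' := by
  have halg : g.right.alg = g'.right.alg := RingHom.ext fun b => c'.alg.injective (by
    rw [alg_comp c c', alg_comp c c', h])
  refine StructuredArrow.hom_ext _ _ (PointedExt.Hom.ext h halg (RingHom.ext fun a =>
    c'.incl_injective ?_))
  rw [g.right.incl_comp, g'.right.incl_comp, halg]

theorem exists_hom {Y Z : StandardExt κ m d R} (c : Y.Chart) (c' : Z.Chart)
    (v : Y.right.base ⟶ Z.right.base) (hv : Y.baseHom ≫ v = Z.baseHom)
    (h : c'.elt = Trunc.map (m * d) (ringHom v) c.elt) : ∃ g : Y ⟶ Z, g.right.base = v := by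
  let α : Y.right.alg →+* Z.right.alg := (c'.alg.symm : Trunc (m * d) Z.right.base →+* _).comp
    ((Trunc.map (m * d) (ringHom v)).comp (c.alg : Y.right.alg →+* _))
  let β : Y.right.sub →+* Z.right.sub := (c'.sub : Trunc m Z.right.base →+* _).comp
    ((Trunc.map m (ringHom v)).comp (c.sub.symm : Y.right.sub →+* _))
  have hα (b) : c'.alg (α b) = Trunc.map (m * d) (ringHom v) (c.alg b) :=
    c'.alg.apply_symm_apply _
  have hβ (x) : β (c.sub x) = c'.sub (Trunc.map m (ringHom v) x) :=
    congr_arg (fun y => c'.sub (Trunc.map m (ringHom v) y)) (c.sub.symm_apply_apply x)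
  have hcomp : ((c'.alg : Z.right.alg →+* _).comp (Z.right.incl.comp
      ((c'.sub : Trunc m Z.right.base →+* _).comp (Trunc.map m (ringHom v))))) =
      (Trunc.map (m * d) (ringHom v)).comp ((c.alg : Y.right.alg →+* _).comp
        (Y.right.incl.comp (c.sub : Trunc m Y.right.base →+* _))) := by
    refine Trunc.ringHom_ext (fun s => ?_) ?_
    · change c'.alg (Z.right.incl (c'.sub (Trunc.map m (ringHom v) (algebraMap _ _ s)))) =
        Trunc.map (m * d) (ringHom v) (c.alg (Y.right.incl (c.sub (algebraMap _ _ s))))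
      rw [Trunc.map_algebraMap, c'.sub_algebraMap, c.sub_algebraMap, Z.right.incl_subStr,
        Y.right.incl_subStr, c'.alg_str, c.alg_str, Trunc.map_algebraMap]
    · change c'.alg (Z.right.incl (c'.sub (Trunc.map m (ringHom v) (Trunc.t m _)))) = _
      rw [Trunc.map_t]
      exact h
  let f : Y.right ⟶ Z.right := PointedExt.Hom.mk
    (PointedAlg.Hom.mk v α (fun b => by rw [sec_eq c', hα, Trunc.pt_map, sec_eq c])
      ((Trunc.isCocartesian (m * d) (ringHom v)).of_ringEquiv c.alg.symm c'.alg.symm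
        (fun s => by rw [← c.alg_str, RingEquiv.symm_apply_apply])
        (fun x => by
          apply c'.alg.injective
          rw [hα, RingEquiv.apply_symm_apply, RingEquiv.apply_symm_apply])
        (fun s => by rw [← c'.alg_str, RingEquiv.symm_apply_apply])))
    β
    (fun a => by
      obtain ⟨x, rfl⟩ := c.sub.surjective a
      apply c'.alg.injective
      rw [hα, hβ]
      exact congr($hcomp x))
    ((Trunc.isCocartesian m (ringHom v)).of_ringEquiv c.sub c'.sub c.sub_algebraMap
      (fun x => (hβ x).symm) c'.sub_algebraMap)
  have hf : Y.hom ≫ (PointedExt.forgetSub κ m d).map f = Z.hom := by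
    have h1 (x : Trunc (m * d) R) : α (Y.algHom x) = Z.algHom x := by
      apply c'.alg.injective
      rw [hα, c.alg_algHom, c'.alg_algHom, Trunc.map_map, ← ringHom_comp, hv]
    exact PointedAlg.Hom.ext hv (RingHom.ext h1)
  exact ⟨StructuredArrow.homMk f hf, rfl⟩

end Chart

/-- The extension of `S[t]/(t^{md})` by `S[t]/(t^m)` with given normal form. -/
noncomputable def _root_.Curvilinear.normalExt {S : CommAlgCat.{u} κ} (s : Trunc (m * d) S)
    (hs : IsNormal s) : PointedExt κ m d where
  toPointedAlg := standardPointedAlg κ (m * d) S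
  sub := CommRingCat.of (Trunc m S)
  subStr := algebraMap S (Trunc m S)
  incl := (normalHom s hs).toRingHom
  incl_subStr := (normalHom s hs).commutes
  sub_isFinLocFree := Trunc.algebraMap_isFinLocFree m S
  incl_isFinLocFree := normalHom_isFinLocFree s hs

/-- The extension of the standard object with given normal form. -/
noncomputable def ofNormal {S : CommAlgCat.{u} κ} (u : R ⟶ S) (s : Trunc (m * d) S)
    (hs : IsNormal s) : StandardExt κ m d R :=
  StructuredArrow.mk (S := standardPointedAlg κ (m * d) R) (T := PointedExt.forgetSub κ m d)
    (Y := normalExt s hs)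
    (PointedAlg.Hom.mk (X := standardPointedAlg κ (m * d) R) (Y := standardPointedAlg κ (m * d) S)
      u (Trunc.map (m * d) (ringHom u)) (Trunc.pt_map (m * d) (ringHom u))
      (Trunc.isCocartesian (m * d) (ringHom u)))

theorem Chart.elt_ofNormal {S : CommAlgCat.{u} κ} (u : R ⟶ S) (s : Trunc (m * d) S)
    (hs : IsNormal s) (c : (ofNormal u s hs).Chart) : c.elt = s := by
  let θ : Trunc (m * d) S ≃+* Trunc (m * d) S := c.alg
  have h : (θ : Trunc (m * d) S →+* Trunc (m * d) S) = RingHom.id _ :=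
    Trunc.ringHom_ext c.alg_str (by
      have h1 : θ (Trunc.map (m * d) (ringHom u) (Trunc.t (m * d) R)) =
        Trunc.map (m * d) (ringHom u) (Trunc.t (m * d) R) := c.alg_algHom (Trunc.t (m * d) R)
      rw [Trunc.map_t] at h1
      exact h1)
  have h2 : θ (normalHom s hs (Trunc.t m S)) = s := by
    rw [normalHom_t]
    exact congr($h s)
  have h3 := c.eq_of_isNormal (Trunc.t m S) (by
    change IsNormal (θ (normalHom s hs (Trunc.t m S)))
    rw [h2]
    exact hs)
  refine Eq.trans ?_ h2
  exact congr_arg (fun a : Trunc m S => θ (normalHom s hs a)) h3.symm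

/-- The functor that sends an extension of the standard object to the coordinates of its normal
form. -/
noncomputable def coordFunctor (c : ∀ Y : StandardExt κ m d R, Y.Chart) :
    StandardExt κ m d R ⥤
      Under (CommAlgCat.of κ (MvPolynomial (Fin ((m - 1) * (d - 1))) R)) where
  obj Y := Under.mk (pointHom Y.baseHom (normalCoords (c Y).elt))
  map {Y Z} g := Under.homMk g.right.base (by
    change pointHom _ _ ≫ g.right.base = pointHom _ _
    rw [pointHom_comp, baseHom_comp, Chart.elt_comp (c Y) (c Z) g]
    congr 1
    funext i
    rw [normalCoords_map])
  map_id _ := rfl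
  map_comp _ _ := rfl

theorem Chart.exists_hom_of_pointHom {Y Z : StandardExt κ m d R} (c : Y.Chart) (c' : Z.Chart)
    (v : Y.right.base ⟶ Z.right.base)
    (h : pointHom Y.baseHom (normalCoords c.elt) ≫ v =
      pointHom Z.baseHom (normalCoords c'.elt)) : ∃ g : Y ⟶ Z, g.right.base = v := by
  have hv : Y.baseHom ≫ v = Z.baseHom := by
    rw [← affineSpaceHom_comp_pointHom Z.baseHom (normalCoords c'.elt), ← h,
      ← Category.assoc, affineSpaceHom_comp_pointHom]
  refine Chart.exists_hom c c' v hv ?_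
  rw [← normalElt_normalCoords c'.elt_isNormal, ← normalElt_normalCoords c.elt_isNormal,
    map_normalElt]
  congr 1
  funext i
  rw [← pointHom_X Z.baseHom (normalCoords c'.elt), ← h, pointHom_comp, pointHom_X]

theorem coordFunctor_isEquivalence (c : ∀ Y : StandardExt κ m d R, Y.Chart) :
    (coordFunctor c).IsEquivalence where
  faithful := ⟨fun {Y Z} g g' h => Chart.hom_ext (c Y) (c Z) (congr_arg (fun f => f.right) h)⟩
  full := ⟨fun {Y Z} f => by
    obtain ⟨g, hg⟩ := Chart.exists_hom_of_pointHom (c Y) (c Z) f.right (Under.w f)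
    exact ⟨g, Under.UnderMorphism.ext hg⟩⟩
  essSurj := ⟨fun P => by
    let x : Fin ((m - 1) * (d - 1)) → P.right := fun i => P.hom.hom (MvPolynomial.X i)
    let u : R ⟶ P.right := affineSpaceHom _ R ≫ P.hom
    let Y : StandardExt κ m d R := ofNormal u (normalElt m d x) (normalElt_isNormal x)
    have h1 : pointHom Y.baseHom (normalCoords (c Y).elt) = pointHom u x :=
      congr_arg (pointHom u) ((congr_arg normalCoords (Chart.elt_ofNormal u _ _ (c Y))).trans
        (normalCoords_normalElt x))
    have h2 : pointHom u x = P.hom :=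
      affineSpace_hom_ext (affineSpaceHom_comp_pointHom u x) (pointHom_X u x)
    exact ⟨Y, ⟨Under.isoMk (Iso.refl _) ((Category.comp_id _).trans (h1.trans h2))⟩⟩⟩

end StandardExt

/-- The structure morphism of an extension in terms of its coordinates. -/
noncomputable def StandardExt.coordIso (Y : StandardExt κ m d R)
    (c : ∀ Y : StandardExt κ m d R, Y.Chart) :
    (Under.map (affineSpaceHom ((m - 1) * (d - 1)) R)).obj ((coordFunctor c).obj Y) ≅
      (fiberProductToBase (PointedAlg.toBase κ (m * d)) (PointedExt.forgetSub κ m d)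
        (standardPointedAlg κ (m * d) R)).obj Y :=
  Under.isoMk (Iso.refl Y.right.base)
    ((Category.comp_id _).trans (affineSpaceHom_comp_pointHom Y.baseHom (normalCoords (c Y).elt)))

theorem isTrivialOver_standardPointedAlg (hmd : d = 1 ∨ (m : κ) ≠ 0) (R : CommAlgCat.{u} κ) :
    IsTrivialOver (PointedAlg.toBase κ (m * d)) (PointedExt.forgetSub κ m d)
      ((m - 1) * (d - 1)) (standardPointedAlg κ (m * d) R) := by
  let c (Y : StandardExt κ m d R) : Y.Chart := (StandardExt.exists_chart hmd Y).some
  have := StandardExt.coordFunctor_isEquivalence c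
  refine ⟨(StandardExt.coordFunctor c).asEquivalence, ⟨NatIso.ofComponents
    (fun Y => StandardExt.coordIso Y c) fun {Y Z} g => ?_⟩⟩
  refine Under.UnderMorphism.ext ?_
  exact (Category.comp_id g.right.base).trans (Category.id_comp g.right.base).symm

end Chart

end Curvilinear

theorem mainTheorem9 (κ : Type u) [Field κ] (m d : ℕ) [NeZero m] [NeZero d] :
    Curvilinear.IsAffineSpace κ (Curvilinear.V κ m d) ((m - 1) * (d - 1)) ∧
    ((d = 1 ∨ (m : κ) ≠ 0) → (Curvilinear.V.toQuotient κ m d).IsEquivalence) ∧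
    ((Nat.factorial (m * d - 1) : κ) ≠ 0 →
      Curvilinear.IsAffineBundle (Curvilinear.PointedAlg.toBase κ (m * d))
        (Curvilinear.PointedExt.forgetSub κ m d) ((m - 1) * (d - 1)) ∧
      (∀ R : CommAlgCat.{u} κ, ∃ ξ : Curvilinear.PointedAlg κ (m * d),
        ξ.base = R ∧ ξ.IsStandard) ∧
      ∀ ξ : Curvilinear.PointedAlg κ (m * d),
        Curvilinear.ZariskiLocally (Curvilinear.PointedAlg.toBase κ (m * d))
          Curvilinear.PointedAlg.IsStandard ξ) := by
  refine ⟨Curvilinear.V_isAffineSpace, Curvilinear.V_toQuotient_isEquivalence, fun h =>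
    ⟨fun ξ => ?_, fun R => ⟨Curvilinear.standardPointedAlg κ (m * d) R, rfl,
      Curvilinear.standardPointedAlg_isStandard κ (m * d) R⟩,
    Curvilinear.zariskiLocally_of_standardPointedAlg h
      (Curvilinear.standardPointedAlg_isStandard κ (m * d))⟩⟩
  refine Curvilinear.zariskiLocally_of_standardPointedAlg h
    (Curvilinear.isTrivialOver_standardPointedAlg ?_) ξ
  by_cases hd : d = 1
  · exact Or.inl hd
  · right
    intro hm
    obtain ⟨c, hc⟩ : m ∣ (m * d - 1).factorial := by
      have hm0 := NeZero.pos m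
      have h2 : m * 2 ≤ m * d := Nat.mul_le_mul_left m (by have := NeZero.pos d; omega)
      exact Nat.dvd_factorial hm0 (by omega)
    rw [hc, Nat.cast_mul, hm, zero_mul] at h
    exact h rfl
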